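/- Let $B_n$ be the braid group on $n$ strands, with the Artin generators $s_1,\dots,s_{n-1}$, their inverses $\bar s_i=s_i^{-1}$, and the relations $s_is_js_i=s_js_is_j$ for $|i-j|=1$, $s_is_j=s_js_i$ for $|i-j|>1$. Let $C_n=\mathbb Q(t_0,t_1)[B_n]/(R_1,R_2,R_3)$ be the quotient of the group algebra of $B_n$ over the field $\mathbb Q(t_0,t_1)$ of rational functions in two variables by the two-sided ideal generated by the following relations, where all indices lie in $\{1,\dots,n-1\}$: $(R_1)$ for every $i$, $$s_i^2+(1-t_0-t_1)\,s_i+(t_0t_1-t_0-t_1)\,1+t_0t_1\,\bar s_i=0;$$ $(R_2)$ for all $i,j$ with $|i-j|=1$, $$\bar s_i s_j s_i-s_i s_j\bar s_i-\bar s_i\bar s_j s_i+s_i\bar s_j\bar s_i=s_is_j-s_i\bar s_j-\bar s_is_j+\bar s_i\bar s_j-s_js_i+s_j\bar s_i+\bar s_js_i-\bar s_j\bar s_i;$$ $(R_3)$ for all $i,j,k$ with $j=i+1$ and $k=i+2$, $$s_i\bar s_k s_j\bar s_k-\bar s_k s_j\bar s_k s_i=\sum_{l=1}^{78}a_l w_l,$$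 where the words $w_1,\dots,w_{78}$ are, in this order, $s_i s_j,\ s_i \bar s_j,\ s_j s_i,\ \bar s_j s_i,\ s_k s_j,\ \bar s_k s_j,\ s_k \bar s_j,\ \bar s_k \bar s_j,\ s_j s_k,\ \bar s_j s_k,\ s_j \bar s_k,\ \bar s_j \bar s_k,\ s_i s_k s_j$, $s_i s_k \bar s_j,\ s_i \bar s_k s_j,\ s_i \bar s_k \bar s_j,\ \bar s_i s_k s_j,\ \bar s_i s_k \bar s_j,\ \bar s_i \bar s_k s_j,\ \bar s_i \bar s_k \bar s_j,\ s_i s_j s_k,\ s_i s_j \bar s_k,\ s_i \bar s_j s_k,\ s_i \bar s_j \bar s_k,\ \bar s_i s_j s_k,\ \bar s_i s_j \bar s_k$, $\bar s_i \bar s_j s_k,\ \bar s_i \bar s_j \bar s_k,\ s_j s_i s_k,\ s_j s_i \bar s_k,\ s_j \bar s_i s_k,\ s_j \bar s_i \bar s_k,\ \bar s_j s_i s_k,\ \bar s_j s_i \bar s_k,\ \bar s_j \bar s_i s_k,\ \bar s_j \bar s_i \bar s_k,\ s_k s_j s_i,\ s_k s_j \bar s_i,\ s_k \bar s_j s_i$,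 $s_k \bar s_j \bar s_i,\ \bar s_k s_j s_i,\ \bar s_k s_j \bar s_i,\ \bar s_k \bar s_j s_i,\ \bar s_k \bar s_j \bar s_i,\ s_k \bar s_i \bar s_j \bar s_i,\ \bar s_k \bar s_i \bar s_j \bar s_i,\ s_k \bar s_i \bar s_j s_i,\ \bar s_k \bar s_i \bar s_j s_i,\ s_k \bar s_i s_j \bar s_i,\ \bar s_k \bar s_i s_j \bar s_i,\ s_k s_i \bar s_j \bar s_i,\ \bar s_k s_i \bar s_j \bar s_i$, $s_k s_i \bar s_j s_i,\ \bar s_k s_i \bar s_j s_i,\ s_k s_i s_j \bar s_i,\ \bar s_k s_i s_j \bar s_i,\ \bar s_i \bar s_j \bar s_i s_k,\ \bar s_i \bar s_j \bar s_i \bar s_k,\ \bar s_i \bar s_j s_i s_k,\ \bar s_i \bar s_j s_i \bar s_k,\ \bar s_i s_j \bar s_i s_k,\ \bar s_i s_j \bar s_i \bar s_k,\ s_i \bar s_j \bar s_i s_k,\ s_i \bar s_j \bar s_i \bar s_k,\ s_i \bar s_j s_i s_k$, $s_i \bar s_j s_i \bar s_k,\ s_i s_j \bar s_i s_k,\ s_i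 s_j \bar s_i \bar s_k,\ s_i \bar s_j \bar s_k s_j,\ s_i \bar s_j s_k \bar s_j,\ s_i s_j \bar s_k \bar s_j,\ s_i s_j \bar s_k s_j,\ s_i s_j s_k \bar s_j,\ \bar s_j \bar s_k s_j s_i,\ \bar s_j s_k \bar s_j s_i,\ s_j \bar s_k \bar s_j s_i,\ s_j \bar s_k s_j s_i,\ s_j s_k \bar s_j s_i$; and where, with the abbreviations $A=t_0+t_1$, $M=t_0t_1+1$, $N=t_0t_1-1$, $E=(1+t_0)(1+t_1)$, $P=1 + t_1 t_0 + t_1^2 t_0 + t_1 t_0^2$, $Q=t_1 + t_0 + t_1 t_0 + t_1^2 t_0^2$, $S=t_1 - t_1^2 + t_0 - t_1 t_0 + t_1^2 t_0 - t_0^2 + t_1 t_0^2 + t_1^2 t_0^2$, $T=-t_1^2 - t_1 t_0 - t_1^2 t_0 - t_0^2 - t_1 t_0^2 + t_1^2 t_0^2$, $U=t_1^2 + t_1 t_0 + t_0^2 - t_1^2 t_0^2 + t_1^3 t_0^2 + t_1^2 t_0^3$, $V=t_1^2 + t_1^2 t_0 + t_0^2 + t_1 t_0^2$, $W=-t_1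 - t_0 - 2 t_1 t_0 - t_1^2 t_0 - t_1 t_0^2 + t_1^3 t_0^2 + t_1^2 t_0^3$, the coefficients are $a_{1}=-\frac{(t_1 - 1) (t_0 - 1) W}{t_0 t_1 A N M}$, $a_{2}=-\frac{(t_1 - 1) (t_0 - 1) (t_1 + t_0 + 2 t_1 t_0)}{A N M}$, $a_{3}=\frac{(t_1 - 1) (t_0 - 1) W}{t_0 t_1 A N M}$, $a_{4}=\frac{(t_1 - 1) (t_0 - 1) (t_1 + t_0 + 2 t_1 t_0)}{A N M}$, $a_{5}=\frac{P}{t_0 t_1 E M}$, $a_{6}=-\frac{Q}{t_0 t_1 E M}$, $a_{7}=-\frac{P S}{t_0 t_1 E A M}$, $a_{8}=\frac{Q S}{t_0 t_1 E A M}$, $a_{9}=-\frac{P}{t_0 t_1 E M}$, $a_{10}=\frac{P S}{t_0 t_1 E A M}$, $a_{11}=\frac{Q}{t_0 t_1 E M}$, $a_{12}=-\frac{Q S}{t_0 t_1 E A M}$, $a_{13}=\frac{T}{t_0 t_1 E A M}$, $a_{14}=\frac{-t_1 + t_1^2 - t_0 + t_1 t_0 + t_1^2 t_0 + t_0^2 +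 t_1 t_0^2 - t_1^2 t_0^2 + 2 t_1^3 t_0^2 + t_1^4 t_0^2 + 2 t_1^2 t_0^3 + 2 t_1^3 t_0^3 + t_1^4 t_0^3 + t_1^2 t_0^4 + t_1^3 t_0^4}{t_0 t_1 E A M}$, $a_{15}=-\frac{-t_1^3 - t_1 t_0 - t_1^4 t_0 - t_1^2 t_0^2 - t_0^3 + t_1^4 t_0^3 - t_1 t_0^4 + t_1^3 t_0^4}{t_0 t_1 E A M}$, $a_{16}=-\frac{-t_1^2 + t_1^3 - t_1 t_0 + t_1^2 t_0 + t_1^3 t_0 - t_0^2 + t_1 t_0^2 + 3 t_1^2 t_0^2 + t_1^4 t_0^2 + t_0^3 + t_1 t_0^3 + 2 t_1^3 t_0^3 + t_1^4 t_0^3 + t_1^2 t_0^4 + t_1^3 t_0^4}{t_0 t_1 E A M}$, $a_{17}=-\frac{P}{E A M}$, $a_{18}=-\frac{(t_1 + t_0 - 1) P}{E A M}$, $a_{19}=\frac{Q}{E A M}$, $a_{20}=\frac{(t_1 + t_0 - 1) Q}{E A M}$, $a_{21}=-\frac{Q}{t_0 t_1 E A M}$, $a_{22}=-\frac{-t_1^2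 - t_1 t_0 - t_1^4 t_0 - t_0^2 + t_1^2 t_0^2 - t_1^3 t_0^2 - t_1^2 t_0^3 + t_1^4 t_0^3 - t_1 t_0^4 + t_1^3 t_0^4}{t_0 t_1 E A M}$, $a_{23}=\frac{t_1 - t_1^2 + t_0 - t_1 t_0 - t_1^4 t_0 - t_0^2 + t_1^2 t_0^2 - 2 t_1^3 t_0^2 - 2 t_1^2 t_0^3 + t_1^4 t_0^3 - t_1 t_0^4 + t_1^3 t_0^4}{t_0 t_1 E A M}$, $a_{24}=-\frac{(t_1 + t_0 - 1) T}{t_0 t_1 E A M}$, $a_{25}=\frac{P}{E A M}$, $a_{26}=-\frac{Q}{E A M}$, $a_{27}=\frac{(t_1 + t_0 - 1) P}{E A M}$, $a_{28}=-\frac{(t_1 + t_0 - 1) Q}{E A M}$, $a_{29}=\frac{(1 + t_1) (1 + t_0)}{A N M}$, $a_{30}=\frac{-1 - 2 t_1 + t_1^2 - 2 t_0 + t_1 t_0 - t_1^3 t_0 + t_0^2 - 2 t_1^2 t_0^2 + t_1^3 t_0^2 - t_1 t_0^3 + t_1^2 t_0^3}{A N M}$, $a_{31}=\frac{P T}{t_0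 t_1 E A N M}$, $a_{32}=-\frac{Q T}{t_0 t_1 E A N M}$, $a_{33}=-\frac{t_1 + t_0 + t_1 t_0 + t_1^2 t_0 + t_1^3 t_0 + t_1 t_0^2 + 4 t_1^2 t_0^2 - t_1^4 t_0^2 + t_1 t_0^3 - t_1^3 t_0^3 + t_1^4 t_0^3 + t_1^5 t_0^3 - t_1^2 t_0^4 + t_1^3 t_0^4 + 2 t_1^4 t_0^4 + t_1^5 t_0^4 + t_1^3 t_0^5 + t_1^4 t_0^5}{t_0 t_1 E A N M}$, $a_{34}=\frac{t_1^2 + 3 t_1 t_0 + 2 t_1^2 t_0 - t_1^3 t_0 + t_0^2 + 2 t_1 t_0^2 + t_1^3 t_0^2 - t_1 t_0^3 + t_1^2 t_0^3 + t_1^3 t_0^3 + t_1^5 t_0^3 + 2 t_1^4 t_0^4 + t_1^5 t_0^4 + t_1^3 t_0^5 + t_1^4 t_0^5}{t_0 t_1 E A N M}$, $a_{35}=\frac{P U}{t_0 t_1 E A N M}$, $a_{36}=-\frac{Q U}{t_0 t_1 E A N M}$, $a_{37}=-\frac{Q}{t_0 t_1 A N M}$, $a_{38}=-\frac{P T}{t_0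 t_1 E A N M}$, $a_{39}=\frac{t_1 + t_0 + t_1 t_0 + 2 t_1^2 t_0 + t_1^3 t_0 - t_1^4 t_0 + 2 t_1 t_0^2 + 4 t_1^2 t_0^2 - t_1^3 t_0^2 + t_1^5 t_0^2 + t_1 t_0^3 - t_1^2 t_0^3 + t_1^3 t_0^3 + 3 t_1^4 t_0^3 - t_1 t_0^4 + 3 t_1^3 t_0^4 - t_1^5 t_0^4 + t_1^2 t_0^5 - t_1^4 t_0^5}{t_0 t_1 E A N M}$, $a_{40}=-\frac{P U}{t_0 t_1 E A N M}$, $a_{41}=\frac{t_1^2 + 3 t_1 t_0 - t_1^2 t_0 + t_0^2 - t_1 t_0^2 + t_1^2 t_0^2 + t_1^3 t_0^2 - t_1^4 t_0^2 + t_1^2 t_0^3 - 2 t_1^3 t_0^3 + t_1^4 t_0^3 - t_1^2 t_0^4 + t_1^3 t_0^4}{t_0 t_1 A N M}$, $a_{42}=\frac{Q T}{t_0 t_1 E A N M}$, $a_{43}=-\frac{t_1^2 + 3 t_1 t_0 + 2 t_1^2 t_0 - t_1^3 t_0 + t_0^2 + 2 t_1 t_0^2 + 2 t_1^3 t_0^2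 + t_1^4 t_0^2 - t_1 t_0^3 + 2 t_1^2 t_0^3 + 3 t_1^3 t_0^3 + t_1^2 t_0^4}{t_0 t_1 E A N M}$, $a_{44}=\frac{Q U}{t_0 t_1 E A N M}$, $a_{45}=\frac{P Q}{E A N M}$, $a_{46}=-\frac{Q^2}{E A N M}$, $a_{47}=\frac{P}{E A M}$, $a_{48}=-\frac{Q}{E A M}$, $a_{49}=-\frac{(t_1 + t_0 + 2 t_1 t_0) P}{E A N M}$, $a_{50}=\frac{(t_1 + t_0 + 2 t_1 t_0) Q}{E A N M}$, $a_{51}=\frac{P T}{t_0 t_1 E A N M}$, $a_{52}=-\frac{Q T}{t_0 t_1 E A N M}$, $a_{53}=-\frac{(t_1 + t_0 + t_1 t_0) P}{t_0 t_1 E A M}$, $a_{54}=\frac{(t_1 + t_0 + t_1 t_0) Q}{t_0 t_1 E A M}$, $a_{55}=\frac{P V}{t_0 t_1 E A N M}$, $a_{56}=-\frac{V Q}{t_0 t_1 E A N M}$, $a_{57}=-\frac{P Q}{E A N M}$, $a_{58}=\frac{Q^2}{E A N M}$, $a_{59}=-\frac{P}{E A M}$, $a_{60}=\frac{Q}{E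 A M}$, $a_{61}=\frac{(t_1 + t_0 + 2 t_1 t_0) P}{E A N M}$, $a_{62}=-\frac{(t_1 + t_0 + 2 t_1 t_0) Q}{E A N M}$, $a_{63}=-\frac{P T}{t_0 t_1 E A N M}$, $a_{64}=\frac{Q T}{t_0 t_1 E A N M}$, $a_{65}=\frac{(t_1 + t_0 + t_1 t_0) P}{t_0 t_1 E A M}$, $a_{66}=-\frac{(t_1 + t_0 + t_1 t_0) Q}{t_0 t_1 E A M}$, $a_{67}=-\frac{P V}{t_0 t_1 E A N M}$, $a_{68}=\frac{V Q}{t_0 t_1 E A N M}$, $a_{69}=\frac{1}{A}$, $a_{70}=\frac{t_1 t_0}{M}$, $a_{71}=\frac{(t_1 - 1) (1 + t_1) (t_0 - 1) (1 + t_0)}{A N M}$, $a_{72}=-\frac{1}{M}$, $a_{73}=\frac{t_1^2 + t_0^2 - 2}{A N M}$, $a_{74}=-\frac{1}{A}$, $a_{75}=-\frac{t_1 t_0}{M}$, $a_{76}=-\frac{(t_1 - 1) (1 + t_1) (t_0 - 1) (1 + t_0)}{A N M}$, $a_{77}=\frac{1}{M}$, $a_{78}=-\frac{t_1^2 + t_0^2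 - 2}{A N M}$. For $m\le n$ the inclusion $B_m\to B_n$, $s_i\mapsto s_i$ (adding vertical strands on the right), induces a natural map $C_m\to C_n$; below, $C_m$ also denotes its image in $C_n$, and $XgY$ denotes the linear span of all products $xgy$ with $x\in X$, $y\in Y$. **Theorem.** For every $n\ge 3$ there is an equality of $\mathbb Q(t_0,t_1)$-vector spaces $$C_n=C_{n-1}+C_{n-1}\,s_{n-1}\,C_{n-1}+C_{n-1}\,\bar s_{n-1}\,C_{n-1}+C_{n-2}\,\bar s_{n-1}s_{n-2}\bar s_{n-1},$$ and it is given by an effective reduction algorithm: there is an algorithm (a computable function) that takes as input $n\ge 3$ and a word $\beta$ in $s_1^{\pm1},\dots,s_{n-1}^{\pm1}$, and returns an explicit finite $\mathbb Q(t_0,t_1)$-linear combination of words, which represents the same element of $C_n$ as $\beta$ and in which each word has one of the forms $u$, $u\,s_{n-1}v$, $u\,\bar s_{n-1}v$ with $u,v$ words in $s_1^{\pm1},\dots,s_{n-2}^{\pm1}$, or $u\,\bar s_{n-1}s_{n-2}\bar s_{n-1}$ with $u$ a word in $s_1^{\pm1},\dots,s_{n-3}^{\pm1}$. In particular, $C_n$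 is a finite-dimensional $\mathbb Q(t_0,t_1)$-vector space for every $n$. -/

import Mathlib

namespace LinksGould

noncomputable section

/-! ### Braid groups -/

/-- Indices of the Artin generators `s_1, …, s_{n-1}` of the braid group on `n` strands. -/
abbrev BraidGen (n : ℕ) : Type := {i : ℕ // 1 ≤ i ∧ i < n}

/-- The Artin relations: `s_i s_j s_i = s_j s_i s_j` for `|i - j| = 1`, and
`s_i s_j = s_j s_i` for `|i - j| > 1` (both are symmetric in `i` and `j`). -/
def braidRels (n : ℕ) : Set (FreeGroup (BraidGen n)) :=
  {r | ∃ i j : BraidGen n, i.1 + 1 = j.1 ∧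
      r = FreeGroup.of i * FreeGroup.of j * FreeGroup.of i *
        (FreeGroup.of j * FreeGroup.of i * FreeGroup.of j)⁻¹} ∪
  {r | ∃ i j : BraidGen n, i.1 + 1 < j.1 ∧
      r = FreeGroup.of i * FreeGroup.of j * (FreeGroup.of j * FreeGroup.of i)⁻¹}

/-- The braid group `B_n` on `n` strands, in the Artin presentation. -/
abbrev BraidGroup (n : ℕ) : Type := PresentedGroup (braidRels n)

/-- The Artin generator `s_i` of `B_n` for `1 ≤ i ≤ n - 1` (and `1` for all other `i`). -/
def sigma (n i : ℕ) : BraidGroup n :=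
  if h : 1 ≤ i ∧ i < n then PresentedGroup.of ⟨i, h⟩ else 1

theorem lift_braidRels {m n : ℕ} (h : m ≤ n) :
    ∀ r ∈ braidRels m, FreeGroup.lift (fun i : BraidGen m => sigma n i.1) r = 1 := by
  have key : ∀ i : BraidGen m, sigma n i.1 =
      PresentedGroup.mk (braidRels n) (FreeGroup.of ⟨i.1, i.2.1, i.2.2.trans_le h⟩) := by
    intro i
    have hi : 1 ≤ i.1 ∧ i.1 < n := ⟨i.2.1, i.2.2.trans_le h⟩
    simp only [sigma, dif_pos hi]
    rfl
  rintro r (⟨i, j, hij, rfl⟩ | ⟨i, j, hij, rfl⟩)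
  · simp only [map_mul, map_inv, FreeGroup.lift_apply_of, key]
    simp only [← map_mul, ← map_inv]
    exact PresentedGroup.one_of_mem (Or.inl ⟨_, _, hij, rfl⟩)
  · simp only [map_mul, map_inv, FreeGroup.lift_apply_of, key]
    simp only [← map_mul, ← map_inv]
    exact PresentedGroup.one_of_mem (Or.inr ⟨_, _, hij, rfl⟩)

/-- The inclusion `B_m → B_n`, for `m ≤ n`, that adds `n - m` vertical strands on the right: it
sends `s_i` to `s_i`. -/
def braidIncl {m n : ℕ} (h : m ≤ n) : BraidGroup m →* BraidGroup n :=
  PresentedGroup.toGroup (lift_braidRels h)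

theorem braidIncl_sigma {m n : ℕ} (h : m ≤ n) {i : ℕ} (hi : 1 ≤ i ∧ i < m) :
    braidIncl h (sigma m i) = sigma n i := by
  rw [sigma, dif_pos hi]
  exact PresentedGroup.toGroup.of _

/-! ### The skein relations -/

/-- The field `ℚ(t₀, t₁)` of rational functions in two variables. -/
abbrev K : Type := FractionRing (MvPolynomial (Fin 2) ℚ)

/-- The variable `t₀`. -/
def t₀ : K := algebraMap (MvPolynomial (Fin 2) ℚ) K (MvPolynomial.X 0)

/-- The variable `t₁`. -/
def t₁ : K := algebraMap (MvPolynomial (Fin 2) ℚ) K (MvPolynomial.X 1)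

/-- The basis element of the group algebra `ℚ(t₀, t₁)[G]` given by a group element. -/
abbrev grp {G : Type} [Group G] (g : G) : MonoidAlgebra K G := MonoidAlgebra.of K G g

theorem map_grp {G H : Type} [Group G] [Group H] (f : G →* H) (g : G) :
    MonoidAlgebra.mapDomainAlgHom K K f (grp g) = grp (f g) := by
  simp

/-- The relation `(R₁)`, for `x = s_i`, as an element of the group algebra that is to vanish. -/
def relR1 {G : Type} [Group G] (x : G) : MonoidAlgebra K G :=
  grp (x ^ 2) + (1 - t₀ - t₁) • grp x + (t₀ * t₁ - t₀ - t₁) • grp 1 + (t₀ * t₁) • grp x⁻¹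

/-- The relation `(R₂)`, for `x = s_i` and `y = s_j`: left side minus right side. -/
def relR2 {G : Type} [Group G] (x y : G) : MonoidAlgebra K G :=
  (grp (x⁻¹ * y * x) - grp (x * y * x⁻¹) - grp (x⁻¹ * y⁻¹ * x) + grp (x * y⁻¹ * x⁻¹)) -
  (grp (x * y) - grp (x * y⁻¹) - grp (x⁻¹ * y) + grp (x⁻¹ * y⁻¹)
    - grp (y * x) + grp (y * x⁻¹) + grp (y⁻¹ * x) - grp (y⁻¹ * x⁻¹))

/-- The words `w_1, …, w_78` of the relation `(R₃)`, for `x = s_i`, `y = s_j`, `z = s_k`. -/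
def r3Words {G : Type} [Group G] (x y z : G) : List G :=
  [x * y, x * y⁻¹, y * x, y⁻¹ * x, z * y, z⁻¹ * y, z * y⁻¹, z⁻¹ * y⁻¹, y * z, y⁻¹ * z, y * z⁻¹,
   y⁻¹ * z⁻¹, x * z * y, x * z * y⁻¹, x * z⁻¹ * y, x * z⁻¹ * y⁻¹, x⁻¹ * z * y, x⁻¹ * z * y⁻¹,
   x⁻¹ * z⁻¹ * y, x⁻¹ * z⁻¹ * y⁻¹, x * y * z, x * y * z⁻¹, x * y⁻¹ * z, x * y⁻¹ * z⁻¹,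
   x⁻¹ * y * z, x⁻¹ * y * z⁻¹, x⁻¹ * y⁻¹ * z, x⁻¹ * y⁻¹ * z⁻¹, y * x * z, y * x * z⁻¹,
   y * x⁻¹ * z, y * x⁻¹ * z⁻¹, y⁻¹ * x * z, y⁻¹ * x * z⁻¹, y⁻¹ * x⁻¹ * z, y⁻¹ * x⁻¹ * z⁻¹,
   z * y * x, z * y * x⁻¹, z * y⁻¹ * x, z * y⁻¹ * x⁻¹, z⁻¹ * y * x, z⁻¹ * y * x⁻¹, z⁻¹ * y⁻¹ * x,
   z⁻¹ * y⁻¹ * x⁻¹, z * x⁻¹ * y⁻¹ * x⁻¹, z⁻¹ * x⁻¹ * y⁻¹ * x⁻¹, z * x⁻¹ * y⁻¹ * x,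
   z⁻¹ * x⁻¹ * y⁻¹ * x, z * x⁻¹ * y * x⁻¹, z⁻¹ * x⁻¹ * y * x⁻¹, z * x * y⁻¹ * x⁻¹,
   z⁻¹ * x * y⁻¹ * x⁻¹, z * x * y⁻¹ * x, z⁻¹ * x * y⁻¹ * x, z * x * y * x⁻¹, z⁻¹ * x * y * x⁻¹,
   x⁻¹ * y⁻¹ * x⁻¹ * z, x⁻¹ * y⁻¹ * x⁻¹ * z⁻¹, x⁻¹ * y⁻¹ * x * z, x⁻¹ * y⁻¹ * x * z⁻¹,
   x⁻¹ * y * x⁻¹ * z, x⁻¹ * y * x⁻¹ * z⁻¹, x * y⁻¹ * x⁻¹ * z, x * y⁻¹ * x⁻¹ * z⁻¹,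
   x * y⁻¹ * x * z, x * y⁻¹ * x * z⁻¹, x * y * x⁻¹ * z, x * y * x⁻¹ * z⁻¹, x * y⁻¹ * z⁻¹ * y,
   x * y⁻¹ * z * y⁻¹, x * y * z⁻¹ * y⁻¹, x * y * z⁻¹ * y, x * y * z * y⁻¹, y⁻¹ * z⁻¹ * y * x,
   y⁻¹ * z * y⁻¹ * x, y * z⁻¹ * y⁻¹ * x, y * z⁻¹ * y * x, y * z * y⁻¹ * x]

section Coefficients

variable {F : Type} [Field F] (t₀ t₁ : F)

/-! The coefficients `a_1, …, a_78` of the relation `(R₃)`, as rational expressions in `t₀`, `t₁`. -/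

def a1 : F :=
  -(((t₁ - 1) * (t₀ - 1) * (-t₁ - t₀ - 2 * t₁ * t₀ - t₁^2 * t₀ - t₁ * t₀^2 + t₁^3 * t₀^2 +
    t₁^2 * t₀^3)) / (t₁ * t₀ * (t₁ + t₀) * (t₁ * t₀ - 1) * (1 + t₁ * t₀)))

def a2 : F :=
  -(((t₁ - 1) * (t₀ - 1) * (t₁ + t₀ + 2 * t₁ * t₀)) / ((t₁ + t₀) * (t₁ * t₀ - 1) * (1 + t₁ * t₀)))

def a3 : F :=
  ((t₁ - 1) * (t₀ - 1) * (-t₁ - t₀ - 2 * t₁ * t₀ - t₁^2 * t₀ - t₁ * t₀^2 + t₁^3 * t₀^2 +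
    t₁^2 * t₀^3)) / (t₁ * t₀ * (t₁ + t₀) * (t₁ * t₀ - 1) * (1 + t₁ * t₀))

def a4 : F :=
  ((t₁ - 1) * (t₀ - 1) * (t₁ + t₀ + 2 * t₁ * t₀)) / ((t₁ + t₀) * (t₁ * t₀ - 1) * (1 + t₁ * t₀))

def a5 : F :=
  (1 + t₁ * t₀ + t₁^2 * t₀ + t₁ * t₀^2) / (t₁ * (1 + t₁) * t₀ * (1 + t₀) * (1 + t₁ * t₀))

def a6 : F :=
  -((t₁ + t₀ + t₁ * t₀ + t₁^2 * t₀^2) / (t₁ * (1 + t₁) * t₀ * (1 + t₀) * (1 + t₁ * t₀)))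

def a7 : F :=
  -(((1 + t₁ * t₀ + t₁^2 * t₀ + t₁ * t₀^2) * (t₁ - t₁^2 + t₀ - t₁ * t₀ + t₁^2 * t₀ - t₀^2 +
    t₁ * t₀^2 + t₁^2 * t₀^2)) / (t₁ * (1 + t₁) * t₀ * (1 + t₀) * (t₁ + t₀) * (1 + t₁ * t₀)))

def a8 : F :=
  ((t₁ + t₀ + t₁ * t₀ + t₁^2 * t₀^2) * (t₁ - t₁^2 + t₀ - t₁ * t₀ + t₁^2 * t₀ - t₀^2 + t₁ * t₀^2 +
    t₁^2 * t₀^2)) / (t₁ * (1 + t₁) * t₀ * (1 + t₀) * (t₁ + t₀) * (1 + t₁ * t₀))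

def a9 : F :=
  -((1 + t₁ * t₀ + t₁^2 * t₀ + t₁ * t₀^2) / (t₁ * (1 + t₁) * t₀ * (1 + t₀) * (1 + t₁ * t₀)))

def a10 : F :=
  ((1 + t₁ * t₀ + t₁^2 * t₀ + t₁ * t₀^2) * (t₁ - t₁^2 + t₀ - t₁ * t₀ + t₁^2 * t₀ - t₀^2 +
    t₁ * t₀^2 + t₁^2 * t₀^2)) / (t₁ * (1 + t₁) * t₀ * (1 + t₀) * (t₁ + t₀) * (1 + t₁ * t₀))

def a11 : F :=
  (t₁ + t₀ + t₁ * t₀ + t₁^2 * t₀^2) / (t₁ * (1 + t₁) * t₀ * (1 + t₀) * (1 + t₁ * t₀))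

def a12 : F :=
  -(((t₁ + t₀ + t₁ * t₀ + t₁^2 * t₀^2) * (t₁ - t₁^2 + t₀ - t₁ * t₀ + t₁^2 * t₀ - t₀^2 + t₁ * t₀^2
    + t₁^2 * t₀^2)) / (t₁ * (1 + t₁) * t₀ * (1 + t₀) * (t₁ + t₀) * (1 + t₁ * t₀)))

def a13 : F :=
  (-t₁^2 - t₁ * t₀ - t₁^2 * t₀ - t₀^2 - t₁ * t₀^2 + t₁^2 * t₀^2) / (t₁ * (1 + t₁) * t₀ * (1 +
    t₀) * (t₁ + t₀) * (1 + t₁ * t₀))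

def a14 : F :=
  (-t₁ + t₁^2 - t₀ + t₁ * t₀ + t₁^2 * t₀ + t₀^2 + t₁ * t₀^2 - t₁^2 * t₀^2 + 2 * t₁^3 * t₀^2 +
    t₁^4 * t₀^2 + 2 * t₁^2 * t₀^3 + 2 * t₁^3 * t₀^3 + t₁^4 * t₀^3 + t₁^2 * t₀^4 + t₁^3 * t₀^4) /
    (t₁ * (1 + t₁) * t₀ * (1 + t₀) * (t₁ + t₀) * (1 + t₁ * t₀))

def a15 : F :=
  -((-t₁^3 - t₁ * t₀ - t₁^4 * t₀ - t₁^2 * t₀^2 - t₀^3 + t₁^4 * t₀^3 - t₁ * t₀^4 + t₁^3 * t₀^4) /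
    (t₁ * (1 + t₁) * t₀ * (1 + t₀) * (t₁ + t₀) * (1 + t₁ * t₀)))

def a16 : F :=
  -((-t₁^2 + t₁^3 - t₁ * t₀ + t₁^2 * t₀ + t₁^3 * t₀ - t₀^2 + t₁ * t₀^2 + 3 * t₁^2 * t₀^2 +
    t₁^4 * t₀^2 + t₀^3 + t₁ * t₀^3 + 2 * t₁^3 * t₀^3 + t₁^4 * t₀^3 + t₁^2 * t₀^4 + t₁^3 * t₀^4) /
    (t₁ * (1 + t₁) * t₀ * (1 + t₀) * (t₁ + t₀) * (1 + t₁ * t₀)))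

def a17 : F :=
  -((1 + t₁ * t₀ + t₁^2 * t₀ + t₁ * t₀^2) / ((1 + t₁) * (1 + t₀) * (t₁ + t₀) * (1 + t₁ * t₀)))

def a18 : F :=
  -(((t₁ + t₀ - 1) * (1 + t₁ * t₀ + t₁^2 * t₀ + t₁ * t₀^2)) / ((1 + t₁) * (1 + t₀) * (t₁ +
    t₀) * (1 + t₁ * t₀)))

def a19 : F :=
  (t₁ + t₀ + t₁ * t₀ + t₁^2 * t₀^2) / ((1 + t₁) * (1 + t₀) * (t₁ + t₀) * (1 + t₁ * t₀))

def a20 : F :=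
  ((t₁ + t₀ - 1) * (t₁ + t₀ + t₁ * t₀ + t₁^2 * t₀^2)) / ((1 + t₁) * (1 + t₀) * (t₁ + t₀) * (1 +
    t₁ * t₀))

def a21 : F :=
  -((t₁ + t₀ + t₁ * t₀ + t₁^2 * t₀^2) / (t₁ * (1 + t₁) * t₀ * (1 + t₀) * (t₁ + t₀) * (1 +
    t₁ * t₀)))

def a22 : F :=
  -((-t₁^2 - t₁ * t₀ - t₁^4 * t₀ - t₀^2 + t₁^2 * t₀^2 - t₁^3 * t₀^2 - t₁^2 * t₀^3 + t₁^4 * t₀^3 -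
    t₁ * t₀^4 + t₁^3 * t₀^4) / (t₁ * (1 + t₁) * t₀ * (1 + t₀) * (t₁ + t₀) * (1 + t₁ * t₀)))

def a23 : F :=
  (t₁ - t₁^2 + t₀ - t₁ * t₀ - t₁^4 * t₀ - t₀^2 + t₁^2 * t₀^2 - 2 * t₁^3 * t₀^2 - 2 * t₁^2 * t₀^3 +
    t₁^4 * t₀^3 - t₁ * t₀^4 + t₁^3 * t₀^4) / (t₁ * (1 + t₁) * t₀ * (1 + t₀) * (t₁ + t₀) * (1 +
    t₁ * t₀))

def a24 : F :=
  -(((t₁ + t₀ - 1) * (-t₁^2 - t₁ * t₀ - t₁^2 * t₀ - t₀^2 - t₁ * t₀^2 + t₁^2 * t₀^2)) / (t₁ * (1 +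
    t₁) * t₀ * (1 + t₀) * (t₁ + t₀) * (1 + t₁ * t₀)))

def a25 : F :=
  (1 + t₁ * t₀ + t₁^2 * t₀ + t₁ * t₀^2) / ((1 + t₁) * (1 + t₀) * (t₁ + t₀) * (1 + t₁ * t₀))

def a26 : F :=
  -((t₁ + t₀ + t₁ * t₀ + t₁^2 * t₀^2) / ((1 + t₁) * (1 + t₀) * (t₁ + t₀) * (1 + t₁ * t₀)))

def a27 : F :=
  ((t₁ + t₀ - 1) * (1 + t₁ * t₀ + t₁^2 * t₀ + t₁ * t₀^2)) / ((1 + t₁) * (1 + t₀) * (t₁ + t₀) * (1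
    + t₁ * t₀))

def a28 : F :=
  -(((t₁ + t₀ - 1) * (t₁ + t₀ + t₁ * t₀ + t₁^2 * t₀^2)) / ((1 + t₁) * (1 + t₀) * (t₁ + t₀) * (1 +
    t₁ * t₀)))

def a29 : F :=
  ((1 + t₁) * (1 + t₀)) / ((t₁ + t₀) * (t₁ * t₀ - 1) * (1 + t₁ * t₀))

def a30 : F :=
  (-1 - 2 * t₁ + t₁^2 - 2 * t₀ + t₁ * t₀ - t₁^3 * t₀ + t₀^2 - 2 * t₁^2 * t₀^2 + t₁^3 * t₀^2 -
    t₁ * t₀^3 + t₁^2 * t₀^3) / ((t₁ + t₀) * (t₁ * t₀ - 1) * (1 + t₁ * t₀))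

def a31 : F :=
  ((1 + t₁ * t₀ + t₁^2 * t₀ + t₁ * t₀^2) * (-t₁^2 - t₁ * t₀ - t₁^2 * t₀ - t₀^2 - t₁ * t₀^2 +
    t₁^2 * t₀^2)) / (t₁ * (1 + t₁) * t₀ * (1 + t₀) * (t₁ + t₀) * (t₁ * t₀ - 1) * (1 + t₁ * t₀))

def a32 : F :=
  -(((t₁ + t₀ + t₁ * t₀ + t₁^2 * t₀^2) * (-t₁^2 - t₁ * t₀ - t₁^2 * t₀ - t₀^2 - t₁ * t₀^2 +
    t₁^2 * t₀^2)) / (t₁ * (1 + t₁) * t₀ * (1 + t₀) * (t₁ + t₀) * (t₁ * t₀ - 1) * (1 + t₁ * t₀)))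

def a33 : F :=
  -((t₁ + t₀ + t₁ * t₀ + t₁^2 * t₀ + t₁^3 * t₀ + t₁ * t₀^2 + 4 * t₁^2 * t₀^2 - t₁^4 * t₀^2 +
    t₁ * t₀^3 - t₁^3 * t₀^3 + t₁^4 * t₀^3 + t₁^5 * t₀^3 - t₁^2 * t₀^4 + t₁^3 * t₀^4 +
    2 * t₁^4 * t₀^4 + t₁^5 * t₀^4 + t₁^3 * t₀^5 + t₁^4 * t₀^5) / (t₁ * (1 + t₁) * t₀ * (1 +
    t₀) * (t₁ + t₀) * (t₁ * t₀ - 1) * (1 + t₁ * t₀)))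

def a34 : F :=
  (t₁^2 + 3 * t₁ * t₀ + 2 * t₁^2 * t₀ - t₁^3 * t₀ + t₀^2 + 2 * t₁ * t₀^2 + t₁^3 * t₀^2 - t₁ * t₀^3
    + t₁^2 * t₀^3 + t₁^3 * t₀^3 + t₁^5 * t₀^3 + 2 * t₁^4 * t₀^4 + t₁^5 * t₀^4 + t₁^3 * t₀^5 +
    t₁^4 * t₀^5) / (t₁ * (1 + t₁) * t₀ * (1 + t₀) * (t₁ + t₀) * (t₁ * t₀ - 1) * (1 + t₁ * t₀))

def a35 : F :=
  ((1 + t₁ * t₀ + t₁^2 * t₀ + t₁ * t₀^2) * (t₁^2 + t₁ * t₀ + t₀^2 - t₁^2 * t₀^2 + t₁^3 * t₀^2 +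
    t₁^2 * t₀^3)) / (t₁ * (1 + t₁) * t₀ * (1 + t₀) * (t₁ + t₀) * (t₁ * t₀ - 1) * (1 + t₁ * t₀))

def a36 : F :=
  -(((t₁ + t₀ + t₁ * t₀ + t₁^2 * t₀^2) * (t₁^2 + t₁ * t₀ + t₀^2 - t₁^2 * t₀^2 + t₁^3 * t₀^2 +
    t₁^2 * t₀^3)) / (t₁ * (1 + t₁) * t₀ * (1 + t₀) * (t₁ + t₀) * (t₁ * t₀ - 1) * (1 + t₁ * t₀)))

def a37 : F :=
  -((t₁ + t₀ + t₁ * t₀ + t₁^2 * t₀^2) / (t₁ * t₀ * (t₁ + t₀) * (t₁ * t₀ - 1) * (1 + t₁ * t₀)))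

def a38 : F :=
  -(((1 + t₁ * t₀ + t₁^2 * t₀ + t₁ * t₀^2) * (-t₁^2 - t₁ * t₀ - t₁^2 * t₀ - t₀^2 - t₁ * t₀^2 +
    t₁^2 * t₀^2)) / (t₁ * (1 + t₁) * t₀ * (1 + t₀) * (t₁ + t₀) * (t₁ * t₀ - 1) * (1 + t₁ * t₀)))

def a39 : F :=
  (t₁ + t₀ + t₁ * t₀ + 2 * t₁^2 * t₀ + t₁^3 * t₀ - t₁^4 * t₀ + 2 * t₁ * t₀^2 + 4 * t₁^2 * t₀^2 -
    t₁^3 * t₀^2 + t₁^5 * t₀^2 + t₁ * t₀^3 - t₁^2 * t₀^3 + t₁^3 * t₀^3 + 3 * t₁^4 * t₀^3 - t₁ * t₀^4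
    + 3 * t₁^3 * t₀^4 - t₁^5 * t₀^4 + t₁^2 * t₀^5 - t₁^4 * t₀^5) / (t₁ * (1 + t₁) * t₀ * (1 +
    t₀) * (t₁ + t₀) * (t₁ * t₀ - 1) * (1 + t₁ * t₀))

def a40 : F :=
  -(((1 + t₁ * t₀ + t₁^2 * t₀ + t₁ * t₀^2) * (t₁^2 + t₁ * t₀ + t₀^2 - t₁^2 * t₀^2 + t₁^3 * t₀^2 +
    t₁^2 * t₀^3)) / (t₁ * (1 + t₁) * t₀ * (1 + t₀) * (t₁ + t₀) * (t₁ * t₀ - 1) * (1 + t₁ * t₀)))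

def a41 : F :=
  (t₁^2 + 3 * t₁ * t₀ - t₁^2 * t₀ + t₀^2 - t₁ * t₀^2 + t₁^2 * t₀^2 + t₁^3 * t₀^2 - t₁^4 * t₀^2 +
    t₁^2 * t₀^3 - 2 * t₁^3 * t₀^3 + t₁^4 * t₀^3 - t₁^2 * t₀^4 + t₁^3 * t₀^4) / (t₁ * t₀ * (t₁ +
    t₀) * (t₁ * t₀ - 1) * (1 + t₁ * t₀))

def a42 : F :=
  ((t₁ + t₀ + t₁ * t₀ + t₁^2 * t₀^2) * (-t₁^2 - t₁ * t₀ - t₁^2 * t₀ - t₀^2 - t₁ * t₀^2 +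
    t₁^2 * t₀^2)) / (t₁ * (1 + t₁) * t₀ * (1 + t₀) * (t₁ + t₀) * (t₁ * t₀ - 1) * (1 + t₁ * t₀))

def a43 : F :=
  -((t₁^2 + 3 * t₁ * t₀ + 2 * t₁^2 * t₀ - t₁^3 * t₀ + t₀^2 + 2 * t₁ * t₀^2 + 2 * t₁^3 * t₀^2 +
    t₁^4 * t₀^2 - t₁ * t₀^3 + 2 * t₁^2 * t₀^3 + 3 * t₁^3 * t₀^3 + t₁^2 * t₀^4) / (t₁ * (1 +
    t₁) * t₀ * (1 + t₀) * (t₁ + t₀) * (t₁ * t₀ - 1) * (1 + t₁ * t₀)))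

def a44 : F :=
  ((t₁ + t₀ + t₁ * t₀ + t₁^2 * t₀^2) * (t₁^2 + t₁ * t₀ + t₀^2 - t₁^2 * t₀^2 + t₁^3 * t₀^2 +
    t₁^2 * t₀^3)) / (t₁ * (1 + t₁) * t₀ * (1 + t₀) * (t₁ + t₀) * (t₁ * t₀ - 1) * (1 + t₁ * t₀))

def a45 : F :=
  ((1 + t₁ * t₀ + t₁^2 * t₀ + t₁ * t₀^2) * (t₁ + t₀ + t₁ * t₀ + t₁^2 * t₀^2)) / ((1 + t₁) * (1 +
    t₀) * (t₁ + t₀) * (t₁ * t₀ - 1) * (1 + t₁ * t₀))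

def a46 : F :=
  -(((t₁ + t₀ + t₁ * t₀ + t₁^2 * t₀^2)^2) / ((1 + t₁) * (1 + t₀) * (t₁ + t₀) * (t₁ * t₀ - 1) * (1
    + t₁ * t₀)))

def a47 : F :=
  (1 + t₁ * t₀ + t₁^2 * t₀ + t₁ * t₀^2) / ((1 + t₁) * (1 + t₀) * (t₁ + t₀) * (1 + t₁ * t₀))

def a48 : F :=
  -((t₁ + t₀ + t₁ * t₀ + t₁^2 * t₀^2) / ((1 + t₁) * (1 + t₀) * (t₁ + t₀) * (1 + t₁ * t₀)))

def a49 : F :=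
  -(((t₁ + t₀ + 2 * t₁ * t₀) * (1 + t₁ * t₀ + t₁^2 * t₀ + t₁ * t₀^2)) / ((1 + t₁) * (1 + t₀) * (t₁
    + t₀) * (t₁ * t₀ - 1) * (1 + t₁ * t₀)))

def a50 : F :=
  ((t₁ + t₀ + 2 * t₁ * t₀) * (t₁ + t₀ + t₁ * t₀ + t₁^2 * t₀^2)) / ((1 + t₁) * (1 + t₀) * (t₁ +
    t₀) * (t₁ * t₀ - 1) * (1 + t₁ * t₀))

def a51 : F :=
  ((1 + t₁ * t₀ + t₁^2 * t₀ + t₁ * t₀^2) * (-t₁^2 - t₁ * t₀ - t₁^2 * t₀ - t₀^2 - t₁ * t₀^2 +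
    t₁^2 * t₀^2)) / (t₁ * (1 + t₁) * t₀ * (1 + t₀) * (t₁ + t₀) * (t₁ * t₀ - 1) * (1 + t₁ * t₀))

def a52 : F :=
  -(((t₁ + t₀ + t₁ * t₀ + t₁^2 * t₀^2) * (-t₁^2 - t₁ * t₀ - t₁^2 * t₀ - t₀^2 - t₁ * t₀^2 +
    t₁^2 * t₀^2)) / (t₁ * (1 + t₁) * t₀ * (1 + t₀) * (t₁ + t₀) * (t₁ * t₀ - 1) * (1 + t₁ * t₀)))

def a53 : F :=
  -(((t₁ + t₀ + t₁ * t₀) * (1 + t₁ * t₀ + t₁^2 * t₀ + t₁ * t₀^2)) / (t₁ * (1 + t₁) * t₀ * (1 +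
    t₀) * (t₁ + t₀) * (1 + t₁ * t₀)))

def a54 : F :=
  ((t₁ + t₀ + t₁ * t₀) * (t₁ + t₀ + t₁ * t₀ + t₁^2 * t₀^2)) / (t₁ * (1 + t₁) * t₀ * (1 + t₀) * (t₁
    + t₀) * (1 + t₁ * t₀))

def a55 : F :=
  ((1 + t₁ * t₀ + t₁^2 * t₀ + t₁ * t₀^2) * (t₁^2 + t₁^2 * t₀ + t₀^2 + t₁ * t₀^2)) / (t₁ * (1 +
    t₁) * t₀ * (1 + t₀) * (t₁ + t₀) * (t₁ * t₀ - 1) * (1 + t₁ * t₀))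

def a56 : F :=
  -(((t₁^2 + t₁^2 * t₀ + t₀^2 + t₁ * t₀^2) * (t₁ + t₀ + t₁ * t₀ + t₁^2 * t₀^2)) / (t₁ * (1 +
    t₁) * t₀ * (1 + t₀) * (t₁ + t₀) * (t₁ * t₀ - 1) * (1 + t₁ * t₀)))

def a57 : F :=
  -(((1 + t₁ * t₀ + t₁^2 * t₀ + t₁ * t₀^2) * (t₁ + t₀ + t₁ * t₀ + t₁^2 * t₀^2)) / ((1 + t₁) * (1 +
    t₀) * (t₁ + t₀) * (t₁ * t₀ - 1) * (1 + t₁ * t₀)))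

def a58 : F :=
  ((t₁ + t₀ + t₁ * t₀ + t₁^2 * t₀^2)^2) / ((1 + t₁) * (1 + t₀) * (t₁ + t₀) * (t₁ * t₀ - 1) * (1 +
    t₁ * t₀))

def a59 : F :=
  -((1 + t₁ * t₀ + t₁^2 * t₀ + t₁ * t₀^2) / ((1 + t₁) * (1 + t₀) * (t₁ + t₀) * (1 + t₁ * t₀)))

def a60 : F :=
  (t₁ + t₀ + t₁ * t₀ + t₁^2 * t₀^2) / ((1 + t₁) * (1 + t₀) * (t₁ + t₀) * (1 + t₁ * t₀))

def a61 : F :=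
  ((t₁ + t₀ + 2 * t₁ * t₀) * (1 + t₁ * t₀ + t₁^2 * t₀ + t₁ * t₀^2)) / ((1 + t₁) * (1 + t₀) * (t₁ +
    t₀) * (t₁ * t₀ - 1) * (1 + t₁ * t₀))

def a62 : F :=
  -(((t₁ + t₀ + 2 * t₁ * t₀) * (t₁ + t₀ + t₁ * t₀ + t₁^2 * t₀^2)) / ((1 + t₁) * (1 + t₀) * (t₁ +
    t₀) * (t₁ * t₀ - 1) * (1 + t₁ * t₀)))

def a63 : F :=
  -(((1 + t₁ * t₀ + t₁^2 * t₀ + t₁ * t₀^2) * (-t₁^2 - t₁ * t₀ - t₁^2 * t₀ - t₀^2 - t₁ * t₀^2 +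
    t₁^2 * t₀^2)) / (t₁ * (1 + t₁) * t₀ * (1 + t₀) * (t₁ + t₀) * (t₁ * t₀ - 1) * (1 + t₁ * t₀)))

def a64 : F :=
  ((t₁ + t₀ + t₁ * t₀ + t₁^2 * t₀^2) * (-t₁^2 - t₁ * t₀ - t₁^2 * t₀ - t₀^2 - t₁ * t₀^2 +
    t₁^2 * t₀^2)) / (t₁ * (1 + t₁) * t₀ * (1 + t₀) * (t₁ + t₀) * (t₁ * t₀ - 1) * (1 + t₁ * t₀))

def a65 : F :=
  ((t₁ + t₀ + t₁ * t₀) * (1 + t₁ * t₀ + t₁^2 * t₀ + t₁ * t₀^2)) / (t₁ * (1 + t₁) * t₀ * (1 +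
    t₀) * (t₁ + t₀) * (1 + t₁ * t₀))

def a66 : F :=
  -(((t₁ + t₀ + t₁ * t₀) * (t₁ + t₀ + t₁ * t₀ + t₁^2 * t₀^2)) / (t₁ * (1 + t₁) * t₀ * (1 +
    t₀) * (t₁ + t₀) * (1 + t₁ * t₀)))

def a67 : F :=
  -(((1 + t₁ * t₀ + t₁^2 * t₀ + t₁ * t₀^2) * (t₁^2 + t₁^2 * t₀ + t₀^2 + t₁ * t₀^2)) / (t₁ * (1 +
    t₁) * t₀ * (1 + t₀) * (t₁ + t₀) * (t₁ * t₀ - 1) * (1 + t₁ * t₀)))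

def a68 : F :=
  ((t₁^2 + t₁^2 * t₀ + t₀^2 + t₁ * t₀^2) * (t₁ + t₀ + t₁ * t₀ + t₁^2 * t₀^2)) / (t₁ * (1 +
    t₁) * t₀ * (1 + t₀) * (t₁ + t₀) * (t₁ * t₀ - 1) * (1 + t₁ * t₀))

def a69 : F :=
  1 / (t₁ + t₀)

def a70 : F :=
  (t₁ * t₀) / (1 + t₁ * t₀)

def a71 : F :=
  ((t₁ - 1) * (1 + t₁) * (t₀ - 1) * (1 + t₀)) / ((t₁ + t₀) * (t₁ * t₀ - 1) * (1 + t₁ * t₀))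

def a72 : F :=
  -(1 / (1 + t₁ * t₀))

def a73 : F :=
  (t₁^2 + t₀^2 - 2) / ((t₁ + t₀) * (t₁ * t₀ - 1) * (1 + t₁ * t₀))

def a74 : F :=
  -(1 / (t₁ + t₀))

def a75 : F :=
  -((t₁ * t₀) / (1 + t₁ * t₀))

def a76 : F :=
  -(((t₁ - 1) * (1 + t₁) * (t₀ - 1) * (1 + t₀)) / ((t₁ + t₀) * (t₁ * t₀ - 1) * (1 + t₁ * t₀)))

def a77 : F :=
  1 / (1 + t₁ * t₀)

def a78 : F :=
  -((t₁^2 + t₀^2 - 2) / ((t₁ + t₀) * (t₁ * t₀ - 1) * (1 + t₁ * t₀)))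

/-- The list `a_1, …, a_78` of the coefficients of the relation `(R₃)`. -/
def r3Coeffs : List F :=
  [a1 t₀ t₁, a2 t₀ t₁, a3 t₀ t₁, a4 t₀ t₁, a5 t₀ t₁, a6 t₀ t₁, a7 t₀ t₁, a8 t₀ t₁, a9 t₀ t₁,
   a10 t₀ t₁, a11 t₀ t₁, a12 t₀ t₁, a13 t₀ t₁, a14 t₀ t₁, a15 t₀ t₁, a16 t₀ t₁, a17 t₀ t₁,
   a18 t₀ t₁, a19 t₀ t₁, a20 t₀ t₁, a21 t₀ t₁, a22 t₀ t₁, a23 t₀ t₁, a24 t₀ t₁, a25 t₀ t₁,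
   a26 t₀ t₁, a27 t₀ t₁, a28 t₀ t₁, a29 t₀ t₁, a30 t₀ t₁, a31 t₀ t₁, a32 t₀ t₁, a33 t₀ t₁,
   a34 t₀ t₁, a35 t₀ t₁, a36 t₀ t₁, a37 t₀ t₁, a38 t₀ t₁, a39 t₀ t₁, a40 t₀ t₁, a41 t₀ t₁,
   a42 t₀ t₁, a43 t₀ t₁, a44 t₀ t₁, a45 t₀ t₁, a46 t₀ t₁, a47 t₀ t₁, a48 t₀ t₁, a49 t₀ t₁,
   a50 t₀ t₁, a51 t₀ t₁, a52 t₀ t₁, a53 t₀ t₁, a54 t₀ t₁, a55 t₀ t₁, a56 t₀ t₁, a57 t₀ t₁,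
   a58 t₀ t₁, a59 t₀ t₁, a60 t₀ t₁, a61 t₀ t₁, a62 t₀ t₁, a63 t₀ t₁, a64 t₀ t₁, a65 t₀ t₁,
   a66 t₀ t₁, a67 t₀ t₁, a68 t₀ t₁, a69 t₀ t₁, a70 t₀ t₁, a71 t₀ t₁, a72 t₀ t₁, a73 t₀ t₁,
   a74 t₀ t₁, a75 t₀ t₁, a76 t₀ t₁, a77 t₀ t₁, a78 t₀ t₁]

end Coefficients

theorem length_r3Words {G : Type} [Group G] (x y z : G) : (r3Words x y z).length = 78 := rfl

theorem length_r3Coeffs {F : Type} [Field F] (t₀ t₁ : F) : (r3Coeffs t₀ t₁).length = 78 := rfl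

/-- The relation `(R₃)`, for `x = s_i`, `y = s_j`, `z = s_k`: left side minus right side. -/
def relR3 {G : Type} [Group G] (x y z : G) : MonoidAlgebra K G :=
  grp (x * z⁻¹ * y * z⁻¹) - grp (z⁻¹ * y * z⁻¹ * x) -
    (List.zipWith (fun a w => a • grp w) (r3Coeffs t₀ t₁) (r3Words x y z)).sum

theorem map_relR1 {G H : Type} [Group G] [Group H] (f : G →* H) (x : G) :
    MonoidAlgebra.mapDomainAlgHom K K f (relR1 x) = relR1 (f x) := by
  simp only [relR1, map_add, map_smul, map_grp, map_pow, map_inv, map_one]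

theorem map_relR2 {G H : Type} [Group G] [Group H] (f : G →* H) (x y : G) :
    MonoidAlgebra.mapDomainAlgHom K K f (relR2 x y) = relR2 (f x) (f y) := by
  simp only [relR2, map_add, map_sub, map_grp, map_mul, map_inv]

theorem map_r3Words {G H : Type} [Group G] [Group H] (f : G →* H) (x y z : G) :
    (r3Words x y z).map f = r3Words (f x) (f y) (f z) := by
  simp only [r3Words, List.map_cons, List.map_nil, map_mul, map_inv]

theorem map_combination {G H : Type} [Group G] [Group H] (f : G →* H) (c : List K) (w : List G) :
    MonoidAlgebra.mapDomainAlgHom K K f (List.zipWith (fun a w => a • grp w) c w).sum =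
      (List.zipWith (fun a w => a • grp w) c (w.map f)).sum := by
  induction c generalizing w with
  | nil => simp
  | cons a c ih =>
    cases w with
    | nil => simp
    | cons v w =>
      simp only [List.zipWith_cons_cons, List.sum_cons, List.map_cons, map_add, ih, map_smul,
        map_grp]

theorem map_relR3 {G H : Type} [Group G] [Group H] (f : G →* H) (x y z : G) :
    MonoidAlgebra.mapDomainAlgHom K K f (relR3 x y z) = relR3 (f x) (f y) (f z) := by
  rw [relR3, map_sub, map_sub, map_combination, map_r3Words, relR3, map_grp, map_grp]
  simp only [map_mul, map_inv]

/-! ### The algebra `C_n` -/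

/-- All instances in `ℚ(t₀, t₁)[B_n]` of the skein relations: `(R₁)` for all generators `s_i`,
`(R₂)` for all `s_i`, `s_j` with `|i - j| = 1`, and `(R₃)` for all `s_i`, `s_{i+1}`, `s_{i+2}`. -/
def skeinRels (n : ℕ) : Set (MonoidAlgebra K (BraidGroup n)) :=
  {r | ∃ i, (1 ≤ i ∧ i < n) ∧ r = relR1 (sigma n i)} ∪
  {r | ∃ i j, (1 ≤ i ∧ i < n) ∧ (1 ≤ j ∧ j < n) ∧ (j = i + 1 ∨ i = j + 1) ∧
      r = relR2 (sigma n i) (sigma n j)} ∪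
  {r | ∃ i, 1 ≤ i ∧ i + 2 < n ∧
      r = relR3 (sigma n i) (sigma n (i + 1)) (sigma n (i + 2))}

/-- The two-sided ideal `(R₁, R₂, R₃)` of `ℚ(t₀, t₁)[B_n]`. -/
def skeinIdeal (n : ℕ) : TwoSidedIdeal (MonoidAlgebra K (BraidGroup n)) :=
  TwoSidedIdeal.span (skeinRels n)

/-- The `ℚ(t₀, t₁)`-algebra `C_n = ℚ(t₀, t₁)[B_n] / (R₁, R₂, R₃)`. -/
abbrev C (n : ℕ) : Type := (skeinIdeal n).ringCon.Quotient

/-- The quotient map `ℚ(t₀, t₁)[B_n] → C_n`. -/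
def toC (n : ℕ) : MonoidAlgebra K (BraidGroup n) →ₐ[K] C n := RingCon.mkₐ K (skeinIdeal n).ringCon

/-- The class in `C_n` of a braid in `B_n`. -/
def braidClass (n : ℕ) (b : BraidGroup n) : C n := toC n (grp b)

/-- The class of `s_i` in `C_n`. -/
def s (n i : ℕ) : C n := braidClass n (sigma n i)

/-- The class of the inverse of `s_i` in `C_n`. -/
def sbar (n i : ℕ) : C n := braidClass n (sigma n i)⁻¹

theorem skeinRels_map {m n : ℕ} (h : m ≤ n) :
    ∀ r ∈ skeinRels m,
      MonoidAlgebra.mapDomainAlgHom K K (braidIncl h) r ∈ skeinRels n := by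
  rintro r ((⟨i, hi, rfl⟩ | ⟨i, j, hi, hj, hij, rfl⟩) | ⟨i, hi, hi', rfl⟩)
  · rw [map_relR1, braidIncl_sigma h hi]
    exact Or.inl (Or.inl ⟨i, ⟨hi.1, hi.2.trans_le h⟩, rfl⟩)
  · rw [map_relR2, braidIncl_sigma h hi, braidIncl_sigma h hj]
    exact Or.inl (Or.inr ⟨i, j, ⟨hi.1, hi.2.trans_le h⟩, ⟨hj.1, hj.2.trans_le h⟩, hij, rfl⟩)
  · rw [map_relR3, braidIncl_sigma h (by omega), braidIncl_sigma h (by omega),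
      braidIncl_sigma h (by omega)]
    exact Or.inr ⟨i, hi, by omega, rfl⟩

theorem skeinIdeal_le_ker {m n : ℕ} (h : m ≤ n) :
    (skeinIdeal m).ringCon ≤
      RingCon.ker ((toC n).comp (MonoidAlgebra.mapDomainAlgHom K K (braidIncl h))).toRingHom := by
  have hle : skeinIdeal m ≤ TwoSidedIdeal.ker
      ((toC n).comp (MonoidAlgebra.mapDomainAlgHom K K (braidIncl h))).toRingHom := by
    refine TwoSidedIdeal.span_le.2 fun r hr => ?_
    have hmem : MonoidAlgebra.mapDomainAlgHom K K (braidIncl h) r ∈ skeinIdeal n :=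
      TwoSidedIdeal.subset_span (skeinRels_map h r hr)
    refine (TwoSidedIdeal.mem_ker _).2 ?_
    exact (RingCon.eq _).2 ((TwoSidedIdeal.mem_iff _ _).1 hmem)
  intro x y hxy
  exact (TwoSidedIdeal.ker_ringCon _).1
    ((TwoSidedIdeal.rel_iff _ _ _).2 (hle ((TwoSidedIdeal.rel_iff _ _ _).1 hxy)))

/-- The natural map `C_m → C_n`, for `m ≤ n`, induced by the inclusion `B_m → B_n`. -/
def CMap {m n : ℕ} (h : m ≤ n) : C m →ₐ[K] C n :=
  RingCon.liftₐ (skeinIdeal m).ringCon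
    ((toC n).comp (MonoidAlgebra.mapDomainAlgHom K K (braidIncl h))) (skeinIdeal_le_ker h)

/-- The image of `C_m` in `C_n` under the natural map, as a `ℚ(t₀, t₁)`-linear subspace. -/
def imC {m n : ℕ} (h : m ≤ n) : Submodule K (C n) := LinearMap.range (CMap h).toLinearMap

/-! ### Data for the reduction algorithm -/

/-- Braid words: the letter `(i, true)` stands for `s_i`, and `(i, false)` for its inverse. -/
abbrev BraidWord : Type := List (ℕ × Bool)

/-- `w` is a word in the letters `s_i`, `1 ≤ i ≤ n - 1`, and their inverses. -/
def IsBraidWord (n : ℕ) (w : BraidWord) : Prop := ∀ l ∈ w, 1 ≤ l.1 ∧ l.1 < n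

/-- The braid in `B_n` that a word represents. -/
def evalWord (n : ℕ) (w : BraidWord) : BraidGroup n :=
  (w.map fun l => if l.2 then sigma n l.1 else (sigma n l.1)⁻¹).prod

/-- The words that occur in the result of the reduction in `B_n`: words in the letters of
`B_{n-1}`; words `u s_{n-1} v` and `u s_{n-1}⁻¹ v` with `u`, `v` words in the letters of `B_{n-1}`;
and words `u s_{n-1}⁻¹ s_{n-2} s_{n-1}⁻¹` with `u` a word in the letters of `B_{n-2}`. -/
def IsReducedWord (n : ℕ) (w : BraidWord) : Prop :=
  IsBraidWord (n - 1) w ∨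
  (∃ u v : BraidWord, ∃ e : Bool, IsBraidWord (n - 1) u ∧ IsBraidWord (n - 1) v ∧
    w = u ++ [(n - 1, e)] ++ v) ∨
  (∃ u : BraidWord, IsBraidWord (n - 2) u ∧
    w = u ++ [(n - 1, false), (n - 2, true), (n - 1, false)])

/-- Explicit polynomials in `ℤ[t₀, t₁]`: the entry `(c, a, b)` stands for `c t₀ ^ a t₁ ^ b`. -/
abbrev PolyCode : Type := List (ℤ × ℕ × ℕ)

/-- The polynomial that a list of terms represents, as an element of `ℚ(t₀, t₁)`. -/
def polyVal (p : PolyCode) : K := (p.map fun m => (m.1 : K) * t₀ ^ m.2.1 * t₁ ^ m.2.2).sum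

/-- Explicit linear combinations of braid words with coefficients in `ℚ(t₀, t₁)`, each coefficient
being given by its numerator and its denominator. -/
abbrev Combination : Type := List ((PolyCode × PolyCode) × BraidWord)

/-- The element of `C_n` that an explicit linear combination represents. -/
def combVal (n : ℕ) (c : Combination) : C n :=
  (c.map fun t => (polyVal t.1.1 / polyVal t.1.2) • braidClass n (evalWord n t.2)).sum

/-- `red` reduces every word in `B_n` to an explicit linear combination of reduced words that
represents the same element of `C_n`; no coefficient has denominator zero. -/
def IsReduction (n : ℕ) (red : BraidWord → Combination) : Prop :=
  ∀ w : BraidWord, IsBraidWord n w →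
    (∀ t ∈ red w, polyVal t.1.2 ≠ 0 ∧ IsReducedWord n t.2) ∧
    combVal n (red w) = braidClass n (evalWord n w)

end

end LinksGould

/-!
The theorem is proved by rewriting words. Write `s_m` for the top letter of `B_{m+1}`, and call
`s_m⁻¹ s_{m-1} s_m⁻¹` the hook. The target words of the reduction in `B_{m+1}` are the words with at
most one top letter, and the words `u s_m⁻¹ s_{m-1} s_m⁻¹` with `u` in the letters of `B_{m-1}`.

Modulo words with at most one top letter, `(R₂)` lets the hook absorb `s_{m-1}` on either side,
`(R₃)` lets it commute with `s_{m-2}`, and it commutes with all lower letters anyway. Hence all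
words `u s_m⁻¹ s_{m-1} s_m⁻¹ v` with `u`, `v` in the letters of `B_m` reduce to targets
(`reduces_hook`). By `(R₁)` only positive words matter, so that it suffices to multiply a target by
one positive letter, and the only problem is a second letter `s_m`. By induction on `m` the word
between two top letters is a target for `B_m`. If it has at most one letter `s_{m-1}`, the braid
relations, `(R₁)` and `reduces_hook` apply (`reduces_sandwich`). If it ends in the hook for `B_m`,
then braid relations and `(R₁)` leave the word `s_m s_{m-1} s_{m-2}⁻¹ s_{m-1} s_m` to be treated.

This last case is `reduces_five`. Multiplying `(R₃)`, in the letters `s_1`, `s_2`, `s_3`, from the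
left by `s_3 s_2` gives
`s_3 s_2 s_1⁻¹ s_2 s_3 (a_25 + a_61 s_1⁻¹)` plus terms that reduce by the cases before. The factor
`a_25 + a_61 s_1⁻¹` is invertible, because `s_1⁻¹` satisfies a cubic equation with roots `-1`,
`1/t₀`, `1/t₁`, at none of which `a_25 + a_61 X` vanishes (`resultant_ne_zero`).

Only finitely many rewriting rules, up to shifts of the indices, occur in all of this; they are
listed in `rules`, and they hold in `C_n` (`holds_of_mem_rules`). The inductive predicate `Reduces`
records that a word can be rewritten into target words, and `reduces_target` says that this is
always so. The vector space decomposition and finite-dimensionality follow at once. For the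
algorithm, a derivation in `Reduces` is turned into a list of commands that act on a
linear combination with coded coefficients. The action of commands is primitive recursive, hence
searching for a list of commands that leaves only target words is a computable procedure, and it
terminates by `reduces_target`.
-/

namespace LinksGould

noncomputable section

/-! ### Rewriting rules -/

/-- The braid word with all indices of letters raised by `i`. -/
def shift (i : ℕ) (w : BraidWord) : BraidWord := w.map fun l => (l.1 + i, l.2)

/-- A rewriting rule `(m, L, c)`: a word `L` in the letters of `B_m` and a linear combination `c` of
words in the letters of `B_m`, to be substituted for `L`. -/
abbrev Rule : Type := ℕ × BraidWord × List (K × BraidWord)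

/-- The words of `(R₃)` in the letters `x`, `y`, `z` and their inverses `x'`, `y'`, `z'`, which may
belong to any type. -/
def r3List {α : Type} (x x' y y' z z' : α) : List (List α) :=
  [[x, y], [x, y'], [y, x], [y', x], [z, y], [z', y], [z, y'], [z', y'], [y, z], [y', z], [y, z'],
   [y', z'], [x, z, y], [x, z, y'], [x, z', y], [x, z', y'], [x', z, y], [x', z, y'],
   [x', z', y], [x', z', y'], [x, y, z], [x, y, z'], [x, y', z], [x, y', z'],
   [x', y, z], [x', y, z'], [x', y', z], [x', y', z'], [y, x, z], [y, x, z'],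
   [y, x', z], [y, x', z'], [y', x, z], [y', x, z'], [y', x', z], [y', x', z'],
   [z, y, x], [z, y, x'], [z, y', x], [z, y', x'], [z', y, x], [z', y, x'], [z', y', x],
   [z', y', x'], [z, x', y', x'], [z', x', y', x'], [z, x', y', x],
   [z', x', y', x], [z, x', y, x'], [z', x', y, x'], [z, x, y', x'],
   [z', x, y', x'], [z, x, y', x], [z', x, y', x], [z, x, y, x'], [z', x, y, x'],
   [x', y', x', z], [x', y', x', z'], [x', y', x, z], [x', y', x, z'],
   [x', y, x', z], [x', y, x', z'], [x, y', x', z], [x, y', x', z'],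
   [x, y', x, z], [x, y', x, z'], [x, y, x', z], [x, y, x', z'], [x, y', z', y],
   [x, y', z, y'], [x, y, z', y'], [x, y, z', y], [x, y, z, y'], [y', z', y, x],
   [y', z, y', x], [y, z', y', x], [y, z', y, x], [y, z, y', x]]

theorem r3Words_eq {G : Type} [Group G] (x y z : G) :
    r3Words x y z = (r3List x x⁻¹ y y⁻¹ z z⁻¹).map List.prod := by
  simp only [r3Words, r3List, List.map_cons, List.map_nil, List.prod_cons, List.prod_nil, mul_one,
    mul_assoc]

theorem map_r3List {α β : Type} (f : α → β) (x x' y y' z z' : α) :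
    (r3List x x' y y' z z').map (List.map f) =
      r3List (f x) (f x') (f y) (f y') (f z) (f z') := rfl

/-- The words of `(R₃)` as braid words in `s_1`, `s_2`, `s_3`. -/
def r3BraidWords : List BraidWord :=
  r3List (1, true) (1, false) (2, true) (2, false) (3, true) (3, false)

/-- The right side of `(R₃)` as a list of terms. -/
def r3Terms : List (K × BraidWord) := List.zip (r3Coeffs t₀ t₁) r3BraidWords

/-- The terms of the right side of `(R₃)` other than those of `s_1⁻¹ s_2 s_3` and
`s_1⁻¹ s_2 s_1⁻¹ s_3`. -/
def r3Rest : List (K × BraidWord) := r3Terms.take 24 ++ (r3Terms.drop 25).take 35 ++ r3Terms.drop 61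

/-- The product over the cubic polynomial that `s_1⁻¹` satisfies of the values
`a_25 + a_61 λ` at its roots `λ = -1, 1/t₀, 1/t₁`, that is, the resultant by which
`a_25 + a_61 s_1⁻¹` is inverted. -/
def resultant : K :=
  (a25 t₀ t₁ - a61 t₀ t₁) * (a25 t₀ t₁ + a61 t₀ t₁ / t₀) * (a25 t₀ t₁ + a61 t₀ t₁ / t₁)

/-- The inverse of `a_25 + a_61 s_1⁻¹` in `C_2`, as a combination of powers of `s_1⁻¹`. -/
def inverseTerms : List (K × BraidWord) :=
  [((a61 t₀ t₁ ^ 2 * ((1 - t₀ - t₁) / (t₀ * t₁)) -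
      a25 t₀ t₁ * a61 t₀ t₁ * ((t₀ * t₁ - t₀ - t₁) / (t₀ * t₁)) + a25 t₀ t₁ ^ 2) / resultant, []),
   ((a61 t₀ t₁ ^ 2 * ((t₀ * t₁ - t₀ - t₁) / (t₀ * t₁)) - a25 t₀ t₁ * a61 t₀ t₁) / resultant,
      [(1, false)]),
   (a61 t₀ t₁ ^ 2 / resultant, [(1, false), (1, false)])]

/-- Cancellation and `(R₁)`, in three forms. -/
def rulesOne : List Rule :=
  [(2, [(1, true), (1, false)], [(1, [])]),
   (2, [(1, false), (1, true)], [(1, [])]),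
   (2, [(1, false)], [(-1 / (t₀ * t₁), [(1, true), (1, true)]),
      (-(1 - t₀ - t₁) / (t₀ * t₁), [(1, true)]), (-(t₀ * t₁ - t₀ - t₁) / (t₀ * t₁), [])]),
   (2, [(1, true), (1, true)], [(-(1 - t₀ - t₁), [(1, true)]), (-(t₀ * t₁ - t₀ - t₁), []),
      (-(t₀ * t₁), [(1, false)])]),
   (2, [(1, false), (1, false)], [(-1 / (t₀ * t₁), [(1, true)]),
      (-(1 - t₀ - t₁) / (t₀ * t₁), []), (-(t₀ * t₁ - t₀ - t₁) / (t₀ * t₁), [(1, false)])])]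

/-- The braid relation on two adjacent generators, for all choices of signs for which it applies. -/
def rulesBraid : List Rule :=
  [(3, [(2, true), (1, true), (2, true)], [(1, [(1, true), (2, true), (1, true)])]),
   (3, [(2, true), (1, true), (2, false)], [(1, [(1, false), (2, true), (1, true)])]),
   (3, [(2, false), (1, true), (2, true)], [(1, [(1, true), (2, true), (1, false)])]),
   (3, [(2, true), (1, false), (2, false)], [(1, [(1, false), (2, false), (1, true)])]),
   (3, [(2, false), (1, false), (2, true)], [(1, [(1, true), (2, false), (1, false)])]),
   (3, [(2, false), (1, false), (2, false)], [(1, [(1, false), (2, false), (1, false)])])]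

/-- The relation between `s_2 s_1⁻¹ s_2` and `s_2⁻¹ s_1 s_2⁻¹` that follows from `(R₁)`, and the
rules that move `s_1` across `s_2⁻¹ s_1 s_2⁻¹`, which come from `(R₂)`. -/
def rulesThree : List Rule :=
  [(3, [(2, true), (1, false), (2, true)],
      [(-(1 - t₀ - t₁), [(1, false), (2, true)]),
       (-(t₀ * t₁ - t₀ - t₁), [(1, true), (2, false), (1, false)]),
       (-(t₀ * t₁), [(2, false), (1, true), (2, false), (1, false)])]),
   (3, [(2, false), (1, true), (2, false)],
      [(-1 / (t₀ * t₁), [(2, true), (1, false), (2, true), (1, true)]),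
       (-(1 - t₀ - t₁) / (t₀ * t₁), [(1, false), (2, true), (1, true)]),
       (-(t₀ * t₁ - t₀ - t₁) / (t₀ * t₁), [(1, true), (2, false)])]),
   (3, [(2, false), (1, true), (2, false), (1, true)],
      [(-1, [(2, false), (1, true), (2, false)]), (1, [(1, true), (2, true)]),
       (-1, [(1, true), (2, false)]), (1, [(1, false), (2, false)]),
       (-1, [(1, true), (2, false), (1, true)]), (1, [(1, true), (2, true), (1, false)]),
       (1, [(1, false), (2, false), (1, true)]), (-1, [(1, true), (1, true)]), (1, []),
       (1, [(2, false), (2, false), (1, true), (1, true)]), (-1, [(2, false), (2, false)])]),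
   (3, [(1, true), (2, false), (1, true), (2, false)],
      [(-1, [(2, false), (1, true), (2, false)]), (1, [(2, true), (1, true)]),
       (-1, [(2, false), (1, true)]), (1, [(2, false), (1, false)]),
       (-1, [(1, true), (2, false), (1, true)]), (1, [(1, false), (2, true), (1, true)]),
       (1, [(1, true), (2, false), (1, false)]), (-1, [(1, true), (1, true)]), (1, []),
       (1, [(1, true), (1, true), (2, false), (2, false)]), (-1, [(2, false), (2, false)])])]

/-- Three consequences of the braid relations, `(R₃)` in both directions, and the consequence of
`(R₃)` that removes `s_3 s_2 s_1⁻¹ s_2 s_3`. -/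
def rulesFour : List Rule :=
  [(4, [(3, true), (2, false), (1, true), (2, false), (3, false)],
      [(1, [(2, false), (1, false), (3, false), (2, true), (3, false), (1, true), (2, true)])]),
   (4, [(3, false), (2, false), (1, true), (2, false), (3, true)],
      [(1, [(2, true), (1, true), (3, false), (2, true), (3, false), (1, false), (2, false)])]),
   (4, [(3, true), (2, true), (1, true), (3, false), (2, true), (3, false)],
      [(1, [(2, false), (1, true), (2, false), (3, true), (2, true), (1, true)])]),
   (4, [(3, false), (2, true), (3, false), (1, true)],
      (1, [(1, true), (3, false), (2, true), (3, false)]) :: r3Terms.map fun t => (-t.1, t.2)),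
   (4, [(1, true), (3, false), (2, true), (3, false)],
      (1, [(3, false), (2, true), (3, false), (1, true)]) :: r3Terms),
   (4, [(3, true), (2, true), (1, false), (2, true), (3, true)],
      ((1, [(1, true), (3, false), (2, true), (3, false)]) ::
        (-1, [(3, false), (2, true), (3, false), (1, true)]) ::
        r3Rest.map fun t => (-t.1, t.2)).flatMap fun t =>
          inverseTerms.map fun q => (t.1 * q.1, [(3, true), (2, true)] ++ t.2 ++ q.2))]

/-- All rewriting rules. Together with the commutation of distant letters they suffice for the
reduction. -/
def rules : List Rule := rulesOne ++ rulesBraid ++ rulesThree ++ rulesFour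

/-- `Reduces n T w`: the word `w` can be rewritten, in `B_n`, into a linear combination of words
with the property `T`. Rules apply at all shifts for which their letters belong to `B_n`. -/
inductive Reduces (n : ℕ) (T : BraidWord → Prop) : BraidWord → Prop
  | base {w : BraidWord} : T w → Reduces n T w
  | rule {r : Rule} {i : ℕ} (u v : BraidWord) : r ∈ rules → i + r.1 ≤ n →
      (∀ t ∈ r.2.2, Reduces n T (u ++ shift i t.2 ++ v)) → Reduces n T (u ++ shift i r.2.1 ++ v)
  | comm {k l : ℕ × Bool} (u v : BraidWord) : k.1 + 1 < l.1 ∨ l.1 + 1 < k.1 →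
      Reduces n T (u ++ [l, k] ++ v) → Reduces n T (u ++ [k, l] ++ v)

/-! ### The relations that hold in `C_n` -/

@[simp] theorem braidClass_one (n : ℕ) : braidClass n 1 = 1 := by
  simp only [braidClass, grp, map_one]

theorem braidClass_mul (n : ℕ) (g h : BraidGroup n) :
    braidClass n (g * h) = braidClass n g * braidClass n h := by
  simp only [braidClass, grp, map_mul]

@[simp] theorem evalWord_nil (n : ℕ) : evalWord n [] = 1 := rfl

@[simp] theorem evalWord_append (n : ℕ) (u v : BraidWord) :
    evalWord n (u ++ v) = evalWord n u * evalWord n v := by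
  simp [evalWord]

@[simp] theorem evalWord_cons_true (n i : ℕ) (v : BraidWord) :
    evalWord n ((i, true) :: v) = sigma n i * evalWord n v := by
  simp [evalWord]

@[simp] theorem evalWord_cons_false (n i : ℕ) (v : BraidWord) :
    evalWord n ((i, false) :: v) = (sigma n i)⁻¹ * evalWord n v := by
  simp [evalWord]

theorem sigma_braid (n i : ℕ) (h1 : 1 ≤ i) (h2 : i + 1 < n) :
    sigma n i * sigma n (i + 1) * sigma n i = sigma n (i + 1) * sigma n i * sigma n (i + 1) := by
  rw [sigma, dif_pos ⟨h1, by omega⟩, sigma, dif_pos ⟨by omega, h2⟩, ← mul_inv_eq_one]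
  exact PresentedGroup.one_of_mem (rels := braidRels n)
    (Or.inl ⟨⟨i, h1, by omega⟩, ⟨i + 1, by omega, h2⟩, rfl, rfl⟩)

theorem sigma_comm (n i j : ℕ) (h : i + 1 < j) :
    sigma n i * sigma n j = sigma n j * sigma n i := by
  by_cases hi : 1 ≤ i ∧ i < n
  · by_cases hj : 1 ≤ j ∧ j < n
    · rw [sigma, dif_pos hi, sigma, dif_pos hj, ← mul_inv_eq_one]
      exact PresentedGroup.one_of_mem (rels := braidRels n) (Or.inr ⟨⟨i, hi⟩, ⟨j, hj⟩, h, rfl⟩)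
    · rw [sigma.eq_def n j, dif_neg hj, one_mul, mul_one]
  · rw [sigma, dif_neg hi, one_mul, mul_one]

theorem toC_eq_zero {n : ℕ} {r : MonoidAlgebra K (BraidGroup n)} (h : r ∈ skeinRels n) :
    toC n r = 0 :=
  (RingCon.eq _).2 ((TwoSidedIdeal.mem_iff _ _).1 (TwoSidedIdeal.subset_span h))

/-- The element of `C_n` that a linear combination of words represents. -/
def linVal (n : ℕ) (c : List (K × BraidWord)) : C n :=
  (c.map fun t => t.1 • braidClass n (evalWord n t.2)).sum

theorem linVal_cons (n : ℕ) (t : K × BraidWord) (c : List (K × BraidWord)) :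
    linVal n (t :: c) = t.1 • braidClass n (evalWord n t.2) + linVal n c := by
  simp [linVal]

theorem linVal_append (n : ℕ) (c d : List (K × BraidWord)) :
    linVal n (c ++ d) = linVal n c + linVal n d := by
  simp [linVal]

theorem linVal_neg (n : ℕ) (c : List (K × BraidWord)) :
    linVal n (c.map fun t => (-t.1, t.2)) = -linVal n c := by
  induction c with
  | nil => simp [linVal]
  | cons t c ih =>
    rw [List.map_cons, linVal_cons, ih, linVal_cons, neg_add]
    exact congrArg (· + _) (neg_smul (R := K) (M := C n) _ _)

theorem linVal_context (n : ℕ) (a : K) (u v : BraidWord) (c : List (K × BraidWord)) :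
    linVal n (c.map fun t => (a * t.1, u ++ t.2 ++ v)) =
      a • (braidClass n (evalWord n u) * linVal n c * braidClass n (evalWord n v)) := by
  induction c with
  | nil => simp [linVal]
  | cons t c ih =>
    rw [List.map_cons, linVal_cons, ih, linVal_cons]
    simp only [evalWord_append, braidClass_mul, mul_add, add_mul, smul_add, mul_smul_comm,
      smul_mul_assoc, smul_smul]

/-- The linear combination with all words shifted. -/
def shiftTerms (i : ℕ) (c : List (K × BraidWord)) : List (K × BraidWord) :=
  c.map fun t => (t.1, shift i t.2)

/-- A rule holds in `C_n` at the shift `i`. -/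
def Rule.Holds (n i : ℕ) (r : Rule) : Prop :=
  braidClass n (evalWord n (shift i r.2.1)) = linVal n (shiftTerms i r.2.2)

theorem skein_one {n i : ℕ} (h1 : 1 ≤ i) (h2 : i < n) (u v : BraidGroup n) :
    braidClass n (u * sigma n i * sigma n i * v) +
      (1 - t₀ - t₁) • braidClass n (u * sigma n i * v) +
      (t₀ * t₁ - t₀ - t₁) • braidClass n (u * v) +
      (t₀ * t₁) • braidClass n (u * (sigma n i)⁻¹ * v) = 0 := by
  have h := toC_eq_zero (Or.inl (Or.inl ⟨i, ⟨h1, h2⟩, rfl⟩) : relR1 (sigma n i) ∈ skeinRels n)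
  have h' : braidClass n u * toC n (relR1 (sigma n i)) * braidClass n v = 0 := by
    rw [h, mul_zero, zero_mul]
  rw [← h', relR1]
  simp only [map_add, map_smul, ← braidClass.eq_def, mul_add, add_mul, mul_smul_comm,
    smul_mul_assoc, ← braidClass_mul, pow_two, mul_assoc, one_mul]

theorem skein_two {n i : ℕ} (h1 : 1 ≤ i) (h2 : i + 1 < n) (u v : BraidGroup n) :
    let x := sigma n i
    let y := sigma n (i + 1)
    (braidClass n (u * x⁻¹ * y * x * v) - braidClass n (u * x * y * x⁻¹ * v)
      - braidClass n (u * x⁻¹ * y⁻¹ * x * v) + braidClass n (u * x * y⁻¹ * x⁻¹ * v)) -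
    (braidClass n (u * x * y * v) - braidClass n (u * x * y⁻¹ * v)
      - braidClass n (u * x⁻¹ * y * v) + braidClass n (u * x⁻¹ * y⁻¹ * v)
      - braidClass n (u * y * x * v) + braidClass n (u * y * x⁻¹ * v)
      + braidClass n (u * y⁻¹ * x * v) - braidClass n (u * y⁻¹ * x⁻¹ * v)) = 0 := by
  intro x y
  have h := toC_eq_zero (Or.inl (Or.inr ⟨i, i + 1, ⟨h1, by omega⟩, ⟨by omega, h2⟩, Or.inl rfl,
    rfl⟩) : relR2 x y ∈ skeinRels n)
  have h' : braidClass n u * toC n (relR2 x y) * braidClass n v = 0 := by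
    rw [h, mul_zero, zero_mul]
  rw [← h', relR2]
  simp only [map_add, map_sub, ← braidClass.eq_def, mul_add, add_mul, mul_sub, sub_mul,
    ← braidClass_mul, mul_assoc]

theorem linVal_zip (n : ℕ) (c : List K) (w : List BraidWord) :
    linVal n (List.zip c w) =
      (List.zipWith (fun a g => a • braidClass n g) c (w.map (evalWord n))).sum := by
  induction c generalizing w with
  | nil => simp [linVal]
  | cons a c ih => cases w with
    | nil => simp [linVal]
    | cons v w => simp [linVal_cons, ih]

theorem toC_combination (n : ℕ) (c : List K) (w : List (BraidGroup n)) :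
    toC n (List.zipWith (fun a g => a • grp g) c w).sum =
      (List.zipWith (fun a g => a • braidClass n g) c w).sum := by
  induction c generalizing w with
  | nil => simp
  | cons a c ih => cases w with
    | nil => simp
    | cons v w =>
      simp only [List.zipWith_cons_cons, List.sum_cons, map_add, ih, map_smul, braidClass]

theorem evalWord_r3 (n i : ℕ) :
    (r3BraidWords.map (shift i)).map (evalWord n) =
      r3Words (sigma n (1 + i)) (sigma n (2 + i)) (sigma n (3 + i)) := by
  rw [r3Words_eq]
  have : (r3BraidWords.map (shift i)) = r3List (1 + i, true) (1 + i, false) (2 + i, true)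
    (2 + i, false) (3 + i, true) (3 + i, false) := rfl
  have h2 := map_r3List (fun l : ℕ × Bool => if l.2 then sigma n l.1 else (sigma n l.1)⁻¹)
    (1 + i, true) (1 + i, false) (2 + i, true) (2 + i, false) (3 + i, true) (3 + i, false)
  simp only [if_true, Bool.false_eq_true, if_false] at h2
  rw [this, ← h2, List.map_map]
  rfl

theorem skein_three {n i : ℕ} (h2 : i + 4 ≤ n) :
    let x := sigma n (1 + i)
    let y := sigma n (2 + i)
    let z := sigma n (3 + i)
    braidClass n (x * z⁻¹ * y * z⁻¹) - braidClass n (z⁻¹ * y * z⁻¹ * x) -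
      linVal n (shiftTerms i r3Terms) = 0 := by
  intro x y z
  have hx : sigma n (i + 1) = x := by rw [add_comm]
  have hy : sigma n (i + 1 + 1) = y := by rw [add_assoc, add_comm]
  have hz : sigma n (i + 1 + 2) = z := by rw [add_assoc, add_comm]
  have h := toC_eq_zero (Or.inr ⟨i + 1, by omega, by omega, by rw [hx, hy, hz]⟩ :
    relR3 x y z ∈ skeinRels n)
  have h3 : shiftTerms i r3Terms = List.zip (r3Coeffs t₀ t₁) (r3BraidWords.map (shift i)) := by
    rw [shiftTerms, r3Terms, ← List.map_id (r3Coeffs t₀ t₁), List.zip_map, List.map_id]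
    rfl
  rw [h3, linVal_zip, evalWord_r3, ← h, relR3, map_sub, map_sub, toC_combination]
  rfl

/-! ### Soundness of the rewriting rules -/

theorem t₀_ne_zero : t₀ ≠ 0 := by
  rw [t₀, Ne, FaithfulSMul.algebraMap_eq_zero_iff]
  exact MvPolynomial.X_ne_zero 0

theorem t₁_ne_zero : t₁ ≠ 0 := by
  rw [t₁, Ne, FaithfulSMul.algebraMap_eq_zero_iff]
  exact MvPolynomial.X_ne_zero 1

section Solve

variable {F M : Type} [Field F] [AddCommGroup M] [Module F M] {a b c : F} {e₂ e₁ e₀ e : M}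

theorem solve_last (hc : c ≠ 0) (h : e₂ + a • e₁ + b • e₀ + c • e = 0) :
    e = (-1 / c) • e₂ + ((-a / c) • e₁ + ((-b / c) • e₀ + 0)) := by
  linear_combination (norm := skip) (1 / c) • h
  match_scalars <;> field

theorem solve_first (h : e₂ + a • e₁ + b • e₀ + c • e = 0) :
    e₂ = (-a) • e₁ + ((-b) • e₀ + ((-c) • e + 0)) := by
  linear_combination (norm := module) h

end Solve

section BraidRelation

variable {G : Type} [Group G] {x y z : G}

theorem braid_conj (h : x * y * x = y * x * y) : y * x * y⁻¹ = x⁻¹ * y * x := by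
  rw [mul_inv_eq_iff_eq_mul, mul_assoc x⁻¹, mul_assoc x⁻¹, ← h]
  group

theorem braid_inv (h : x * y * x = y * x * y) :
    x⁻¹ * y⁻¹ * x⁻¹ = y⁻¹ * x⁻¹ * y⁻¹ := by
  simpa [mul_assoc] using congrArg (·⁻¹) h

/-- The braid relation for all signs, as rewriting rules that lower the number of letters `y`. -/
theorem braid_rules (h : x * y * x = y * x * y) (g : G) :
    y * (x * (y * g)) = x * (y * (x * g)) ∧
    y * (x * (y⁻¹ * g)) = x⁻¹ * (y * (x * g)) ∧
    y⁻¹ * (x * (y * g)) = x * (y * (x⁻¹ * g)) ∧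
    y * (x⁻¹ * (y⁻¹ * g)) = x⁻¹ * (y⁻¹ * (x * g)) ∧
    y⁻¹ * (x⁻¹ * (y * g)) = x * (y⁻¹ * (x⁻¹ * g)) ∧
    y⁻¹ * (x⁻¹ * (y⁻¹ * g)) = x⁻¹ * (y⁻¹ * (x⁻¹ * g)) := by
  have h' := braid_inv h
  have h1 := braid_conj h
  have h2 := braid_conj h.symm
  have h3 := braid_conj h'.symm
  have h4 := braid_conj h'
  simp only [inv_inv] at h3 h4
  simp only [← mul_assoc, h, h1, ← h2, h3, h4, h', and_self]

end BraidRelation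

theorem holds_rulesOne {n i : ℕ} {r : Rule} (hr : r ∈ rulesOne) (h : i + r.1 ≤ n) :
    r.Holds n i := by
  have hc := mul_ne_zero t₀_ne_zero t₁_ne_zero
  simp only [rulesOne, List.mem_cons, List.not_mem_nil, or_false] at hr
  have hs : i + 2 ≤ n → _ := fun hn => skein_one (n := n) (i := 1 + i) (by omega) (by omega) 1
  rcases hr with rfl | rfl | rfl | rfl | rfl
  · simp [Rule.Holds, shift, shiftTerms, linVal]
  · simp [Rule.Holds, shift, shiftTerms, linVal]
  all_goals
    simp only [Rule.Holds, shift, shiftTerms, linVal, List.map_cons, List.map_nil,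
      evalWord_cons_true, evalWord_cons_false, evalWord_nil, mul_one, List.sum_cons, List.sum_nil]
  · specialize hs h 1
    simp only [one_mul, mul_one] at hs
    exact solve_last (F := K) (M := C n) hc hs
  · specialize hs h 1
    simp only [one_mul, mul_one] at hs
    exact solve_first (F := K) (M := C n) hs
  · specialize hs h (sigma n (1 + i))⁻¹
    simp only [one_mul, mul_one, mul_assoc, mul_inv_cancel] at hs
    exact solve_last (F := K) (M := C n) hc hs

theorem holds_rulesBraid {n i : ℕ} {r : Rule} (hr : r ∈ rulesBraid) (h : i + r.1 ≤ n) :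
    r.Holds n i := by
  simp only [rulesBraid, List.mem_cons, List.not_mem_nil, or_false] at hr
  have hs : i + 3 ≤ n → sigma n (1 + i) * sigma n (2 + i) * sigma n (1 + i) =
      sigma n (2 + i) * sigma n (1 + i) * sigma n (2 + i) := fun hn => by
    have := sigma_braid n (1 + i) (by omega) (by omega)
    rwa [show 1 + i + 1 = 2 + i by omega] at this
  rcases hr with rfl | rfl | rfl | rfl | rfl | rfl
  all_goals
    obtain ⟨h1, h2, h3, h4, h5, h6⟩ := braid_rules (hs h) 1
    simp only [Rule.Holds, shift, shiftTerms, linVal, List.map_cons, List.map_nil,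
      evalWord_cons_true, evalWord_cons_false, evalWord_nil, List.sum_cons, List.sum_nil,
      one_smul, add_zero, h1, h2, h3, h4, h5, h6]

theorem holds_rulesThree {n i : ℕ} {r : Rule} (hr : r ∈ rulesThree) (h : i + r.1 ≤ n) :
    r.Holds n i := by
  have hc := mul_ne_zero t₀_ne_zero t₁_ne_zero
  simp only [rulesThree, List.mem_cons, List.not_mem_nil, or_false] at hr
  have h' : i + 3 ≤ n := by rcases hr with rfl | rfl | rfl | rfl <;> exact h
  have hs : sigma n (1 + i) * sigma n (2 + i) * sigma n (1 + i) =
      sigma n (2 + i) * sigma n (1 + i) * sigma n (2 + i) := by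
    have := sigma_braid n (1 + i) (by omega) (by omega)
    rwa [show 1 + i + 1 = 2 + i by omega] at this
  have hs1 := skein_one (n := n) (i := 2 + i) (by omega) (by omega) 1
  have hs2 := skein_two (n := n) (i := 1 + i) (by omega) (by omega)
  rw [show 1 + i + 1 = 2 + i by omega] at hs2
  have hb := braid_rules hs
  have hneg : ∀ e : C n, (-1 : K) • e = -e := fun e => neg_one_smul K e
  rcases hr with rfl | rfl | rfl | rfl
  all_goals
    simp only [Rule.Holds, shift, shiftTerms, linVal, List.map_cons, List.map_nil,
      evalWord_cons_true, evalWord_cons_false, evalWord_nil, List.sum_cons, List.sum_nil]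
  all_goals
    generalize sigma n (1 + i) = x at *
    generalize sigma n (2 + i) = y at *
  · have := hs1 (y⁻¹ * (x⁻¹ * (y * 1)))
    simp only [mul_assoc, one_mul, mul_inv_cancel_left, hb] at this ⊢
    exact solve_first (F := K) (M := C n) this
  · have := hs1 (x * (y⁻¹ * 1))
    simp only [mul_assoc, one_mul, hb] at this ⊢
    exact solve_last (F := K) (M := C n) hc this
  · have := hs2 y⁻¹ (x * 1)
    simp only [mul_assoc, hb, inv_mul_cancel_left] at this
    simp only [hneg, one_smul, add_zero]
    simp only [mul_one] at this ⊢
    linear_combination (norm := skip) this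
    abel
  · have := hs2 x (y⁻¹ * 1)
    simp only [mul_assoc, hb, mul_inv_cancel_left] at this
    simp only [hneg, one_smul, add_zero]
    simp only [mul_one] at this ⊢
    linear_combination (norm := skip) -this
    abel

/-! ### Solving `(R₃)` for a word with two top letters -/

section Group

variable {G : Type} [Group G] {x y z : G}

/-- Conjugating the hook `s_2⁻¹ s_1 s_2⁻¹` by `s_3` turns it into a hook `s_3⁻¹ s_2 s_3⁻¹`, with
letters `s_1`, `s_2` around it. -/
theorem braid_mixed (h : x * y * x = y * x * y) (h' : y * z * y = z * y * z) (hc : x * z = z * x) :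
    z * y⁻¹ * x * y⁻¹ * z⁻¹ = y⁻¹ * x⁻¹ * z⁻¹ * y * z⁻¹ * x * y := by
  have e1 : z * y⁻¹ = y⁻¹ * z⁻¹ * y * z := by
    have := (braid_rules h' z).2.2.2.1
    rw [inv_mul_cancel, mul_one] at this
    rw [this]
    group
  have e2 : y⁻¹ * z⁻¹ = z⁻¹ * y⁻¹ * z⁻¹ * y := by
    have := (braid_rules h' 1).2.2.2.1
    rw [mul_one, mul_one] at this
    simp only [mul_assoc]
    exact eq_inv_mul_iff_mul_eq.2 this
  have e3 : y * x * y⁻¹ = x⁻¹ * y * x := braid_conj h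
  have hc' : x⁻¹ * z⁻¹ = z⁻¹ * x⁻¹ := by rw [← mul_inv_rev, ← mul_inv_rev, hc]
  have hc'' : x * z⁻¹ = z⁻¹ * x := by rw [mul_inv_eq_iff_eq_mul, mul_assoc, hc, inv_mul_cancel_left]
  calc z * y⁻¹ * x * y⁻¹ * z⁻¹ = (z * y⁻¹) * x * (y⁻¹ * z⁻¹) := by group
    _ = y⁻¹ * z⁻¹ * y * (z * x) * (z⁻¹ * y⁻¹ * z⁻¹ * y) := by rw [e1, e2]; group
    _ = y⁻¹ * z⁻¹ * (y * x * y⁻¹) * z⁻¹ * y := by rw [← hc]; group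
    _ = y⁻¹ * (z⁻¹ * x⁻¹) * y * (x * z⁻¹) * y := by rw [e3]; group
    _ = _ := by rw [← hc', hc'']; group

theorem braid_across (h : x * y * x = y * x * y) (h' : y * z * y = z * y * z)
    (hc : x * z = z * x) :
    z * y * x * z⁻¹ * y * z⁻¹ = y⁻¹ * x * y⁻¹ * z * y * x := by
  have hc' : x * z⁻¹ = z⁻¹ * x := by rw [mul_inv_eq_iff_eq_mul, mul_assoc, hc, inv_mul_cancel_left]
  have e : z * y * z⁻¹ = y⁻¹ * z * y := braid_conj h'
  calc z * y * x * z⁻¹ * y * z⁻¹ = z * y * (x * z⁻¹) * y * z⁻¹ := by group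
    _ = (z * y * z⁻¹) * x * y * z⁻¹ := by rw [hc']; group
    _ = y⁻¹ * z * (y * x * y) * z⁻¹ := by rw [e]; group
    _ = y⁻¹ * (z * x) * y * (x * z⁻¹) := by rw [← h]; group
    _ = y⁻¹ * x * (z * y * z⁻¹) * x := by rw [← hc, hc']; group
    _ = _ := by rw [e]; group

end Group

/-- The inverse of `a + b e`, where `e` is a root of the cubic `1 + p X + q X² + r X³`: it exists as
soon as the resultant `d` of this cubic and `a + b X` does not vanish. -/
theorem linear_inverse {F A : Type} [Field F] [Ring A] [Algebra F A] {e : A} {a b p q r d : F}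
    (hr : r ≠ 0) (hd : d ≠ 0)
    (hd' : d = a ^ 3 - a ^ 2 * b * (q / r) + a * b ^ 2 * (p / r) - b ^ 3 / r)
    (h : 1 + p • e + q • (e * e) + r • (e * e * e) = 0) :
    (a • 1 + b • e) * (((b ^ 2 * (p / r) - a * b * (q / r) + a ^ 2) / d) • 1 +
      (((b ^ 2 * (q / r) - a * b) / d) • e + ((b ^ 2 / d) • (e * e) + 0))) = 1 := by
  have key : (a • (1 : A) + b • e) * ((b ^ 2 * (p / r) - a * b * (q / r) + a ^ 2) • 1 +
      ((b ^ 2 * (q / r) - a * b) • e + (b ^ 2 • (e * e) + 0))) = d • 1 := by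
    rw [hd']
    simp only [mul_add, add_mul, mul_smul_comm, smul_mul_assoc, mul_one, one_mul, mul_zero,
      ← mul_assoc]
    linear_combination (norm := skip) (b ^ 3 / r) • h
    match_scalars <;> field
  have := (mul_smul_comm d⁻¹ _ _).trans ((congrArg (d⁻¹ • ·) key).trans (inv_smul_smul₀ hd 1))
  simpa only [smul_add, smul_smul, div_eq_inv_mul, smul_zero] using this

/-- A polynomial in `t₀`, `t₁` is nonzero if it does not vanish at `(2, 3)`. -/
theorem algebraMap_ne_zero_of_eval {p : MvPolynomial (Fin 2) ℚ}
    (h : MvPolynomial.eval ![2, 3] p ≠ 0) : algebraMap (MvPolynomial (Fin 2) ℚ) K p ≠ 0 := by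
  rw [Ne, FaithfulSMul.algebraMap_eq_zero_iff]
  rintro rfl
  exact h (map_zero _)

theorem one_add_t₀_ne_zero : 1 + t₀ ≠ 0 := by
  have := algebraMap_ne_zero_of_eval (p := 1 + MvPolynomial.X 0) (by simp; norm_num)
  simpa [t₀] using this

theorem one_add_t₁_ne_zero : 1 + t₁ ≠ 0 := by
  have := algebraMap_ne_zero_of_eval (p := 1 + MvPolynomial.X 1) (by simp; norm_num)
  simpa [t₁] using this

theorem t₁_add_t₀_ne_zero : t₁ + t₀ ≠ 0 := by
  have := algebraMap_ne_zero_of_eval (p := MvPolynomial.X 1 + MvPolynomial.X 0)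
    (by simp; norm_num)
  simpa [t₁, t₀] using this

theorem one_add_mul_ne_zero : 1 + t₁ * t₀ ≠ 0 := by
  have := algebraMap_ne_zero_of_eval (p := 1 + MvPolynomial.X 1 * MvPolynomial.X 0)
    (by simp; norm_num)
  simpa [t₁, t₀] using this

theorem mul_sub_one_ne_zero : t₁ * t₀ - 1 ≠ 0 := by
  have := algebraMap_ne_zero_of_eval (p := MvPolynomial.X 1 * MvPolynomial.X 0 - 1)
    (by simp; norm_num)
  simpa [t₁, t₀] using this

theorem a25_numerator_ne_zero : 1 + t₁ * t₀ + t₁ ^ 2 * t₀ + t₁ * t₀ ^ 2 ≠ 0 := by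
  have := algebraMap_ne_zero_of_eval (p := 1 + MvPolynomial.X 1 * MvPolynomial.X 0 +
    MvPolynomial.X 1 ^ 2 * MvPolynomial.X 0 + MvPolynomial.X 1 * MvPolynomial.X 0 ^ 2)
    (by simp; norm_num)
  simpa [t₁, t₀] using this

/-- Each factor of the resultant is the numerator of `a_25` times a quotient of products of `t₀`,
`t₁`, `1 + t₀`, `1 + t₁`, `t₀ + t₁` and `t₀ t₁ ± 1`. -/
theorem resultant_eq {F : Type} [Field F] (t₀ t₁ : F) (h0 : t₀ ≠ 0) (h1 : t₁ ≠ 0)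
    (h2 : 1 + t₀ ≠ 0) (h3 : 1 + t₁ ≠ 0) (h4 : t₁ + t₀ ≠ 0) (h5 : 1 + t₁ * t₀ ≠ 0)
    (h6 : t₁ * t₀ - 1 ≠ 0) :
    (a25 t₀ t₁ - a61 t₀ t₁) * (a25 t₀ t₁ + a61 t₀ t₁ / t₀) * (a25 t₀ t₁ + a61 t₀ t₁ / t₁) =
      -((1 + t₁ * t₀ + t₁ ^ 2 * t₀ + t₁ * t₀ ^ 2) ^ 3 /
        ((t₁ + t₀) ^ 3 * (t₁ * t₀ - 1) ^ 3 * (1 + t₁ * t₀) ^ 3)) := by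
  have e0 : a25 t₀ t₁ - a61 t₀ t₁ = -((1 + t₁ * t₀ + t₁ ^ 2 * t₀ + t₁ * t₀ ^ 2) /
      ((t₁ + t₀) * (t₁ * t₀ - 1) * (1 + t₁ * t₀))) := by
    rw [a25, a61]
    field_simp
    ring
  have e1 : a25 t₀ t₁ + a61 t₀ t₁ / t₀ = (1 + t₁ * t₀ + t₁ ^ 2 * t₀ + t₁ * t₀ ^ 2) *
      (t₁ * (1 + t₀)) / (t₀ * (1 + t₁) * ((t₁ + t₀) * (t₁ * t₀ - 1) * (1 + t₁ * t₀))) := by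
    rw [a25, a61]
    field_simp
    ring
  have e2 : a25 t₀ t₁ + a61 t₀ t₁ / t₁ = (1 + t₁ * t₀ + t₁ ^ 2 * t₀ + t₁ * t₀ ^ 2) *
      (t₀ * (1 + t₁)) / (t₁ * (1 + t₀) * ((t₁ + t₀) * (t₁ * t₀ - 1) * (1 + t₁ * t₀))) := by
    rw [a25, a61]
    field_simp
    ring
  rw [e0, e1, e2]
  field_simp

theorem resultant_ne_zero : resultant ≠ 0 := by
  rw [resultant, resultant_eq t₀ t₁ t₀_ne_zero t₁_ne_zero one_add_t₀_ne_zero one_add_t₁_ne_zero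
    t₁_add_t₀_ne_zero one_add_mul_ne_zero mul_sub_one_ne_zero]
  exact neg_ne_zero.2 (div_ne_zero (pow_ne_zero _ a25_numerator_ne_zero)
    (mul_ne_zero (mul_ne_zero (pow_ne_zero _ t₁_add_t₀_ne_zero)
      (pow_ne_zero _ mul_sub_one_ne_zero)) (pow_ne_zero _ one_add_mul_ne_zero)))

theorem linVal_flatMap (n : ℕ) (u : BraidWord) (c q : List (K × BraidWord)) :
    linVal n (c.flatMap fun t => q.map fun p => (t.1 * p.1, u ++ t.2 ++ p.2)) =
      braidClass n (evalWord n u) * linVal n c * linVal n q := by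
  have inner : ∀ (a : K) (w : BraidWord), linVal n (q.map fun p => (a * p.1, w ++ p.2)) =
      a • braidClass n (evalWord n w) * linVal n q := fun a w => by
    have := linVal_context n a w [] q
    simpa only [List.append_nil, evalWord_nil, braidClass_one, mul_one, smul_mul_assoc] using this
  induction c with
  | nil => simp [linVal]
  | cons t c ih =>
    rw [List.flatMap_cons, linVal_append, ih, linVal_cons, inner, evalWord_append, braidClass_mul,
      mul_add, add_mul, mul_smul_comm]

/-- The two terms of `(R₃)` that `r3Rest` leaves out combine, since `s_3` commutes with `s_1`, to
`s_1⁻¹ s_2 s_3 (a_25 + a_61 s_1⁻¹)`. -/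
theorem linVal_r3Terms (n i : ℕ) :
    linVal n (shiftTerms i r3Terms) = linVal n (shiftTerms i r3Rest) +
      (a25 t₀ t₁ • braidClass n ((sigma n (1 + i))⁻¹ * sigma n (2 + i) * sigma n (3 + i)) +
       a61 t₀ t₁ • braidClass n ((sigma n (1 + i))⁻¹ * sigma n (2 + i) * (sigma n (1 + i))⁻¹ *
        sigma n (3 + i))) := by
  have h : r3Terms = r3Terms.take 24 ++ ((a25 t₀ t₁, [(1, false), (2, true), (3, true)]) ::
      ((r3Terms.drop 25).take 35 ++ ((a61 t₀ t₁, [(1, false), (2, true), (1, false), (3, true)]) ::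
        r3Terms.drop 61))) := rfl
  rw [h]
  simp only [r3Rest, shiftTerms, List.map_append, List.map_cons, linVal_append, linVal_cons]
  simp only [shift, List.map_cons, List.map_nil, evalWord_cons_true, evalWord_cons_false,
    evalWord_nil, mul_one, mul_assoc]
  abel

theorem inverseTerms_spec {n i : ℕ} (h : i + 2 ≤ n) :
    (a25 t₀ t₁ • 1 + a61 t₀ t₁ • braidClass n (sigma n (1 + i))⁻¹) *
      linVal n (shiftTerms i inverseTerms) = 1 := by
  have hs := skein_one (n := n) (i := 1 + i) (by omega) (by omega) 1
    ((sigma n (1 + i))⁻¹ * (sigma n (1 + i))⁻¹)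
  simp only [one_mul, mul_assoc, mul_inv_cancel_left, mul_inv_cancel, braidClass_one] at hs
  simp only [inverseTerms, shiftTerms, shift, linVal, List.map_cons, List.map_nil, List.sum_cons,
    List.sum_nil, evalWord_cons_false, evalWord_nil, mul_one, braidClass_one]
  simp only [braidClass_mul, ← mul_assoc] at hs ⊢
  refine linear_inverse (F := K) (A := C n) (mul_ne_zero t₀_ne_zero t₁_ne_zero)
    resultant_ne_zero ?_ hs
  have h0 := t₀_ne_zero
  have h1 := t₁_ne_zero
  rw [resultant]
  generalize a25 t₀ t₁ = a
  generalize a61 t₀ t₁ = b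
  field

theorem linVal_shift_flatMap (n i : ℕ) (u : BraidWord) (c q : List (K × BraidWord)) :
    linVal n (shiftTerms i (c.flatMap fun t => q.map fun p => (t.1 * p.1, u ++ t.2 ++ p.2))) =
      braidClass n (evalWord n (shift i u)) * linVal n (shiftTerms i c) *
        linVal n (shiftTerms i q) := by
  rw [← linVal_flatMap]
  simp only [shiftTerms, List.map_flatMap, List.map_map, List.flatMap_map, Function.comp_def, shift,
    List.map_append]

theorem linVal_shift_neg (n i : ℕ) (c : List (K × BraidWord)) :
    linVal n (shiftTerms i (c.map fun t => (-t.1, t.2))) = -linVal n (shiftTerms i c) := by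
  rw [← linVal_neg]
  simp only [shiftTerms, List.map_map, Function.comp_def]

theorem holds_rulesFour {n i : ℕ} {r : Rule} (hr : r ∈ rulesFour) (h : i + r.1 ≤ n) :
    r.Holds n i := by
  simp only [rulesFour, List.mem_cons, List.not_mem_nil, or_false] at hr
  have h' : i + 4 ≤ n := by rcases hr with rfl | rfl | rfl | rfl | rfl | rfl <;> exact h
  have hxy : sigma n (1 + i) * sigma n (2 + i) * sigma n (1 + i) =
      sigma n (2 + i) * sigma n (1 + i) * sigma n (2 + i) := by
    have := sigma_braid n (1 + i) (by omega) (by omega)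
    rwa [show 1 + i + 1 = 2 + i by omega] at this
  have hyz : sigma n (2 + i) * sigma n (3 + i) * sigma n (2 + i) =
      sigma n (3 + i) * sigma n (2 + i) * sigma n (3 + i) := by
    have := sigma_braid n (2 + i) (by omega) (by omega)
    rwa [show 2 + i + 1 = 3 + i by omega] at this
  have hxz : sigma n (1 + i) * sigma n (3 + i) = sigma n (3 + i) * sigma n (1 + i) :=
    sigma_comm n _ _ (by omega)
  have hneg : ∀ e : C n, (-1 : K) • e = -e := fun e => neg_one_smul K e
  have h3 := skein_three h'
  dsimp only at h3
  rcases hr with rfl | rfl | rfl | rfl | rfl | rfl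
  · have := braid_mixed hxy hyz hxz
    simpa [Rule.Holds, shift, shiftTerms, linVal, mul_assoc] using congrArg (braidClass n) this
  · have := braid_mixed (braid_inv hxy) (braid_inv hyz)
      (by rw [← mul_inv_rev, ← mul_inv_rev, hxz])
    simpa [Rule.Holds, shift, shiftTerms, linVal, mul_assoc] using
      congrArg (fun g => braidClass n g⁻¹) this
  · have := braid_across hxy hyz hxz
    simpa [Rule.Holds, shift, shiftTerms, linVal, mul_assoc] using congrArg (braidClass n) this
  · rw [Rule.Holds]
    have e : ∀ t c, shiftTerms i (t :: c) = (t.1, shift i t.2) :: shiftTerms i c := fun _ _ => rfl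
    simp only [e, linVal_cons, linVal_shift_neg]
    simp only [shift, List.map_cons, List.map_nil, evalWord_cons_true, evalWord_cons_false,
      evalWord_nil, mul_one, one_smul]
    simp only [mul_assoc] at h3
    linear_combination (norm := skip) -h3
    abel
  · rw [Rule.Holds]
    have e : ∀ t c, shiftTerms i (t :: c) = (t.1, shift i t.2) :: shiftTerms i c := fun _ _ => rfl
    simp only [e, linVal_cons]
    simp only [shift, List.map_cons, List.map_nil, evalWord_cons_true, evalWord_cons_false,
      evalWord_nil, mul_one, one_smul]
    simp only [mul_assoc] at h3
    linear_combination (norm := skip) h3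
    abel
  · rw [Rule.Holds, linVal_shift_flatMap]
    have e : ∀ t c, shiftTerms i (t :: c) = (t.1, shift i t.2) :: shiftTerms i c := fun _ _ => rfl
    simp only [e, linVal_cons, linVal_shift_neg]
    simp only [shift, List.map_cons, List.map_nil, evalWord_cons_true, evalWord_cons_false,
      evalWord_nil, mul_one, one_smul, hneg]
    rw [linVal_r3Terms] at h3
    have hxz' : (sigma n (1 + i))⁻¹ * sigma n (3 + i) = sigma n (3 + i) * (sigma n (1 + i))⁻¹ := by
      rw [inv_mul_eq_iff_eq_mul, ← mul_assoc, hxz, mul_inv_cancel_right]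
    have key : braidClass n (sigma n (3 + i) * sigma n (2 + i)) *
        (braidClass n (sigma n (1 + i) * ((sigma n (3 + i))⁻¹ * (sigma n (2 + i) *
          (sigma n (3 + i))⁻¹))) + (-braidClass n ((sigma n (3 + i))⁻¹ * (sigma n (2 + i) *
          ((sigma n (3 + i))⁻¹ * sigma n (1 + i)))) + -linVal n (shiftTerms i r3Rest))) =
        braidClass n (sigma n (3 + i) * (sigma n (2 + i) * ((sigma n (1 + i))⁻¹ *
          (sigma n (2 + i) * sigma n (3 + i))))) *
        (a25 t₀ t₁ • 1 + a61 t₀ t₁ • braidClass n (sigma n (1 + i))⁻¹) := by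
      simp only [mul_assoc, hxz'] at h3 ⊢
      have h4 := congrArg (braidClass n (sigma n (3 + i) * sigma n (2 + i)) * ·) h3
      simp only [mul_sub, mul_add, mul_zero, mul_smul_comm, ← braidClass_mul, mul_assoc, mul_neg,
        mul_one] at h4 ⊢
      linear_combination (norm := skip) h4
      abel
    rw [key, mul_assoc _ (_ + _), inverseTerms_spec (by omega), mul_one]

theorem holds_of_mem_rules {n i : ℕ} {r : Rule} (hr : r ∈ rules) (h : i + r.1 ≤ n) :
    r.Holds n i := by
  simp only [rules, List.mem_append] at hr
  rcases hr with ((hr | hr) | hr) | hr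
  exacts [holds_rulesOne hr h, holds_rulesBraid hr h, holds_rulesThree hr h, holds_rulesFour hr h]

theorem evalWord_comm (n : ℕ) {k l : ℕ × Bool} (h : k.1 + 1 < l.1 ∨ l.1 + 1 < k.1) :
    evalWord n [k, l] = evalWord n [l, k] := by
  have hc : Commute (sigma n k.1) (sigma n l.1) := by
    rcases h with h | h
    · exact sigma_comm n _ _ h
    · exact (sigma_comm n _ _ h).symm
  obtain ⟨i, _ | _⟩ := k <;> obtain ⟨j, _ | _⟩ := l <;>
    simp only [evalWord_cons_true, evalWord_cons_false, evalWord_nil, mul_one]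
  · exact hc.inv_inv
  · exact hc.inv_left
  · exact hc.inv_right
  · exact hc

/-! ### Calculus of reductions -/

namespace Reduces

variable {n : ℕ} {S T : BraidWord → Prop} {w w' : BraidWord}

theorem of_eq (h : Reduces n T w) (e : w = w') : Reduces n T w' := e ▸ h

/-- Reductions compose, and can be carried out inside a longer word. -/
theorem trans (h : Reduces n S w) (u v : BraidWord)
    (hST : ∀ w', S w' → Reduces n T (u ++ w' ++ v)) : Reduces n T (u ++ w ++ v) := by
  induction h with
  | base hw => exact hST _ hw
  | rule u' v' hr hi _ ih =>
    refine (rule (u ++ u') (v' ++ v) hr hi fun t ht => (ih t ht).of_eq ?_).of_eq ?_ <;> simp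
  | comm u' v' hkl _ ih =>
    refine (comm (u ++ u') (v' ++ v) hkl (ih.of_eq ?_)).of_eq ?_ <;> simp

theorem mono {n' : ℕ} (h : Reduces n T w) (hn : n ≤ n') : Reduces n' T w := by
  induction h with
  | base hw => exact base hw
  | rule u v hr hi _ ih => exact rule u v hr (hi.trans hn) ih
  | comm u v hkl _ ih => exact comm u v hkl ih

theorem move_left {k : ℕ × Bool} {p : BraidWord}
    (hp : ∀ l ∈ p, k.1 + 1 < l.1 ∨ l.1 + 1 < k.1) (u v : BraidWord)
    (h : Reduces n T (u ++ p ++ [k] ++ v)) : Reduces n T (u ++ [k] ++ p ++ v) := by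
  induction p generalizing u with
  | nil => simpa using h
  | cons l p ih =>
    simp only [List.mem_cons, forall_eq_or_imp] at hp
    refine (comm u (p ++ v) hp.1 ((ih hp.2 (u ++ [l]) (h.of_eq (by simp))).of_eq ?_)).of_eq ?_ <;>
      simp

theorem move_right {k : ℕ × Bool} {p : BraidWord}
    (hp : ∀ l ∈ p, k.1 + 1 < l.1 ∨ l.1 + 1 < k.1) (u v : BraidWord)
    (h : Reduces n T (u ++ [k] ++ p ++ v)) : Reduces n T (u ++ p ++ [k] ++ v) := by
  induction p generalizing u with
  | nil => simpa using h
  | cons l p ih =>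
    simp only [List.mem_cons, forall_eq_or_imp] at hp
    refine (ih hp.2 (u ++ [l]) (((comm u (p ++ v) hp.1.symm (h.of_eq ?_))).of_eq ?_)).of_eq ?_ <;>
      simp

theorem of_ruleOne {r : Rule} {i : ℕ} (u v : BraidWord) (hr : r ∈ rulesOne) (hi : i + r.1 ≤ n)
    (h : ∀ t ∈ r.2.2, Reduces n T (u ++ shift i t.2 ++ v)) :
    Reduces n T (u ++ shift i r.2.1 ++ v) :=
  rule u v (by simp only [rules, List.mem_append, hr, true_or]) hi h

theorem of_ruleBraid {r : Rule} {i : ℕ} (u v : BraidWord) (hr : r ∈ rulesBraid) (hi : i + r.1 ≤ n)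
    (h : ∀ t ∈ r.2.2, Reduces n T (u ++ shift i t.2 ++ v)) :
    Reduces n T (u ++ shift i r.2.1 ++ v) :=
  rule u v (by simp only [rules, List.mem_append, hr, true_or, or_true]) hi h

theorem of_ruleThree {r : Rule} {i : ℕ} (u v : BraidWord) (hr : r ∈ rulesThree) (hi : i + r.1 ≤ n)
    (h : ∀ t ∈ r.2.2, Reduces n T (u ++ shift i t.2 ++ v)) :
    Reduces n T (u ++ shift i r.2.1 ++ v) :=
  rule u v (by simp only [rules, List.mem_append, hr, true_or, or_true]) hi h

theorem of_ruleFour {r : Rule} {i : ℕ} (u v : BraidWord) (hr : r ∈ rulesFour) (hi : i + r.1 ≤ n)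
    (h : ∀ t ∈ r.2.2, Reduces n T (u ++ shift i t.2 ++ v)) :
    Reduces n T (u ++ shift i r.2.1 ++ v) :=
  rule u v (by simp only [rules, List.mem_append, hr, or_true]) hi h

theorem cancel {k : ℕ} (hk : 1 ≤ k) (hkn : k < n) (e : Bool) (u v : BraidWord)
    (h : Reduces n T (u ++ v)) : Reduces n T (u ++ [(k, e), (k, !e)] ++ v) := by
  obtain ⟨i, rfl⟩ := Nat.exists_eq_add_of_le hk
  cases e
  · exact of_ruleOne u v (r := rulesOne[1]) (List.getElem_mem _) (by simp [rulesOne]; omega)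
      (by simpa [rulesOne, shift] using h)
  · exact of_ruleOne u v (r := rulesOne[0]) (List.getElem_mem _) (by simp [rulesOne]; omega)
      (by simpa [rulesOne, shift] using h)

theorem square {k : ℕ} (hk : 1 ≤ k) (hkn : k < n) (e : Bool) (u v : BraidWord)
    (h : Reduces n T (u ++ v)) (h' : ∀ f, Reduces n T (u ++ [(k, f)] ++ v)) :
    Reduces n T (u ++ [(k, e), (k, e)] ++ v) := by
  obtain ⟨i, rfl⟩ := Nat.exists_eq_add_of_le hk
  have h1 := h' true
  have h2 := h' false
  simp only [List.append_assoc] at h1 h2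
  cases e
  · exact of_ruleOne u v (r := rulesOne[4]) (List.getElem_mem _) (by simp [rulesOne]; omega)
      (by simpa [rulesOne, shift] using ⟨h1, h, h2⟩)
  · exact of_ruleOne u v (r := rulesOne[3]) (List.getElem_mem _) (by simp [rulesOne]; omega)
      (by simpa [rulesOne, shift] using ⟨h1, h, h2⟩)

/-- A word with two adjacent letters `s_k`, of any signs, reduces to words with at most one. -/
theorem pair {k : ℕ} (hk : 1 ≤ k) (hkn : k < n) (e f : Bool) (u v : BraidWord)
    (h : Reduces n T (u ++ v)) (h' : ∀ f, Reduces n T (u ++ [(k, f)] ++ v)) :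
    Reduces n T (u ++ [(k, e), (k, f)] ++ v) := by
  by_cases hef : f = e
  · exact hef ▸ square hk hkn f u v h h'
  · rw [Bool.eq_not_of_ne hef]
    exact cancel hk hkn e u v h

theorem of_inverse {k : ℕ} (hk : 1 ≤ k) (hkn : k < n) (u v : BraidWord)
    (h : Reduces n T (u ++ v)) (h' : Reduces n T (u ++ [(k, true)] ++ v))
    (h'' : Reduces n T (u ++ [(k, true), (k, true)] ++ v)) :
    Reduces n T (u ++ [(k, false)] ++ v) := by
  obtain ⟨i, rfl⟩ := Nat.exists_eq_add_of_le hk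
  simp only [List.append_assoc] at h' h''
  exact of_ruleOne u v (r := rulesOne[2]) (List.getElem_mem _) (by simp [rulesOne]; omega)
    (by simpa [rulesOne, shift] using ⟨h'', h', h⟩)

end Reduces

theorem IsBraidWord.append {n : ℕ} {u v : BraidWord} (hu : IsBraidWord n u) (hv : IsBraidWord n v) :
    IsBraidWord n (u ++ v) := fun l hl => (List.mem_append.1 hl).elim (hu l) (hv l)

theorem IsBraidWord.mono {m n : ℕ} {u : BraidWord} (hu : IsBraidWord m u) (h : m ≤ n) :
    IsBraidWord n u := fun l hl => ⟨(hu l hl).1, (hu l hl).2.trans_le h⟩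

theorem isBraidWord_append {n : ℕ} {u v : BraidWord} :
    IsBraidWord n (u ++ v) ↔ IsBraidWord n u ∧ IsBraidWord n v :=
  ⟨fun h => ⟨fun l hl => h l (by simp [hl]), fun l hl => h l (by simp [hl])⟩,
    fun h => h.1.append h.2⟩

theorem isBraidWord_cons {n : ℕ} {l : ℕ × Bool} {u : BraidWord} :
    IsBraidWord n (l :: u) ↔ (1 ≤ l.1 ∧ l.1 < n) ∧ IsBraidWord n u := List.forall_mem_cons

theorem isBraidWord_nil (n : ℕ) : IsBraidWord n [] := by simp [IsBraidWord]

/-- Since `(R₁)` expresses `s_k⁻¹` by `s_k ^ 2`, `s_k` and `1`, only positive words matter. -/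
theorem reduces_positive {m n : ℕ} (hmn : m ≤ n) {w : BraidWord} (hw : IsBraidWord m w) :
    Reduces n (fun w' => IsBraidWord m w' ∧ ∀ l ∈ w', l.2 = true) w := by
  induction w with
  | nil => exact .base ⟨hw, by simp⟩
  | cons l w ih =>
    rw [isBraidWord_cons] at hw
    refine ((ih hw.2).trans [l] [] fun w' hw' => ?_).of_eq (by simp)
    obtain ⟨k, _ | _⟩ := l
    · refine (Reduces.of_inverse hw.1.1 (hw.1.2.trans_le hmn) [] (w' ++ []) (.base ?_) (.base ?_)
        (.base ?_)).of_eq (by simp) <;>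
      simpa [isBraidWord_cons, hw.1.1, hw.1.2] using hw'
    · exact .base (by simpa [isBraidWord_cons, hw.1.1, hw.1.2] using hw')

/-! ### Words with at most one top letter -/

/-- Words in the letters of `B_{m+1}` in which the top letters `s_m`, `s_m⁻¹` occur at most once. -/
def IsSingle (m : ℕ) (w : BraidWord) : Prop :=
  IsBraidWord (m + 1) w ∧ w.countP (fun l => l.1 == m) ≤ 1

theorem countP_eq_zero {m : ℕ} {w : BraidWord} (hw : IsBraidWord m w) :
    w.countP (fun l => l.1 == m) = 0 :=
  List.countP_eq_zero.2 fun l hl => by simpa using (hw l hl).2.ne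

theorem isSingle_context {m : ℕ} {u v w : BraidWord} (hu : IsBraidWord m u) (hv : IsBraidWord m v)
    (hw : IsSingle m w) : IsSingle m (u ++ w ++ v) :=
  ⟨((hu.mono m.le_succ).append hw.1).append (hv.mono m.le_succ), by
    simpa [countP_eq_zero hu, countP_eq_zero hv] using hw.2⟩

theorem IsBraidWord.isSingle {m : ℕ} {w : BraidWord} (hw : IsBraidWord m w) : IsSingle m w :=
  ⟨hw.mono m.le_succ, by simp [countP_eq_zero hw]⟩

theorem isSingle_letter {m : ℕ} (hm : 1 ≤ m) (e : Bool) : IsSingle m [(m, e)] :=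
  ⟨by simp [isBraidWord_cons, isBraidWord_nil, hm], by simp⟩

theorem isBraidWord_of_countP {m : ℕ} {w : BraidWord} (hw : IsBraidWord (m + 1) w)
    (h : w.countP (fun l => l.1 == m) = 0) : IsBraidWord m w := fun l hl => by
  have h1 := hw l hl
  have h2 : l.1 ≠ m := by simpa using List.countP_eq_zero.1 h l hl
  omega

theorem IsSingle.cases {m : ℕ} {w : BraidWord} (hw : IsSingle m w) :
    IsBraidWord m w ∨ (1 ≤ m ∧ ∃ u v : BraidWord, ∃ e : Bool,
      IsBraidWord m u ∧ IsBraidWord m v ∧ w = u ++ [(m, e)] ++ v) := by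
  by_cases h : w.countP (fun l => l.1 == m) = 0
  · exact Or.inl (isBraidWord_of_countP hw.1 h)
  · obtain ⟨⟨k, e⟩, hl, hk⟩ := List.countP_pos_iff.1 (Nat.pos_of_ne_zero h)
    obtain rfl : k = m := by simpa using hk
    obtain ⟨u, v, rfl⟩ := List.append_of_mem hl
    obtain ⟨h1, h2⟩ := hw
    rw [isBraidWord_append, isBraidWord_cons] at h1
    simp only [List.countP_append, List.countP_cons, beq_self_eq_true, if_true] at h2
    exact Or.inr ⟨h1.2.1.1, u, v, e, isBraidWord_of_countP h1.1 (by omega),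
      isBraidWord_of_countP h1.2.2 (by omega), by simp⟩

/-- The words that the reduction in `B_{m+1}` aims at. -/
def IsTarget (m : ℕ) (w : BraidWord) : Prop :=
  IsSingle m w ∨ (2 ≤ m ∧ ∃ u : BraidWord, IsBraidWord (m - 1) u ∧
    w = u ++ [(m, false), (m - 1, true), (m, false)])

theorem IsTarget.isReducedWord {m : ℕ} {w : BraidWord} (hw : IsTarget m w) :
    IsReducedWord (m + 1) w := by
  rcases hw with hw | ⟨-, hw⟩
  · rcases hw.cases with h | ⟨-, h⟩
    · exact Or.inl h
    · exact Or.inr (Or.inl h)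
  · exact Or.inr (Or.inr hw)

theorem reduces_of_isSingle {m n : ℕ} {u v w : BraidWord} (hu : IsBraidWord m u)
    (hv : IsBraidWord m v) (hw : IsSingle m w) : Reduces n (IsTarget m) (u ++ w ++ v) :=
  .base (Or.inl (isSingle_context hu hv hw))

theorem isBraidWord_shift {m i : ℕ} {w : BraidWord} (hw : IsBraidWord m w) :
    IsBraidWord (m + i) (shift i w) := by
  intro l hl
  obtain ⟨k, hk, rfl⟩ := List.mem_map.1 hl
  have := hw k hk
  exact ⟨by dsimp only; omega, by dsimp only; omega⟩

theorem isSingle_shift {m i : ℕ} {w : BraidWord} (hw : IsSingle m w) :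
    IsSingle (m + i) (shift i w) := by
  refine ⟨(isBraidWord_shift (i := i) hw.1).mono (by omega), ?_⟩
  rw [shift, List.countP_map]
  exact (List.countP_congr fun l _ => by simp).trans_le hw.2

instance (n : ℕ) (w : BraidWord) : Decidable (IsBraidWord n w) :=
  inferInstanceAs (Decidable (∀ l ∈ w, _))

instance (m : ℕ) (w : BraidWord) : Decidable (IsSingle m w) :=
  inferInstanceAs (Decidable (_ ∧ _))

theorem isSingle_r3BraidWords : ∀ w ∈ r3BraidWords, IsSingle 3 w := by decide

theorem isSingle_of_mem_r3Terms {t : K × BraidWord} (ht : t ∈ r3Terms) : IsSingle 3 t.2 :=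
  isSingle_r3BraidWords _ (List.of_mem_zip (a := t.1) (b := t.2) ht).2

/-! ### Words with the factor `s_m⁻¹ s_{m-1} s_m⁻¹` -/

/-- The word `s_m⁻¹ s_{m-1} s_m⁻¹`. -/
def hook (m : ℕ) : BraidWord := [(m, false), (m - 1, true), (m, false)]

theorem far_of_isBraidWord {m : ℕ} {p : BraidWord} (hp : IsBraidWord m p) {k : ℕ × Bool}
    (hk : m < k.1) : ∀ l ∈ p, k.1 + 1 < l.1 ∨ l.1 + 1 < k.1 := fun l hl => by
  have := (hp l hl).2
  omega

theorem far_hook {j m : ℕ} (hj : j + 2 < m) :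
    ∀ l ∈ hook m, j + 1 < l.1 ∨ l.1 + 1 < j := by
  intro l hl
  simp only [hook, List.mem_cons, List.not_mem_nil, or_false] at hl
  rcases hl with rfl | rfl | rfl <;> dsimp only <;> omega

theorem reduces_pair {m n : ℕ} (hm : 1 ≤ m) (hmn : m < n) {u v : BraidWord} (e f : Bool)
    (hu : IsBraidWord m u) (hv : IsBraidWord m v) :
    Reduces n (IsTarget m) (u ++ [(m, e), (m, f)] ++ v) :=
  Reduces.pair hm hmn e f u v (.base (Or.inl (hu.append hv).isSingle)) fun f =>
    reduces_of_isSingle hu hv (isSingle_letter hm f)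

/-- `s_{m-1}` is absorbed on the right by the hook, up to words with one top letter. -/
theorem hook_mul_letter {m : ℕ} (hm : 2 ≤ m) {u v : BraidWord} (hu : IsBraidWord m u)
    (hv : IsBraidWord m v) (h : Reduces (m + 1) (IsTarget m) (u ++ hook m ++ v)) :
    Reduces (m + 1) (IsTarget m) (u ++ hook m ++ [(m - 1, true)] ++ v) := by
  obtain ⟨i, rfl⟩ := Nat.exists_eq_add_of_le hm
  have e : 2 + i - 1 = 1 + i := by omega
  have hx : IsBraidWord (2 + i) [(1 + i, true), (1 + i, true)] := by
    simp [isBraidWord_cons, isBraidWord_nil]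
  rw [hook, e] at h ⊢
  refine (Reduces.of_ruleThree u v (r := rulesThree[2]) (i := i) (List.getElem_mem _)
    (by change i + 3 ≤ 2 + i + 1; omega) ?_).of_eq (by simp [rulesThree, shift])
  simp only [rulesThree, List.getElem_cons_succ, List.getElem_cons_zero, List.forall_mem_cons]
  refine ⟨h, ?_, ?_, ?_, ?_, ?_, ?_, ?_, ?_, ?_, ?_, by simp⟩
  case refine_9 =>
    exact (reduces_pair (by omega) (by omega) false false hu (hx.append hv)).of_eq
      (by simp [shift])
  case refine_10 =>
    exact reduces_pair (by omega) (by omega) false false hu hv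
  all_goals exact reduces_of_isSingle hu hv (isSingle_shift (m := 2) (by decide))

/-- `s_{m-1}` is absorbed on the left by the hook, up to words with one top letter. -/
theorem letter_mul_hook {m : ℕ} (hm : 2 ≤ m) {u v : BraidWord} (hu : IsBraidWord m u)
    (hv : IsBraidWord m v) (h : Reduces (m + 1) (IsTarget m) (u ++ hook m ++ v)) :
    Reduces (m + 1) (IsTarget m) (u ++ [(m - 1, true)] ++ hook m ++ v) := by
  obtain ⟨i, rfl⟩ := Nat.exists_eq_add_of_le hm
  have e : 2 + i - 1 = 1 + i := by omega
  have hx : IsBraidWord (2 + i) [(1 + i, true), (1 + i, true)] := by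
    simp [isBraidWord_cons, isBraidWord_nil]
  rw [hook, e] at h ⊢
  refine (Reduces.of_ruleThree u v (r := rulesThree[3]) (i := i) (List.getElem_mem _)
    (by change i + 3 ≤ 2 + i + 1; omega) ?_).of_eq (by simp [rulesThree, shift])
  simp only [rulesThree, List.getElem_cons_succ, List.getElem_cons_zero, List.forall_mem_cons]
  refine ⟨h, ?_, ?_, ?_, ?_, ?_, ?_, ?_, ?_, ?_, ?_, by simp⟩
  case refine_9 =>
    exact (reduces_pair (by omega) (by omega) false false (hu.append hx) hv).of_eq
      (by simp [shift])
  case refine_10 =>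
    exact reduces_pair (by omega) (by omega) false false hu hv
  all_goals exact reduces_of_isSingle hu hv (isSingle_shift (m := 2) (by decide))

/-- By `(R₃)`, the hook commutes with `s_{m-2}` up to words with one top letter. -/
theorem hook_comm_right {m : ℕ} (hm : 3 ≤ m) {u v : BraidWord} (hu : IsBraidWord m u)
    (hv : IsBraidWord m v)
    (h : Reduces (m + 1) (IsTarget m) (u ++ [(m - 2, true)] ++ hook m ++ v)) :
    Reduces (m + 1) (IsTarget m) (u ++ hook m ++ [(m - 2, true)] ++ v) := by
  obtain ⟨i, rfl⟩ := Nat.exists_eq_add_of_le hm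
  have e : 3 + i - 1 = 2 + i := by omega
  have e' : 3 + i - 2 = 1 + i := by omega
  rw [hook, e, e'] at h ⊢
  refine (Reduces.of_ruleFour u v (r := rulesFour[3]) (i := i) (List.getElem_mem _)
    (by change i + 4 ≤ 3 + i + 1; omega) ?_).of_eq (by simp [rulesFour, shift])
  simp only [rulesFour, List.getElem_cons_succ, List.getElem_cons_zero, List.forall_mem_cons,
    List.forall_mem_map]
  exact ⟨h.of_eq (by simp [shift]), fun t ht =>
    reduces_of_isSingle hu hv (isSingle_shift (isSingle_of_mem_r3Terms ht))⟩

theorem hook_comm_left {m : ℕ} (hm : 3 ≤ m) {u v : BraidWord} (hu : IsBraidWord m u)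
    (hv : IsBraidWord m v)
    (h : Reduces (m + 1) (IsTarget m) (u ++ hook m ++ [(m - 2, true)] ++ v)) :
    Reduces (m + 1) (IsTarget m) (u ++ [(m - 2, true)] ++ hook m ++ v) := by
  obtain ⟨i, rfl⟩ := Nat.exists_eq_add_of_le hm
  have e : 3 + i - 1 = 2 + i := by omega
  have e' : 3 + i - 2 = 1 + i := by omega
  rw [hook, e, e'] at h ⊢
  refine (Reduces.of_ruleFour u v (r := rulesFour[4]) (i := i) (List.getElem_mem _)
    (by change i + 4 ≤ 3 + i + 1; omega) ?_).of_eq (by simp [rulesFour, shift])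
  simp only [rulesFour, List.getElem_cons_succ, List.getElem_cons_zero, List.forall_mem_cons]
  exact ⟨h.of_eq (by simp [shift]), fun t ht =>
    reduces_of_isSingle hu hv (isSingle_shift (isSingle_of_mem_r3Terms ht))⟩

/-- The letters of `v` either pass the hook, and join `u`, or are absorbed by it. -/
theorem reduces_hook_positive {m : ℕ} (hm : 2 ≤ m) {u v : BraidWord} (hu : IsBraidWord (m - 1) u)
    (hv : IsBraidWord m v) (hpos : ∀ l ∈ v, l.2 = true) :
    Reduces (m + 1) (IsTarget m) (u ++ hook m ++ v) := by
  induction v generalizing u with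
  | nil => exact .base (Or.inr ⟨hm, u, hu, by simp [hook]⟩)
  | cons l v ih =>
    obtain ⟨j, e⟩ := l
    rw [isBraidWord_cons] at hv
    rw [List.forall_mem_cons] at hpos
    obtain rfl : e = true := hpos.1
    have hu' : IsBraidWord m u := hu.mono (Nat.sub_le m 1)
    have hj : j < m - 1 → IsBraidWord (m - 1) (u ++ [(j, true)]) := fun h =>
      hu.append (by simpa [isBraidWord_cons, isBraidWord_nil] using ⟨hv.1.1, h⟩)
    obtain rfl | h | h : j = m - 1 ∨ j + 2 = m ∨ j + 2 < m := by have := hv.1.2; omega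
    · exact (hook_mul_letter hm hu' hv.2 (ih hu hv.2 hpos.2)).of_eq (by simp)
    · obtain rfl : j = m - 2 := by omega
      have := hv.1.1
      exact (hook_comm_right (by omega) hu' hv.2
        (ih (hj (by omega)) hv.2 hpos.2)).of_eq (by simp)
    · exact (Reduces.move_right (far_hook h) u v
        (ih (hj (by omega)) hv.2 hpos.2)).of_eq (by simp)

/-- The words `u s_m⁻¹ s_{m-1} s_m⁻¹ v` with arbitrary `u`, `v` in the letters of `B_m` reduce. -/
theorem reduces_hook {m : ℕ} (hm : 2 ≤ m) {u v : BraidWord} (hu : IsBraidWord m u)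
    (hv : IsBraidWord m v) : Reduces (m + 1) (IsTarget m) (u ++ hook m ++ v) := by
  suffices H : ∀ u : BraidWord, IsBraidWord m u → (∀ l ∈ u, l.2 = true) → ∀ v, IsBraidWord m v →
      Reduces (m + 1) (IsTarget m) (u ++ hook m ++ v) by
    exact ((reduces_positive (Nat.le_succ m) hu).trans [] (hook m ++ v) fun u' hu' =>
      (H u' hu'.1 hu'.2 v hv).of_eq (by simp)).of_eq (by simp)
  intro u
  induction u using List.reverseRecOn with
  | nil =>
    intro _ _ v hv
    exact ((reduces_positive (Nat.le_succ m) hv).trans (hook m) [] fun v' hv' =>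
      (reduces_hook_positive hm (isBraidWord_nil _) hv'.1 hv'.2).of_eq (by simp)).of_eq (by simp)
  | append_singleton u l ih =>
    intro hu hpos v hv
    obtain ⟨j, e⟩ := l
    obtain rfl : e = true := hpos (j, e) (by simp)
    rw [isBraidWord_append, isBraidWord_cons] at hu
    have ih' := ih hu.1 (fun l hl => hpos l (by simp [hl]))
    have hv' : IsBraidWord m ([(j, true)] ++ v) := by
      rw [isBraidWord_append, isBraidWord_cons]
      exact ⟨hu.2, hv⟩
    obtain rfl | h | h : j = m - 1 ∨ j + 2 = m ∨ j + 2 < m := by have := hu.2.1.2; omega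
    · exact letter_mul_hook hm hu.1 hv (ih' v hv)
    · obtain rfl : j = m - 2 := by omega
      have := hu.2.1.1
      exact hook_comm_left (by omega) hu.1 hv ((ih' _ hv').of_eq (by simp))
    · exact Reduces.move_left (far_hook h) u v ((ih' _ hv').of_eq (by simp))

/-! ### Words with two top letters -/

/-- For one choice of signs `s_m^{±1} s_{m-1}^{±1} s_m^{±1}` is the hook and for another one `(R₁)`
leads to the hook; for all others the braid relation applies. -/
theorem reduces_triple {m : ℕ} (hm : 2 ≤ m) {u v : BraidWord} (hu : IsBraidWord m u)
    (hv : IsBraidWord m v) (e g f : Bool) :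
    Reduces (m + 1) (IsTarget m) (u ++ [(m, e), (m - 1, g), (m, f)] ++ v) := by
  obtain ⟨i, rfl⟩ := Nat.exists_eq_add_of_le hm
  have hh : ∀ v, IsBraidWord (2 + i) v → _ := fun v hv => reduces_hook hm hu hv
  have e' : 2 + i - 1 = 1 + i := by omega
  simp only [hook, e'] at hh ⊢
  have hx : ∀ b, IsBraidWord (2 + i) [(1 + i, b)] := fun b => by
    simp [isBraidWord_cons, isBraidWord_nil]
  have braid : ∀ k (hk : k < rulesBraid.length), rulesBraid[k].1 = 3 →
      (∀ t ∈ rulesBraid[k].2.2, IsSingle 2 t.2) →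
      Reduces (2 + i + 1) (IsTarget (2 + i)) (u ++ shift i rulesBraid[k].2.1 ++ v) :=
    fun k hk h3 h => Reduces.of_ruleBraid u v (List.getElem_mem _) (by rw [h3]; omega)
      fun t ht => reduces_of_isSingle hu hv (isSingle_shift (h t ht))
  cases e <;> cases g <;> cases f
  · exact (braid 5 (by simp [rulesBraid]) rfl (by simp [rulesBraid]; decide)).of_eq rfl
  · exact (braid 4 (by simp [rulesBraid]) rfl (by simp [rulesBraid]; decide)).of_eq rfl
  · exact hh v hv
  · exact (braid 2 (by simp [rulesBraid]) rfl (by simp [rulesBraid]; decide)).of_eq rfl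
  · exact (braid 3 (by simp [rulesBraid]) rfl (by simp [rulesBraid]; decide)).of_eq rfl
  · refine (Reduces.of_ruleThree u v (r := rulesThree[0]) (i := i) (List.getElem_mem _)
      (by change i + 3 ≤ 2 + i + 1; omega) ?_).of_eq (by simp [rulesThree, shift])
    simp only [rulesThree, List.getElem_cons_zero, List.forall_mem_cons]
    refine ⟨?_, ?_, ?_, by simp⟩
    case refine_3 =>
      exact (hh ([(1 + i, false)] ++ v) ((hx false).append hv)).of_eq (by simp [shift])
    all_goals exact reduces_of_isSingle hu hv (isSingle_shift (m := 2) (by decide))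
  · exact (braid 1 (by simp [rulesBraid]) rfl (by simp [rulesBraid]; decide)).of_eq rfl
  · exact (braid 0 (by simp [rulesBraid]) rfl (by simp [rulesBraid]; decide)).of_eq rfl

/-- Two top letters that enclose a word with at most one letter of the next lower index. -/
theorem reduces_sandwich {m : ℕ} (hm : 1 ≤ m) {u v w : BraidWord} (hu : IsBraidWord m u)
    (hv : IsBraidWord m v) (hw : Reduces (m + 1) (IsSingle (m - 1)) w) (e f : Bool) :
    Reduces (m + 1) (IsTarget m) (u ++ [(m, e)] ++ w ++ [(m, f)] ++ v) := by
  refine (hw.trans (u ++ [(m, e)]) ([(m, f)] ++ v) fun w' hw' => ?_).of_eq (by simp)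
  have hB : ∀ {p}, IsBraidWord (m - 1) p → IsBraidWord m p := fun h => h.mono (Nat.sub_le m 1)
  have hlt : m - 1 < m := by omega
  rcases hw'.cases with h | ⟨hm', p, q, g, hp, hq, rfl⟩
  · exact (Reduces.move_left (far_of_isBraidWord h (k := (m, e)) hlt) u ([(m, f)] ++ v)
      ((reduces_pair hm (by omega) e f (hu.append (hB h)) hv).of_eq (by simp))).of_eq (by simp)
  · refine (Reduces.move_left (far_of_isBraidWord hp (k := (m, e)) hlt) u
      ([(m - 1, g)] ++ q ++ [(m, f)] ++ v)
      (Reduces.of_eq (Reduces.move_right (far_of_isBraidWord hq (k := (m, f)) hlt)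
        (u ++ p ++ [(m, e), (m - 1, g)]) v ((reduces_triple (by omega) (hu.append (hB hp))
        ((hB hq).append hv) e g f).of_eq (by simp))) (by simp))).of_eq (by simp)

/-- The powers of the lowest letter that occur at the ends of the words of `(R₃)`. -/
def lowWords : List BraidWord := [[], [(1, true)], [(1, false)]]

/-- The words of `r3Rest`. -/
def r3RestWords : List BraidWord :=
  r3BraidWords.take 24 ++ (r3BraidWords.drop 25).take 35 ++ r3BraidWords.drop 61

theorem mem_r3RestWords {t : K × BraidWord} (ht : t ∈ r3Rest) : t.2 ∈ r3RestWords := by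
  have h : r3RestWords = r3Rest.map Prod.snd := rfl
  exact h ▸ List.mem_map_of_mem ht

/-- In each remaining word of `(R₃)`, either there is no letter `s_3^{±1}`, or the part in front of
it is a word `p`, or `p s_2^{±1} q`, with `p`, `q` powers of `s_1`; and words that begin with
`s_1⁻¹ s_2 q` end in `s_3⁻¹`. -/
theorem r3RestWords_form : ∀ w ∈ r3RestWords, IsBraidWord 3 w ∨
    (∃ q ∈ lowWords, w = [(1, false), (2, true)] ++ q ++ [(3, false)]) ∨
    ∃ p ∈ lowWords, ∃ f : Bool,
    (w = p ++ [(3, f)] ++ w.drop (p.length + 1) ∧ IsBraidWord 3 (w.drop (p.length + 1))) ∨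
    ∃ q ∈ lowWords, ∃ g : Bool, ¬(p = [(1, false)] ∧ g = true) ∧
      w = p ++ [(2, g)] ++ q ++ [(3, f)] ++ w.drop (p.length + q.length + 2) ∧
      IsBraidWord 3 (w.drop (p.length + q.length + 2)) := by
  decide

theorem isBraidWord_lowWords {p : BraidWord} (hp : p ∈ lowWords) : IsBraidWord 2 p := by
  revert p
  decide

theorem shift_append (i : ℕ) (u v : BraidWord) : shift i (u ++ v) = shift i u ++ shift i v :=
  List.map_append

/-- Words `s_2 p s_2^{±1} q` reduce to words with at most one letter `s_2^{±1}`, except for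
`s_2 s_1⁻¹ s_2 q`. -/
theorem reduces_low {n i : ℕ} (hn : 3 + i ≤ n) {p q : BraidWord} {g : Bool} (hp : p ∈ lowWords)
    (hq : q ∈ lowWords) (h : ¬(p = [(1, false)] ∧ g = true)) :
    Reduces n (IsSingle (2 + i)) (shift i ([(2, true)] ++ p ++ [(2, g)] ++ q)) := by
  have hq' : IsBraidWord (2 + i) (shift i q) := isBraidWord_shift (isBraidWord_lowWords hq)
  have braid : ∀ k (hk : k < rulesBraid.length), rulesBraid[k].1 = 3 →
      (∀ t ∈ rulesBraid[k].2.2, IsSingle 2 t.2) →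
      Reduces n (IsSingle (2 + i)) (shift i rulesBraid[k].2.1 ++ shift i q) :=
    fun k hk h3 h => Reduces.of_ruleBraid [] _ (List.getElem_mem _) (by rw [h3]; omega)
      fun t ht => .base (isSingle_context (isBraidWord_nil _) hq' (isSingle_shift (h t ht)))
  rw [shift_append]
  simp only [lowWords, List.mem_cons, List.not_mem_nil, or_false] at hp
  rcases hp with rfl | rfl | rfl
  · exact Reduces.pair (by omega) (by omega) true g [] (shift i q) (.base hq'.isSingle)
      fun f => .base (isSingle_context (isBraidWord_nil _) hq' (isSingle_letter (by omega) f))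
  · cases g
    · exact (braid 1 (by simp [rulesBraid]) rfl (by simp [rulesBraid]; decide)).of_eq rfl
    · exact (braid 0 (by simp [rulesBraid]) rfl (by simp [rulesBraid]; decide)).of_eq rfl
  · cases g
    · exact (braid 3 (by simp [rulesBraid]) rfl (by simp [rulesBraid]; decide)).of_eq rfl
    · exact absurd ⟨rfl, rfl⟩ h

/-- Two top letters of opposite signs that enclose a hook in lower letters. -/
theorem reduces_mixed {m : ℕ} (hm : 3 ≤ m) {u v : BraidWord} (hu : IsBraidWord m u)
    (hv : IsBraidWord m v) (e : Bool) :
    Reduces (m + 1) (IsTarget m) (u ++ [(m, e)] ++ hook (m - 1) ++ [(m, !e)] ++ v) := by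
  obtain ⟨i, rfl⟩ := Nat.exists_eq_add_of_le hm
  have e1 : 3 + i - 1 = 2 + i := by omega
  have e3 : 2 + i - 1 = 1 + i := by omega
  have hs : ∀ w, IsBraidWord 3 w → IsBraidWord (3 + i) (shift i w) := fun w => isBraidWord_shift
  cases e
  · refine Reduces.of_eq (Reduces.of_ruleFour u v (r := rulesFour[1]) (i := i)
      (List.getElem_mem _) (by change i + 4 ≤ 3 + i + 1; omega) ?_)
      (by simp [rulesFour, shift, hook, e1, e3])
    simp only [rulesFour, List.getElem_cons_succ, List.getElem_cons_zero, List.forall_mem_cons]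
    refine ⟨(reduces_hook (by omega) (hu.append (hs [(2, true), (1, true)] (by decide)))
      ((hs [(1, false), (2, false)] (by decide)).append hv)).of_eq ?_, by simp⟩
    simp [hook, shift, e1]
  · refine Reduces.of_eq (Reduces.of_ruleFour u v (r := rulesFour[0]) (i := i)
      (List.getElem_mem _) (by change i + 4 ≤ 3 + i + 1; omega) ?_)
      (by simp [rulesFour, shift, hook, e1, e3])
    simp only [rulesFour, List.getElem_cons_zero, List.forall_mem_cons]
    refine ⟨(reduces_hook (by omega) (hu.append (hs [(2, false), (1, false)] (by decide)))
      ((hs [(1, true), (2, true)] (by decide)).append hv)).of_eq ?_, by simp⟩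
    simp [hook, shift, e1]

/-- By `(R₁)` for `s_{m-1}`, this word reduces to the one with a hook between the top letters. -/
theorem reduces_mixed_five {m : ℕ} (hm : 3 ≤ m) {u v : BraidWord} (hu : IsBraidWord m u)
    (hv : IsBraidWord m v) : Reduces (m + 1) (IsTarget m)
      (u ++ [(m, true), (m - 1, true), (m - 2, false), (m - 1, true), (m, false)] ++ v) := by
  obtain ⟨i, rfl⟩ := Nat.exists_eq_add_of_le hm
  have mixed : ∀ v, IsBraidWord (3 + i) v → _ := fun v hv => reduces_mixed hm hu hv true
  have sandwich : ∀ w, _ → _ := fun w hw => reduces_sandwich (w := w) (by omega) hu hv (.base hw)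
    true false
  have e1 : 3 + i - 1 = 2 + i := by omega
  have e2 : 3 + i - 2 = 1 + i := by omega
  have e3 : 2 + i - 1 = 1 + i := by omega
  have hx : IsBraidWord (2 + i) [(1 + i, false)] :=
    isBraidWord_shift (m := 2) (i := i) (w := [(1, false)]) (by decide)
  simp only [hook, e1, e2, e3] at mixed sandwich ⊢
  refine Reduces.of_eq (Reduces.of_ruleThree (u ++ [(3 + i, true)]) ([(3 + i, false)] ++ v)
    (r := rulesThree[0]) (i := i) (List.getElem_mem _)
    (by change i + 3 ≤ 3 + i + 1; omega) ?_) (by simp [rulesThree, shift])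
  simp only [rulesThree, List.getElem_cons_zero, List.forall_mem_cons]
  refine ⟨?_, ?_, ?_, by simp⟩
  · exact (sandwich _ (isSingle_shift (m := 2) (i := i)
      (w := [(1, false), (2, true)]) (by decide))).of_eq (by simp)
  · exact (sandwich _ (isSingle_shift (m := 2) (i := i)
      (w := [(1, true), (2, false), (1, false)]) (by decide))).of_eq (by simp)
  · refine Reduces.of_eq (Reduces.move_right (far_of_isBraidWord hx (k := (3 + i, false))
      (by dsimp only; omega))
      (u ++ [(3 + i, true), (2 + i, false), (1 + i, true), (2 + i, false)]) v
      ((mixed ([(1 + i, false)] ++ v) ((hx.mono (by omega)).append hv)).of_eq ?_)) ?_ <;>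
      simp [shift]

/-- The key case: the word `s_m s_{m-1} s_{m-2}⁻¹ s_{m-1} s_m`, the only one in which `(R₃)` has to
be solved for a coefficient that is not a scalar. -/
theorem reduces_five {m : ℕ} (hm : 3 ≤ m) {u v : BraidWord} (hu : IsBraidWord m u)
    (hv : IsBraidWord m v) : Reduces (m + 1) (IsTarget m)
      (u ++ [(m, true), (m - 1, true), (m - 2, false), (m - 1, true), (m, true)] ++ v) := by
  obtain ⟨i, rfl⟩ := Nat.exists_eq_add_of_le hm
  have e : 3 + i - 1 = 2 + i := by omega
  have e' : 3 + i - 2 = 1 + i := by omega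
  rw [e, e']
  refine (Reduces.of_ruleFour u v (r := rulesFour[5]) (i := i) (List.getElem_mem _)
    (by change i + 4 ≤ 3 + i + 1; omega) ?_).of_eq (by simp [rulesFour, shift])
  simp only [rulesFour, List.getElem_cons_succ, List.getElem_cons_zero, List.forall_mem_flatMap,
    List.forall_mem_cons, List.forall_mem_map]
  have hr : ∀ r ∈ inverseTerms, IsBraidWord 2 r.2 := by
    simp only [inverseTerms, List.forall_mem_cons]
    refine ⟨?_, ?_, ?_, by simp⟩ <;> decide
  refine ⟨fun r h => ?_, fun r h => ?_, fun t ht r h => ?_⟩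
  all_goals
    have hv' : IsBraidWord (3 + i) (shift i r.2 ++ v) :=
      ((isBraidWord_shift (hr r h)).mono (by omega)).append hv
  · refine Reduces.of_eq (Reduces.of_ruleFour u (shift i r.2 ++ v) (r := rulesFour[2]) (i := i)
      (List.getElem_mem _) (by change i + 4 ≤ 3 + i + 1; omega) ?_) (by simp [rulesFour, shift])
    simp only [rulesFour, List.getElem_cons_succ, List.getElem_cons_zero, List.forall_mem_cons]
    exact ⟨reduces_of_isSingle hu hv' (isSingle_shift (m := 3) (by decide)), by simp⟩
  · have h1 : IsBraidWord (3 + i) [(2 + i, false)] :=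
      isBraidWord_shift (m := 3) (i := i) (w := [(2, false)]) (by decide)
    have h2 : IsBraidWord (3 + i) [(1 + i, true)] :=
      isBraidWord_shift (m := 3) (i := i) (w := [(1, true)]) (by decide)
    have h3 : Reduces (3 + i + 1) (IsSingle (3 + i - 1)) [(2 + i, true), (2 + i, true)] := by
      rw [e]
      exact Reduces.pair (by omega) (by omega) true true [] []
        (.base (isBraidWord_nil _).isSingle) fun f => .base (isSingle_letter (by omega) f)
    refine Reduces.of_eq (Reduces.of_ruleBraid u ([(2 + i, true), (3 + i, false), (1 + i, true)] ++
      (shift i r.2 ++ v)) (r := rulesBraid[1]) (i := 1 + i)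
      (List.getElem_mem _) (by change 1 + i + 3 ≤ 3 + i + 1; omega) ?_)
      (by simp [rulesBraid, shift, ← add_assoc])
    simp only [rulesBraid, List.getElem_cons_succ, List.getElem_cons_zero, List.forall_mem_cons]
    exact ⟨(reduces_sandwich (by omega) (hu.append h1) (h2.append hv') h3 true false).of_eq
      (by simp [shift, ← add_assoc]), by simp⟩
  · rcases r3RestWords_form _ (mem_r3RestWords ht) with hw | ⟨q, hq, hw⟩ |
      ⟨p, hp, f, ⟨hw, hd⟩ | ⟨q, hq, g, hpg, hw, hd⟩⟩
    · have h1 : IsBraidWord (3 + i) (shift i ([(2, true)] ++ t.2)) :=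
        isBraidWord_shift (IsBraidWord.append (by decide) hw)
      exact (reduces_of_isSingle hu (h1.append hv') (isSingle_letter (by omega) true)).of_eq
        (by simp [shift])
    · rw [hw]
      have h1 : IsBraidWord (2 + i) (shift i q) := isBraidWord_shift (isBraidWord_lowWords hq)
      refine Reduces.of_eq (Reduces.move_right (far_of_isBraidWord h1 (k := (3 + i, false))
        (by dsimp only; omega)) (u ++ [(3 + i, true), (2 + i, true), (1 + i, false), (2 + i, true)])
        (shift i r.2 ++ v) (Reduces.of_eq (reduces_mixed_five hm hu
          (v := shift i q ++ (shift i r.2 ++ v)) ((h1.mono (by omega)).append hv')) ?_)) ?_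
      · simp [e, e']
      · simp [shift]
    · generalize t.2.drop (p.length + 1) = d at hw hd
      rw [hw]
      have h1 : IsSingle (3 + i - 1) (shift i ([(2, true)] ++ p)) := by
        rw [e]
        have h0 : ∀ p ∈ lowWords, IsSingle 2 ([(2, true)] ++ p) := by decide
        exact isSingle_shift (h0 p hp)
      exact (reduces_sandwich (by omega) hu ((isBraidWord_shift hd).append hv') (.base h1)
        true f).of_eq (by simp [shift])
    · generalize t.2.drop (p.length + q.length + 2) = d at hw hd
      rw [hw]
      have h1 := reduces_low (n := 3 + i + 1) (i := i) (by omega) hp hq hpg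
      rw [← e] at h1
      exact (reduces_sandwich (by omega) hu ((isBraidWord_shift hd).append hv') h1
        true f).of_eq (by simp [shift])

/-- Two top letters, the second one positive, that enclose a hook in lower letters. -/
theorem reduces_hook_sandwich {m : ℕ} (hm : 3 ≤ m) {u v : BraidWord} (hu : IsBraidWord m u)
    (hv : IsBraidWord m v) (e : Bool) :
    Reduces (m + 1) (IsTarget m) (u ++ [(m, e)] ++ hook (m - 1) ++ [(m, true)] ++ v) := by
  cases e
  · exact reduces_mixed hm hu hv false
  obtain ⟨i, rfl⟩ := Nat.exists_eq_add_of_le hm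
  have five : ∀ v, IsBraidWord (3 + i) v → _ := fun v hv => reduces_five hm hu hv
  have sandwich : ∀ w, _ → _ := fun w hw => reduces_sandwich (w := w) (by omega) hu hv (.base hw)
    true true
  have e1 : 3 + i - 1 = 2 + i := by omega
  have e2 : 3 + i - 2 = 1 + i := by omega
  have e3 : 2 + i - 1 = 1 + i := by omega
  have hx : IsBraidWord (2 + i) [(1 + i, true)] :=
    isBraidWord_shift (m := 2) (i := i) (w := [(1, true)]) (by decide)
  simp only [hook, e1, e2, e3] at five sandwich ⊢
  refine Reduces.of_eq (Reduces.of_ruleThree (u ++ [(3 + i, true)]) ([(3 + i, true)] ++ v)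
    (r := rulesThree[1]) (i := i) (List.getElem_mem _)
    (by change i + 3 ≤ 3 + i + 1; omega) ?_) (by simp [rulesThree, shift])
  simp only [rulesThree, List.getElem_cons_succ, List.getElem_cons_zero, List.forall_mem_cons]
  refine ⟨?_, ?_, ?_, by simp⟩
  · refine Reduces.of_eq (Reduces.move_right (far_of_isBraidWord hx (k := (3 + i, true))
      (by dsimp only; omega))
      (u ++ [(3 + i, true), (2 + i, true), (1 + i, false), (2 + i, true)]) v
      ((five ([(1 + i, true)] ++ v) ((hx.mono (by omega)).append hv)).of_eq ?_)) ?_ <;>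
      simp [shift]
  · exact (sandwich _ (isSingle_shift (m := 2) (i := i)
      (w := [(1, false), (2, true), (1, true)]) (by decide))).of_eq (by simp)
  · exact (sandwich _ (isSingle_shift (m := 2) (i := i)
      (w := [(1, true), (2, false)]) (by decide))).of_eq (by simp)

/-! ### Every word reduces -/

/-- Right multiplication by a positive letter, provided that words in lower letters reduce. -/
theorem reduces_target_mul_letter {m : ℕ}
    (ih : ∀ w, IsBraidWord m w → Reduces m (IsTarget (m - 1)) w) {w : BraidWord}
    (hw : IsTarget m w) {j : ℕ} (hj : 1 ≤ j) (hjm : j ≤ m) :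
    Reduces (m + 1) (IsTarget m) (w ++ [(j, true)]) := by
  have hjB : j ≠ m → IsBraidWord m [(j, true)] := fun h => by
    simp [isBraidWord_cons, isBraidWord_nil]; omega
  have hm : 1 ≤ m := hj.trans hjm
  have hnil := isBraidWord_nil m
  rcases hw with hw | ⟨hm2, u, hu, rfl⟩
  · by_cases hjm' : j = m
    · subst hjm'
      rcases hw.cases with hw | ⟨-, u, v, e, hu, hv, rfl⟩
      · exact (reduces_of_isSingle hw hnil (isSingle_letter hm true)).of_eq (by simp)
      · refine (((ih v hv).mono (Nat.le_succ _)).trans (u ++ [(j, e)]) [(j, true)]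
          fun v' hv' => ?_).of_eq (by simp)
        rcases hv' with hv' | ⟨h2, p, hp, rfl⟩
        · exact (reduces_sandwich hm hu hnil (.base hv') e true).of_eq (by simp)
        · have hp' : IsBraidWord (j - 1) p := hp.mono (Nat.sub_le _ 1)
          refine (Reduces.move_left (far_of_isBraidWord hp' (k := (j, e)) (by dsimp only; omega)) u
            (hook (j - 1) ++ [(j, true)]) ((reduces_hook_sandwich (by omega)
              (hu.append (hp'.mono (Nat.sub_le _ 1))) hnil e).of_eq (by simp))).of_eq ?_
          simp [hook]
    · exact (reduces_of_isSingle hnil (hjB hjm') hw).of_eq (by simp)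
  · have hu' : IsBraidWord m u := hu.mono (Nat.sub_le m 1)
    by_cases hjm' : j = m
    · subst hjm'
      have h1 : IsBraidWord j [(j - 1, true)] := by
        simp [isBraidWord_cons, isBraidWord_nil]; omega
      refine (Reduces.cancel hj (Nat.lt_succ_self j) false (u ++ [(j, false), (j - 1, true)]) []
        ((reduces_of_isSingle hu' h1 (isSingle_letter hm false)).of_eq ?_)).of_eq ?_ <;> simp
    · exact reduces_hook hm2 hu' (hjB hjm')

/-- Every word in the letters of `B_{m+1}` reduces to words of the desired form. -/
theorem reduces_target (m : ℕ) : ∀ w, IsBraidWord (m + 1) w → Reduces (m + 1) (IsTarget m) w := by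
  induction m with
  | zero =>
    intro w hw
    obtain rfl : w = [] := List.eq_nil_iff_forall_not_mem.2 fun l hl => by
      have := hw l hl
      omega
    exact .base (Or.inl (isBraidWord_nil 0).isSingle)
  | succ m ih =>
    intro w hw
    suffices H : ∀ w : BraidWord, IsBraidWord (m + 2) w → (∀ l ∈ w, l.2 = true) →
        Reduces (m + 2) (IsTarget (m + 1)) w from
      ((reduces_positive le_rfl hw).trans [] [] fun w' hw' =>
        (H w' hw'.1 hw'.2).of_eq (by simp)).of_eq (by simp)
    intro w
    induction w using List.reverseRecOn with
    | nil => exact fun _ _ => .base (Or.inl (isBraidWord_nil _).isSingle)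
    | append_singleton w l ihw =>
      intro hw hpos
      obtain ⟨j, e⟩ := l
      obtain rfl : e = true := hpos (j, e) (by simp)
      rw [isBraidWord_append, isBraidWord_cons] at hw
      exact ((ihw hw.1 fun l hl => hpos l (by simp [hl])).trans [] [(j, true)] fun w' hw' =>
        (reduces_target_mul_letter ih hw' hw.2.1.1 (Nat.lt_succ_iff.1 hw.2.1.2)).of_eq
          (by simp)).of_eq (by simp)

/-! ### Coded coefficients -/

section IntegerArithmetic

open Primrec Encodable

theorem encode_natCast (n : ℕ) : encode (n : ℤ) = 2 * n := rfl

theorem encode_negSucc (n : ℕ) : encode (Int.negSucc n) = 2 * n + 1 := rfl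

theorem primrec_natAbs : Primrec Int.natAbs :=
  (nat_div.comp (succ.comp Primrec.encode) (const 2)).of_eq fun z => by
    rcases z with n | n
    · have := encode_natCast n
      simp only [Int.ofNat_eq_natCast, Int.natAbs_natCast]
      omega
    · have := encode_negSucc n
      simp only [Int.natAbs_negSucc]
      omega

theorem primrec_natCast : Primrec fun n : ℕ => (n : ℤ) :=
  encode_iff.1 ((nat_mul.comp (const 2) .id).of_eq fun n => (encode_natCast n).symm)

theorem primrec_neg_natCast : Primrec fun n : ℕ => -(n : ℤ) :=
  encode_iff.1 ((pred.comp (nat_mul.comp (const 2) .id)).of_eq fun n => by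
    rcases n with _ | n
    · rfl
    · exact (encode_negSucc n).symm)

theorem encode_mod_two (z : ℤ) : encode z % 2 = if z < 0 then 1 else 0 := by
  rcases z with n | n
  · have := encode_natCast n
    rw [if_neg (by simp), Int.ofNat_eq_natCast]
    omega
  · have := encode_negSucc n
    rw [if_pos (Int.negSucc_lt_zero n)]
    omega

/-- Mathlib has no primitive recursive arithmetic on `ℤ`: the product is computed from the absolute
values, and its sign from the parities of the codes. -/
theorem primrec_int_mul : Primrec₂ fun a b : ℤ => a * b := by
  have hm : Primrec₂ fun a b : ℤ => a.natAbs * b.natAbs :=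
    (nat_mul.comp (primrec_natAbs.comp fst) (primrec_natAbs.comp snd)).to₂
  refine (Primrec.ite (PrimrecRel.comp (R := fun m n : ℕ => m = n) Primrec.eq
    (nat_mod.comp (Primrec.encode.comp fst) (const 2))
    (nat_mod.comp (Primrec.encode.comp snd) (const 2)))
    (primrec_natCast.comp hm) (primrec_neg_natCast.comp hm)).of_eq fun ⟨a, b⟩ => ?_
  dsimp only
  rw [encode_mod_two, encode_mod_two]
  push_cast
  rcases lt_or_ge a 0 with ha | ha <;> rcases lt_or_ge b 0 with hb | hb
  · simp [ha, hb, abs_of_neg]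
  · simp [ha, hb.not_gt, abs_of_neg, abs_of_nonneg hb]
  · simp [ha.not_gt, hb, abs_of_neg, abs_of_nonneg ha]
  · simp [ha.not_gt, hb.not_gt, abs_of_nonneg ha, abs_of_nonneg hb]

end IntegerArithmetic

/-- The product of coded polynomials. -/
def polyMul (p q : PolyCode) : PolyCode :=
  p.flatMap fun a => q.map fun b => (a.1 * b.1, a.2.1 + b.2.1, a.2.2 + b.2.2)

theorem polyVal_nil : polyVal [] = 0 := rfl

theorem polyVal_cons (a : ℤ × ℕ × ℕ) (p : PolyCode) :
    polyVal (a :: p) = (a.1 : K) * t₀ ^ a.2.1 * t₁ ^ a.2.2 + polyVal p := by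
  rw [polyVal, List.map_cons, List.sum_cons, polyVal]

theorem polyVal_append (p q : PolyCode) : polyVal (p ++ q) = polyVal p + polyVal q := by
  rw [polyVal, List.map_append, List.sum_append, polyVal, polyVal]

theorem polyVal_polyMul (p q : PolyCode) : polyVal (polyMul p q) = polyVal p * polyVal q := by
  have h (a : ℤ × ℕ × ℕ) :
      polyVal (q.map fun b => (a.1 * b.1, a.2.1 + b.2.1, a.2.2 + b.2.2)) =
        (a.1 : K) * t₀ ^ a.2.1 * t₁ ^ a.2.2 * polyVal q := by
    induction q with
    | nil => rw [List.map_nil, polyVal_nil, mul_zero]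
    | cons b q ih =>
      rw [List.map_cons, polyVal_cons, polyVal_cons, ih]
      push_cast
      ring
  induction p with
  | nil => rw [polyVal_nil, zero_mul]; rfl
  | cons a p ih =>
    rw [polyMul, List.flatMap_cons, polyVal_append, h, polyVal_cons, add_mul, ← ih]
    rfl

theorem polyVal_singleton (a : ℤ) (i j : ℕ) :
    polyVal [(a, i, j)] = (a : K) * t₀ ^ i * t₁ ^ j := by
  rw [polyVal_cons, polyVal_nil, add_zero]

theorem polyVal_one : polyVal [(1, 0, 0)] = 1 := by
  rw [polyVal_singleton]
  simp

/-- Every element of `ℚ(t₀, t₁)` is a quotient of coded polynomials. -/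
theorem exists_code (x : K) :
    ∃ c : PolyCode × PolyCode, polyVal c.2 ≠ 0 ∧ polyVal c.1 / polyVal c.2 = x := by
  have key (f : MvPolynomial (Fin 2) ℚ) : ∃ c : PolyCode × PolyCode, polyVal c.2 ≠ 0 ∧
      polyVal c.1 / polyVal c.2 = algebraMap (MvPolynomial (Fin 2) ℚ) K f := by
    induction f using MvPolynomial.induction_on with
    | C r =>
      have hd : (r.den : K) ≠ 0 := Nat.cast_ne_zero.2 r.den_nz
      refine ⟨([(r.num, 0, 0)], [(r.den, 0, 0)]), ?_, ?_⟩
      · rw [polyVal_singleton]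
        simp
      · have h1 : (algebraMap (MvPolynomial (Fin 2) ℚ) K) (MvPolynomial.C r) = (r : K) :=
          map_ratCast ((algebraMap (MvPolynomial (Fin 2) ℚ) K).comp MvPolynomial.C) r
        rw [h1, polyVal_singleton, polyVal_singleton, Rat.cast_def]
        simp
    | add f g hf hg =>
      obtain ⟨c, hc, hc'⟩ := hf
      obtain ⟨d, hd, hd'⟩ := hg
      refine ⟨(polyMul c.1 d.2 ++ polyMul c.2 d.1, polyMul c.2 d.2), ?_, ?_⟩
      · rw [polyVal_polyMul]
        exact mul_ne_zero hc hd
      · rw [map_add, ← hc', ← hd', polyVal_append, polyVal_polyMul, polyVal_polyMul,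
          polyVal_polyMul, div_add_div _ _ hc hd]
    | mul_X f i hf =>
      obtain ⟨c, hc, hc'⟩ := hf
      have hX : ∃ d : PolyCode,
          polyVal d = algebraMap (MvPolynomial (Fin 2) ℚ) K (MvPolynomial.X i) := by
        fin_cases i
        · exact ⟨[(1, 1, 0)], by rw [polyVal_singleton]; simp [t₀]⟩
        · exact ⟨[(1, 0, 1)], by rw [polyVal_singleton]; simp [t₁]⟩
      obtain ⟨d, hd⟩ := hX
      refine ⟨(polyMul c.1 d, c.2), hc, ?_⟩
      rw [map_mul, ← hc', ← hd, polyVal_polyMul, div_mul_eq_mul_div]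
  obtain ⟨f, g, hg, rfl⟩ := IsFractionRing.div_surjective (A := MvPolynomial (Fin 2) ℚ) x
  obtain ⟨c, hc, hc'⟩ := key f
  obtain ⟨d, hd, hd'⟩ := key g
  have hg' : algebraMap (MvPolynomial (Fin 2) ℚ) K g ≠ 0 :=
    IsFractionRing.to_map_ne_zero_of_mem_nonZeroDivisors hg
  have hd1 : polyVal d.1 ≠ 0 := fun h => hg' (by rw [← hd', h, zero_div])
  refine ⟨(polyMul c.1 d.2, polyMul c.2 d.1), ?_, ?_⟩
  · rw [polyVal_polyMul]
    exact mul_ne_zero hc hd1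
  · rw [polyVal_polyMul, polyVal_polyMul, ← hc', ← hd', div_div_div_eq]

/-- Numerator and denominator of an element of `ℚ(t₀, t₁)`. -/
def code (x : K) : PolyCode × PolyCode := (exists_code x).choose

theorem code_ne_zero (x : K) : polyVal (code x).2 ≠ 0 := (exists_code x).choose_spec.1

theorem code_val (x : K) : polyVal (code x).1 / polyVal (code x).2 = x :=
  (exists_code x).choose_spec.2

/-! ### Rewriting commands -/

/-- The rewriting rules with coded coefficients. -/
def codedRules : List (ℕ × BraidWord × Combination) :=
  rules.map fun r => (r.1, r.2.1, r.2.2.map fun t => (code t.1, t.2))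

/-- A rewriting command consists of a rule `r`, a shift `i`, words `u`, `v` and letters `k`, `l`. It
tells to apply the `i`-th shift of `r` between `u` and `v`, or else to interchange `k` and `l`
there. -/
abbrev Command : Type :=
  (ℕ × BraidWord × Combination) × ℕ × BraidWord × BraidWord × (ℕ × Bool) × (ℕ × Bool)

/-- The command `c` applies a rule to the word `w`. -/
def Command.IsRule (n : ℕ) (c : Command) (w : BraidWord) : Prop :=
  c.1 ∈ codedRules ∧ c.2.1 + c.1.1 ≤ n ∧ w = c.2.2.1 ++ shift c.2.1 c.1.2.1 ++ c.2.2.2.1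

/-- The command `c` interchanges two adjacent letters of the word `w` that commute. -/
def Command.IsComm (c : Command) (w : BraidWord) : Prop :=
  (c.2.2.2.2.1.1 + 1 < c.2.2.2.2.2.1 ∨ c.2.2.2.2.2.1 + 1 < c.2.2.2.2.1.1) ∧
    w = c.2.2.1 ++ [c.2.2.2.2.1, c.2.2.2.2.2] ++ c.2.2.2.1

/-- The terms that replace the term `t` when the rule of the command `c` is applied. -/
def Command.replace (c : Command) (t : (PolyCode × PolyCode) × BraidWord) : Combination :=
  c.1.2.2.map fun q => ((polyMul t.1.1 q.1.1, polyMul t.1.2 q.1.2),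
    c.2.2.1 ++ shift c.2.1 q.2 ++ c.2.2.2.1)

/-- The term that replaces the term `t` when the command `c` interchanges two letters. -/
def Command.swap (c : Command) (t : (PolyCode × PolyCode) × BraidWord) :
    (PolyCode × PolyCode) × BraidWord :=
  (t.1, c.2.2.1 ++ [c.2.2.2.2.2, c.2.2.2.2.1] ++ c.2.2.2.1)

open Classical in
/-- A command acts on the first term of a combination; if it does not fit there, the first term
moves to the end. -/
def step (n : ℕ) : Combination → Command → Combination
  | [], _ => []
  | t :: d, c =>
    if c.IsRule n t.2 then c.replace t ++ d else if c.IsComm t.2 then c.swap t :: d else d ++ [t]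

/-- No coefficient of the combination `d` has denominator zero. -/
def Valid (d : Combination) : Prop := ∀ t ∈ d, polyVal t.1.2 ≠ 0

theorem combVal_nil (n : ℕ) : combVal n [] = 0 := rfl

theorem combVal_cons (n : ℕ) (t : (PolyCode × PolyCode) × BraidWord) (d : Combination) :
    combVal n (t :: d) =
      (polyVal t.1.1 / polyVal t.1.2) • braidClass n (evalWord n t.2) + combVal n d := by
  rw [combVal, List.map_cons, List.sum_cons, combVal]

theorem combVal_append (n : ℕ) (c d : Combination) :
    combVal n (c ++ d) = combVal n c + combVal n d := by
  rw [combVal, List.map_append, List.sum_append, combVal, combVal]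

theorem combVal_eq_linVal (n : ℕ) (d : Combination) :
    combVal n d = linVal n (d.map fun t => (polyVal t.1.1 / polyVal t.1.2, t.2)) := by
  rw [combVal, linVal, List.map_map]
  rfl

theorem combVal_replace {n : ℕ} {c : Command} {t : (PolyCode × PolyCode) × BraidWord}
    (h : c.IsRule n t.2) :
    combVal n (c.replace t) =
      (polyVal t.1.1 / polyVal t.1.2) • braidClass n (evalWord n t.2) := by
  obtain ⟨r', i, u, v, k⟩ := c
  obtain ⟨a, w⟩ := t
  obtain ⟨hr, hi, hw⟩ := h
  dsimp only at hr hi hw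
  obtain ⟨r, hr₀, rfl⟩ := List.mem_map.1 hr
  have hh : r.Holds n i := holds_of_mem_rules hr₀ hi
  rw [Rule.Holds] at hh
  dsimp only
  rw [hw, evalWord_append, evalWord_append, braidClass_mul, braidClass_mul, hh, ← linVal_context,
    combVal_eq_linVal]
  congr 1
  simp only [Command.replace, shiftTerms, List.map_map]
  refine List.map_congr_left fun q _ => ?_
  simp only [Function.comp_apply, polyVal_polyMul, mul_div_mul_comm, code_val]

theorem combVal_step (n : ℕ) (d : Combination) (c : Command) :
    combVal n (step n d c) = combVal n d := by
  rcases d with _ | ⟨t, d⟩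
  · rfl
  rw [step]
  split_ifs with h1 h2
  · rw [combVal_append, combVal_replace h1, combVal_cons]
  · rw [combVal_cons, combVal_cons, Command.swap]
    congr 3
    dsimp only
    rw [h2.2, evalWord_append, evalWord_append, evalWord_append, evalWord_append,
      evalWord_comm n h2.1]
  · rw [combVal_append, combVal_cons, combVal_cons, combVal_nil, add_zero, add_comm]

theorem mem_codedRules {r : Rule} (hr : r ∈ rules) :
    (r.1, r.2.1, r.2.2.map fun t => (code t.1, t.2)) ∈ codedRules :=
  List.mem_map.2 ⟨r, hr, rfl⟩

theorem Valid.step {n : ℕ} {d : Combination} (hd : Valid d) (c : Command) :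
    Valid (step n d c) := by
  rcases d with _ | ⟨t, d⟩
  · exact hd
  rw [LinksGould.step]
  have ht : polyVal t.1.2 ≠ 0 := hd t List.mem_cons_self
  have hd' : Valid d := fun t' h => hd t' (List.mem_cons_of_mem _ h)
  split_ifs with h1 h2
  · intro t' h
    rcases List.mem_append.1 h with h | h
    · obtain ⟨q, hq, rfl⟩ := List.mem_map.1 h
      obtain ⟨r, hr, hr'⟩ := List.mem_map.1 h1.1
      rw [← hr'] at hq
      obtain ⟨q', -, rfl⟩ := List.mem_map.1 hq
      dsimp only
      rw [polyVal_polyMul]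
      exact mul_ne_zero ht (code_ne_zero _)
    · exact hd' t' h
  · intro t' h
    rcases List.mem_cons.1 h with rfl | h
    · exact ht
    · exact hd' t' h
  · intro t' h
    rcases List.mem_append.1 h with h | h
    · exact hd' t' h
    · rwa [List.mem_singleton.1 h]

/-- The combination that a list of commands produces from `d`. -/
def run (n : ℕ) (d : Combination) (cs : List Command) : Combination :=
  cs.foldl (step n) d

theorem run_append (n : ℕ) (d : Combination) (cs cs' : List Command) :
    run n d (cs ++ cs') = run n (run n d cs) cs' := List.foldl_append

theorem combVal_run (n : ℕ) (d : Combination) (cs : List Command) :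
    combVal n (run n d cs) = combVal n d := by
  induction cs generalizing d with
  | nil => rfl
  | cons c cs ih => exact (ih _).trans (combVal_step n d c)

theorem Valid.run {n : ℕ} {d : Combination} (hd : Valid d) (cs : List Command) :
    Valid (run n d cs) := by
  induction cs generalizing d with
  | nil => exact hd
  | cons c cs ih => exact ih (hd.step c)

/-- Some command fits nowhere, because its shift is too large and its letters are equal: it always
moves the first term to the end. -/
theorem exists_rotate (n : ℕ) :
    ∃ c : Command, ∀ t d, step n (t :: d) c = d ++ [t] := by
  refine ⟨((0, [], []), n + 1, [], [], (0, true), (0, true)), fun t d => ?_⟩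
  rw [step, if_neg, if_neg]
  · rintro ⟨h, -⟩
    simp at h
  · rintro ⟨-, h, -⟩
    simp at h

/-- If each term of `e` can be driven to the end of any combination, in the form of terms with words
in `T`, then so can all of `e`. -/
theorem exists_run_list {n : ℕ} {T : BraidWord → Prop} (e : Combination)
    (he : ∀ t ∈ e, ∀ d, ∃ cs d', (∀ t' ∈ d', T t'.2) ∧ run n (t :: d) cs = d ++ d')
    (d : Combination) : ∃ cs d', (∀ t' ∈ d', T t'.2) ∧ run n (e ++ d) cs = d ++ d' := by
  induction e generalizing d with
  | nil => exact ⟨[], [], by simp, by simp [run]⟩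
  | cons t e ih =>
    obtain ⟨cs, d₁, h₁, h₁'⟩ := he t List.mem_cons_self (e ++ d)
    obtain ⟨cs', d₂, h₂, h₂'⟩ := ih (fun t' ht' => he t' (List.mem_cons_of_mem _ ht')) (d ++ d₁)
    refine ⟨cs ++ cs', d₁ ++ d₂, ?_, ?_⟩
    · intro t' ht'
      rcases List.mem_append.1 ht' with h | h
      · exact h₁ _ h
      · exact h₂ _ h
    · rw [run_append, List.cons_append, h₁', List.append_assoc, h₂', List.append_assoc]

/-- Every reduction can be carried out by commands. -/
theorem exists_run {n : ℕ} {T : BraidWord → Prop} {w : BraidWord} (h : Reduces n T w)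
    (a : PolyCode × PolyCode) (d : Combination) :
    ∃ cs d', (∀ t ∈ d', T t.2) ∧ run n ((a, w) :: d) cs = d ++ d' := by
  induction h generalizing a d with
  | base hw =>
    obtain ⟨c, hc⟩ := exists_rotate n
    exact ⟨[c], [(a, _)], by simpa using hw, hc _ _⟩
  | @rule r i u v hr hi _ ih =>
    let c : Command := ((r.1, r.2.1, r.2.2.map fun t => (code t.1, t.2)), i, u, v,
      (0, true), (0, true))
    have hc : step n ((a, u ++ shift i r.2.1 ++ v) :: d) c =
        c.replace (a, u ++ shift i r.2.1 ++ v) ++ d := by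
      rw [step, if_pos ⟨mem_codedRules hr, hi, rfl⟩]
    obtain ⟨cs, d', hd', h⟩ := exists_run_list (n := n) (T := T)
      (c.replace (a, u ++ shift i r.2.1 ++ v)) (by
        intro t ht d
        obtain ⟨q, hq, rfl⟩ := List.mem_map.1 ht
        obtain ⟨q', hq', rfl⟩ := List.mem_map.1 hq
        exact ih q' hq' _ d) d
    exact ⟨c :: cs, d', hd', by rw [run, List.foldl_cons, hc]; exact h⟩
  | @comm k l u v hkl _ ih =>
    obtain ⟨cs, d', hd', h⟩ := ih a d
    -- The shift `n + 1` prevents the command from being read as the application of a rule.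
    let c : Command := ((0, [], []), n + 1, u, v, k, l)
    have hc : step n ((a, u ++ [k, l] ++ v) :: d) c = (a, u ++ [l, k] ++ v) :: d := by
      rw [step, if_neg, if_pos ⟨hkl, rfl⟩]
      · rfl
      · rintro ⟨-, h, -⟩
        simp [c] at h
    exact ⟨c :: cs, d', hd', by rw [run, List.foldl_cons, hc]; exact h⟩

/-! ### Computability of the reduction -/

section Primrec

open Primrec

theorem primrec_shift : Primrec₂ shift := by
  have h : Primrec₂ fun (p : ℕ × BraidWord) (l : ℕ × Bool) => (l.1 + p.1, l.2) :=
    Primrec.pair (nat_add.comp (fst.comp snd) (fst.comp fst)) (snd.comp snd)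
  exact list_map snd h

theorem primrec_polyMul : Primrec₂ polyMul := by
  have h : Primrec₂ fun (p : (PolyCode × PolyCode) × ℤ × ℕ × ℕ) (b : ℤ × ℕ × ℕ) =>
      (p.2.1 * b.1, p.2.2.1 + b.2.1, p.2.2.2 + b.2.2) :=
    Primrec.pair (primrec_int_mul.comp (fst.comp (snd.comp fst)) (fst.comp snd))
      (.pair (nat_add.comp (fst.comp (snd.comp (snd.comp fst))) (fst.comp (snd.comp snd)))
        (nat_add.comp (snd.comp (snd.comp (snd.comp fst))) (snd.comp (snd.comp snd))))
  have h' : Primrec₂ fun (p : PolyCode × PolyCode) (a : ℤ × ℕ × ℕ) =>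
      p.2.map fun b => (a.1 * b.1, a.2.1 + b.2.1, a.2.2 + b.2.2) := list_map (snd.comp fst) h
  exact list_flatMap fst h'

theorem primrecRel_isBraidWord : PrimrecRel fun (w : BraidWord) (n : ℕ) => IsBraidWord n w := by
  have h : PrimrecRel fun (l : ℕ × Bool) (n : ℕ) => 1 ≤ l.1 ∧ l.1 < n :=
    (nat_le.comp (const 1) (fst.comp fst)).and (nat_lt.comp (fst.comp fst) snd)
  exact h.forall_mem_list

theorem primrecRel_isSingle : PrimrecRel fun (w : BraidWord) (m : ℕ) => IsSingle m w := by
  have h : PrimrecRel fun (l : ℕ × Bool) (m : ℕ) => l.1 = m :=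
    PrimrecRel.comp (R := fun a b : ℕ => a = b) Primrec.eq (fst.comp fst) snd
  refine ((primrecRel_isBraidWord.comp fst (succ.comp snd)).and
    (nat_le.comp (list_length.comp h.listFilter) (const 1))).of_eq fun p => ?_
  simp only [IsSingle, List.countP_eq_length_filter, Nat.succ_eq_add_one, beq_eq_decide]

theorem isTarget_iff (m : ℕ) (w : BraidWord) : IsTarget m w ↔ IsSingle m w ∨ (2 ≤ m ∧
    IsBraidWord (m - 1) (w.take (w.length - 3)) ∧ w = w.take (w.length - 3) ++ hook m) := by
  refine or_congr_right (and_congr_right fun _ => ⟨?_, fun h => ⟨_, h.1, h.2⟩⟩)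
  rintro ⟨u, hu, rfl⟩
  simp [hu, hook]

theorem primrec_hook : Primrec hook := by
  have h1 : Primrec fun m : ℕ => (m, false) := .pair .id (const false)
  have h2 : Primrec fun m : ℕ => (m - 1, true) := .pair pred (const true)
  exact list_cons.comp h1 (list_cons.comp h2 (list_cons.comp h1 (const [])))

theorem primrecRel_isTarget : PrimrecRel fun (w : BraidWord) (m : ℕ) => IsTarget m w := by
  have h : Primrec fun p : BraidWord × ℕ => p.1.take (p.1.length - 3) :=
    list_take.comp (nat_sub.comp (list_length.comp fst) (const 3)) fst
  exact (primrecRel_isSingle.or ((nat_le.comp (const 2) snd).and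
    ((primrecRel_isBraidWord.comp h (pred.comp snd)).and
      (PrimrecRel.comp (R := fun u v : BraidWord => u = v) Primrec.eq fst
        (list_append.comp h (primrec_hook.comp snd)))))).of_eq fun p => (isTarget_iff _ _).symm

theorem primrec_replace : Primrec₂ Command.replace := by
  have hu : Primrec fun c : Command => c.2.2.1 := fst.comp (snd.comp snd)
  have hv : Primrec fun c : Command => c.2.2.2.1 := fst.comp (snd.comp (snd.comp snd))
  have h : Primrec₂ fun (p : Command × (PolyCode × PolyCode) × BraidWord)
      (q : (PolyCode × PolyCode) × BraidWord) =>
      ((polyMul p.2.1.1 q.1.1, polyMul p.2.1.2 q.1.2),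
        p.1.2.2.1 ++ shift p.1.2.1 q.2 ++ p.1.2.2.2.1) :=
    Primrec.pair (.pair
      (primrec_polyMul.comp (fst.comp (fst.comp (snd.comp fst))) (fst.comp (fst.comp snd)))
      (primrec_polyMul.comp (snd.comp (fst.comp (snd.comp fst))) (snd.comp (fst.comp snd))))
      (list_append.comp (list_append.comp (hu.comp (fst.comp fst))
        (primrec_shift.comp (fst.comp (snd.comp (fst.comp fst))) (snd.comp snd)))
        (hv.comp (fst.comp fst)))
  exact list_map (snd.comp (snd.comp (fst.comp fst))) h

theorem primrec_swap : Primrec₂ Command.swap := by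
  have hu : Primrec fun c : Command => c.2.2.1 := fst.comp (snd.comp snd)
  have hv : Primrec fun c : Command => c.2.2.2.1 := fst.comp (snd.comp (snd.comp snd))
  have hk : Primrec fun c : Command => c.2.2.2.2.1 := fst.comp (snd.comp (snd.comp (snd.comp snd)))
  have hl : Primrec fun c : Command => c.2.2.2.2.2 := snd.comp (snd.comp (snd.comp (snd.comp snd)))
  exact Primrec.pair (fst.comp snd) (list_append.comp (list_append.comp (hu.comp fst)
    (list_cons.comp (hl.comp fst) (list_cons.comp (hk.comp fst) (const [])))) (hv.comp fst))

theorem primrecPred_isRule :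
    PrimrecPred fun p : ℕ × Command × BraidWord => p.2.1.IsRule p.1 p.2.2 := by
  have hc : Primrec fun p : ℕ × Command × BraidWord => p.2.1 := fst.comp snd
  have hu : Primrec fun c : Command => c.2.2.1 := fst.comp (snd.comp snd)
  have hv : Primrec fun c : Command => c.2.2.2.1 := fst.comp (snd.comp (snd.comp snd))
  have hmem : PrimrecPred fun p : ℕ × Command × BraidWord => p.2.1.1 ∈ codedRules :=
    (((Primrec.eq (α := ℕ × BraidWord × Combination)).exists_mem_list).comp
      (const codedRules) (fst.comp hc)).of_eq fun p => by simp
  exact hmem.and ((nat_le.comp (nat_add.comp (fst.comp (snd.comp hc)) (fst.comp (fst.comp hc)))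
    fst).and (PrimrecRel.comp (R := fun u v : BraidWord => u = v) Primrec.eq (snd.comp snd)
      (list_append.comp (list_append.comp (hu.comp hc) (primrec_shift.comp (fst.comp (snd.comp hc))
        (fst.comp (snd.comp (fst.comp hc))))) (hv.comp hc))))

theorem primrecRel_isComm : PrimrecRel Command.IsComm := by
  have hu : Primrec fun c : Command => c.2.2.1 := fst.comp (snd.comp snd)
  have hv : Primrec fun c : Command => c.2.2.2.1 := fst.comp (snd.comp (snd.comp snd))
  have hk : Primrec fun c : Command => c.2.2.2.2.1 := fst.comp (snd.comp (snd.comp (snd.comp snd)))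
  have hl : Primrec fun c : Command => c.2.2.2.2.2 := snd.comp (snd.comp (snd.comp (snd.comp snd)))
  exact ((nat_lt.comp (succ.comp (fst.comp (hk.comp fst))) (fst.comp (hl.comp fst))).or
    (nat_lt.comp (succ.comp (fst.comp (hl.comp fst))) (fst.comp (hk.comp fst)))).and
    (PrimrecRel.comp (R := fun u v : BraidWord => u = v) Primrec.eq snd
      (list_append.comp (list_append.comp (hu.comp fst)
        (list_cons.comp (hk.comp fst) (list_cons.comp (hl.comp fst) (const [])))) (hv.comp fst)))

set_option synthInstance.maxSize 1000 in
theorem primrec_step : Primrec fun p : ℕ × Combination × Command => step p.1 p.2.1 p.2.2 := by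
  classical
  have h : Primrec₂ fun (p : ℕ × Combination × Command)
      (q : ((PolyCode × PolyCode) × BraidWord) × Combination) =>
      if p.2.2.IsRule p.1 q.1.2 then p.2.2.replace q.1 ++ q.2 else
        if p.2.2.IsComm q.1.2 then p.2.2.swap q.1 :: q.2 else q.2 ++ [q.1] := by
    have hc : Primrec fun x : (ℕ × Combination × Command) ×
        ((PolyCode × PolyCode) × BraidWord) × Combination => x.1.2.2 :=
      snd.comp (snd.comp fst)
    exact Primrec.ite (primrecPred_isRule.comp
      (.pair (fst.comp fst) (.pair hc (snd.comp (fst.comp snd)))))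
      (list_append.comp (primrec_replace.comp hc (fst.comp snd)) (snd.comp snd))
      (Primrec.ite (primrecRel_isComm.comp hc (snd.comp (fst.comp snd)))
        (list_cons.comp (primrec_swap.comp hc (fst.comp snd)) (snd.comp snd))
        (list_append.comp (snd.comp snd) (list_cons.comp (fst.comp snd) (const []))))
  refine (list_casesOn (fst.comp snd) (const []) h).of_eq fun ⟨n, d, c⟩ => ?_
  cases d with
  | nil => rfl
  | cons t d => simp only [step]

set_option synthInstance.maxSize 1000 in
theorem primrec_run : Primrec fun p : ℕ × Combination × List Command => run p.1 p.2.1 p.2.2 := by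
  have h : Primrec₂ fun (p : ℕ × Combination × List Command) (q : Combination × Command) =>
      step p.1 q.1 q.2 := primrec_step.comp (.pair (fst.comp fst) snd)
  exact list_foldl (snd.comp snd) (fst.comp snd) h

open Classical in
/-- The combination that the list of commands with code `k` produces from a word in the letters of
`B_n`, provided that all its words are as wanted. -/
def attempt (p : ℕ × BraidWord) (k : ℕ) : Option Combination :=
  if 3 ≤ p.1 ∧ IsBraidWord p.1 p.2 then
    (Encodable.decode k : Option (List Command)).bind fun cs =>
      if ∀ t ∈ run p.1 [(([(1, 0, 0)], [(1, 0, 0)]), p.2)] cs, IsTarget (p.1 - 1) t.2 then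
        some (run p.1 [(([(1, 0, 0)], [(1, 0, 0)]), p.2)] cs)
      else none
  else some []

theorem primrec_attempt : Primrec₂ attempt := by
  classical
  have hrun : Primrec fun x : ((ℕ × BraidWord) × ℕ) × List Command =>
      run x.1.1.1 [(([(1, 0, 0)], [(1, 0, 0)]), x.1.1.2)] x.2 :=
    primrec_run.comp (.pair (fst.comp (fst.comp fst)) (.pair
      (list_cons.comp (.pair (const _) (snd.comp (fst.comp fst))) (const [])) snd))
  have htar : PrimrecRel fun (d : Combination) (m : ℕ) => ∀ t ∈ d, IsTarget m t.2 := by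
    have : PrimrecRel fun (t : (PolyCode × PolyCode) × BraidWord) (m : ℕ) => IsTarget m t.2 :=
      primrecRel_isTarget.comp (snd.comp fst) snd
    exact this.forall_mem_list
  have h : Primrec₂ fun (x : (ℕ × BraidWord) × ℕ) (cs : List Command) =>
      if ∀ t ∈ run x.1.1 [(([(1, 0, 0)], [(1, 0, 0)]), x.1.2)] cs, IsTarget (x.1.1 - 1) t.2 then
        some (run x.1.1 [(([(1, 0, 0)], [(1, 0, 0)]), x.1.2)] cs)
      else none :=
    Primrec.ite (htar.comp hrun (pred.comp (fst.comp (fst.comp fst)))) (option_some.comp hrun)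
      (const none)
  refine (Primrec.ite (((nat_le.comp (const 3) (fst.comp fst))).and
    (primrecRel_isBraidWord.comp (snd.comp fst) (fst.comp fst)))
    (option_bind (Primrec.decode.comp snd) h) (const (some []))).of_eq fun ⟨p, k⟩ => ?_
  simp only [attempt]

end Primrec

theorem attempt_spec {p : ℕ × BraidWord} {k : ℕ} {d : Combination} (hn : 3 ≤ p.1)
    (hw : IsBraidWord p.1 p.2) (h : d ∈ attempt p k) :
    (∀ t ∈ d, polyVal t.1.2 ≠ 0 ∧ IsReducedWord p.1 t.2) ∧
      combVal p.1 d = braidClass p.1 (evalWord p.1 p.2) := by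
  rw [attempt, if_pos ⟨hn, hw⟩, Option.mem_def, Option.bind_eq_some_iff] at h
  obtain ⟨cs, -, h⟩ := h
  split_ifs at h with ht
  cases h
  have hv : Valid [(([(1, 0, 0)], [(1, 0, 0)]), p.2)] := by
    intro t h
    rw [List.mem_singleton.1 h]
    exact polyVal_one.trans_ne one_ne_zero
  refine ⟨fun t h => ⟨hv.run cs t h, ?_⟩, ?_⟩
  · have := (ht t h).isReducedWord
    rwa [Nat.sub_add_cancel (by omega)] at this
  · rw [combVal_run, combVal_cons, combVal_nil, add_zero]
    dsimp only
    rw [polyVal_one, div_one, one_smul]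

theorem exists_attempt (p : ℕ × BraidWord) : ∃ k d, d ∈ attempt p k := by
  by_cases h : 3 ≤ p.1 ∧ IsBraidWord p.1 p.2
  · obtain ⟨n, w⟩ := p
    obtain ⟨h3, hw⟩ := h
    obtain ⟨m, rfl⟩ : ∃ m, n = m + 1 := ⟨n - 1, by dsimp only at h3; omega⟩
    obtain ⟨cs, d, hd, hrun⟩ := exists_run (reduces_target m w hw) ([(1, 0, 0)], [(1, 0, 0)]) []
    refine ⟨Encodable.encode cs, d, ?_⟩
    rw [List.nil_append] at hrun
    rw [attempt, if_pos ⟨h3, hw⟩, Encodable.encodek, Option.mem_def, Option.bind_some]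
    simp only [Nat.add_sub_cancel]
    rw [hrun]
    exact if_pos hd
  · exact ⟨0, [], by rw [attempt, if_neg h]; rfl⟩

/-- The reduction algorithm searches for a list of commands that succeeds. -/
theorem exists_computable_reduction : ∃ red : ℕ × BraidWord → Combination, Computable red ∧
    ∀ n : ℕ, 3 ≤ n → IsReduction n (fun w => red (n, w)) := by
  have hdom (p) : (Nat.rfindOpt (attempt p)).Dom := Nat.rfindOpt_dom.2 (exists_attempt p)
  refine ⟨fun p => (Nat.rfindOpt (attempt p)).get (hdom p), ?_, fun n hn w hw => ?_⟩
  · exact (Partrec.rfindOpt primrec_attempt.to_comp).of_eq fun p => (Part.some_get (hdom p)).symm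
  · obtain ⟨k, hk⟩ := Nat.rfindOpt_spec (Part.get_mem (hdom (n, w)))
    exact attempt_spec (p := (n, w)) hn hw hk

/-! ### The decomposition of `C_n` -/

theorem exists_braidWord {n : ℕ} (b : BraidGroup n) :
    ∃ w, IsBraidWord n w ∧ evalWord n w = b := by
  obtain ⟨x, rfl⟩ := QuotientGroup.mk_surjective b
  have hgen (i : BraidGen n) : sigma n i.1 = QuotientGroup.mk (FreeGroup.of i) := by
    rw [sigma, dif_pos i.2]
    rfl
  induction x using FreeGroup.induction_on with
  | C1 => exact ⟨[], isBraidWord_nil n, rfl⟩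
  | of i =>
    refine ⟨[(i.1, true)], isBraidWord_cons.2 ⟨i.2, isBraidWord_nil n⟩, ?_⟩
    rw [evalWord_cons_true, evalWord_nil, mul_one]
    exact hgen i
  | inv_of i _ =>
    refine ⟨[(i.1, false)], isBraidWord_cons.2 ⟨i.2, isBraidWord_nil n⟩, ?_⟩
    rw [evalWord_cons_false, evalWord_nil, mul_one]
    exact congrArg _ (hgen i)
  | mul x y hx hy =>
    obtain ⟨u, hu, hu'⟩ := hx
    obtain ⟨v, hv, hv'⟩ := hy
    exact ⟨u ++ v, hu.append hv, by rw [evalWord_append, hu', hv']; rfl⟩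

theorem top_le_of_forall_braidWord {n : ℕ} (S : Submodule K (C n))
    (h : ∀ w, IsBraidWord n w → braidClass n (evalWord n w) ∈ S) : ⊤ ≤ S := by
  intro x _
  obtain ⟨f, rfl⟩ : ∃ f, toC n f = x := (skeinIdeal n).ringCon.mk'_surjective x
  induction f using MonoidAlgebra.induction_on with
  | of b =>
    obtain ⟨w, hw, rfl⟩ := exists_braidWord b
    exact h w hw
  | add f g hf hg =>
    rw [map_add]
    exact S.add_mem (hf trivial) (hg trivial)
  | smul r f hf =>
    rw [map_smul]
    exact S.smul_mem r (hf trivial)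

theorem linVal_mem {n : ℕ} (S : Submodule K (C n)) (c : List (K × BraidWord))
    (h : ∀ t ∈ c, braidClass n (evalWord n t.2) ∈ S) : linVal n c ∈ S := by
  refine S.list_sum_mem fun x hx => ?_
  obtain ⟨t, ht, rfl⟩ := List.mem_map.1 hx
  exact S.smul_mem _ (h t ht)

/-- The class of a word lies in the span of the classes of the words that it reduces to. -/
theorem Reduces.braidClass_mem {n : ℕ} {T : BraidWord → Prop} {w : BraidWord} (h : Reduces n T w)
    (S : Submodule K (C n)) (hS : ∀ w, T w → braidClass n (evalWord n w) ∈ S) :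
    braidClass n (evalWord n w) ∈ S := by
  induction h with
  | base hw => exact hS _ hw
  | @rule r i u v hr hi _ ih =>
    have hh : r.Holds n i := holds_of_mem_rules hr hi
    have hc := linVal_context n 1 u v (shiftTerms i r.2.2)
    rw [one_smul] at hc
    rw [Rule.Holds] at hh
    rw [evalWord_append, evalWord_append, braidClass_mul, braidClass_mul, hh, ← hc]
    refine linVal_mem S _ fun t ht => ?_
    obtain ⟨q, hq, rfl⟩ := List.mem_map.1 ht
    obtain ⟨p, hp, rfl⟩ := List.mem_map.1 hq
    exact ih p hp
  | comm u v hkl _ ih =>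
    rw [evalWord_append, evalWord_append] at ih ⊢
    rwa [evalWord_comm n hkl]

theorem top_le_of_forall_isTarget {m : ℕ} (S : Submodule K (C (m + 1)))
    (h : ∀ w, IsTarget m w → braidClass (m + 1) (evalWord (m + 1) w) ∈ S) : ⊤ ≤ S :=
  top_le_of_forall_braidWord S fun w hw => (reduces_target m w hw).braidClass_mem S h

theorem braidIncl_evalWord {m n : ℕ} (h : m ≤ n) {w : BraidWord} (hw : IsBraidWord m w) :
    braidIncl h (evalWord m w) = evalWord n w := by
  induction w with
  | nil => exact map_one _
  | cons l w ih =>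
    obtain ⟨k, _ | _⟩ := l <;> rw [isBraidWord_cons] at hw
    · rw [evalWord_cons_false, evalWord_cons_false, map_mul, ih hw.2, map_inv,
        braidIncl_sigma h hw.1]
    · rw [evalWord_cons_true, evalWord_cons_true, map_mul, ih hw.2, braidIncl_sigma h hw.1]

theorem braidClass_mem_imC {m n : ℕ} (h : m ≤ n) {w : BraidWord} (hw : IsBraidWord m w) :
    braidClass n (evalWord n w) ∈ imC h := by
  refine ⟨braidClass m (evalWord m w), ?_⟩
  have : CMap h (braidClass m (evalWord m w)) =
      toC n (MonoidAlgebra.mapDomainAlgHom K K (braidIncl h) (grp (evalWord m w))) := rfl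
  rw [AlgHom.toLinearMap_apply, this, map_grp, braidIncl_evalWord h hw]
  rfl

theorem top_eq_sup (n : ℕ) (hn : 3 ≤ n) :
    (⊤ : Submodule K (C n)) =
      imC (Nat.sub_le n 1) ⊔
      imC (Nat.sub_le n 1) * Submodule.span K {s n (n - 1)} * imC (Nat.sub_le n 1) ⊔
      imC (Nat.sub_le n 1) * Submodule.span K {sbar n (n - 1)} * imC (Nat.sub_le n 1) ⊔
      imC (Nat.sub_le n 2) *
        Submodule.span K {sbar n (n - 1) * s n (n - 2) * sbar n (n - 1)} := by
  obtain ⟨m, rfl⟩ : ∃ m, n = m + 1 := ⟨n - 1, by omega⟩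
  refine le_antisymm (top_le_of_forall_isTarget _ fun w hw => ?_) le_top
  rcases hw.isReducedWord with h | ⟨u, v, e, hu, hv, rfl⟩ | ⟨u, hu, rfl⟩
  · exact Submodule.mem_sup_left (Submodule.mem_sup_left (Submodule.mem_sup_left
      (braidClass_mem_imC _ h)))
  · rw [evalWord_append, evalWord_append, braidClass_mul, braidClass_mul]
    have hu' := braidClass_mem_imC (Nat.sub_le (m + 1) 1) hu
    have hv' := braidClass_mem_imC (Nat.sub_le (m + 1) 1) hv
    cases e
    · rw [evalWord_cons_false, evalWord_nil, mul_one]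
      exact Submodule.mem_sup_left (Submodule.mem_sup_right (Submodule.mul_mem_mul
        (Submodule.mul_mem_mul hu' (Submodule.mem_span_singleton_self _)) hv'))
    · rw [evalWord_cons_true, evalWord_nil, mul_one]
      exact Submodule.mem_sup_left (Submodule.mem_sup_left (Submodule.mem_sup_right
        (Submodule.mul_mem_mul
          (Submodule.mul_mem_mul hu' (Submodule.mem_span_singleton_self _)) hv')))
  · rw [evalWord_append, braidClass_mul, evalWord_cons_false, evalWord_cons_true,
      evalWord_cons_false, evalWord_nil, mul_one, braidClass_mul, braidClass_mul]
    exact Submodule.mem_sup_right (Submodule.mul_mem_mul (braidClass_mem_imC _ hu)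
      (Submodule.mem_span_singleton.2 ⟨1, (one_smul K _).trans (mul_assoc _ _ _)⟩))

theorem isBraidWord_one {w : BraidWord} (hw : IsBraidWord 1 w) : w = [] := by
  rcases w with _ | ⟨l, w⟩
  · rfl
  · have := (isBraidWord_cons.1 hw).1
    omega

/-- For at most two strands, the words with at most one letter suffice. -/
theorem mem_lowWords_of_isTarget {m : ℕ} (hm : m ≤ 1) {w : BraidWord} (hw : IsTarget m w) :
    w ∈ lowWords := by
  rcases hw with hw | ⟨h, -⟩
  · rcases hw.cases with h | ⟨h, u, v, e, hu, hv, rfl⟩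
    · rw [isBraidWord_one (h.mono hm)]
      simp [lowWords]
    · obtain rfl : m = 1 := by omega
      rw [isBraidWord_one hu, isBraidWord_one hv]
      cases e <;> simp [lowWords]
  · omega

theorem finiteDimensional_of_lowWords {n : ℕ}
    (h : ∀ S : Submodule K (C n), (∀ w ∈ lowWords, braidClass n (evalWord n w) ∈ S) → ⊤ ≤ S) :
    FiniteDimensional K (C n) := by
  classical
  refine Module.finite_def.2 ?_
  rw [← top_le_iff.1 (h (Submodule.span K
    ((lowWords.map fun w => braidClass n (evalWord n w)).toFinset : Set (C n))) ?_)]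
  · exact ⟨_, rfl⟩
  · intro w hw
    exact Submodule.subset_span (by simpa using ⟨w, hw, rfl⟩)

theorem finiteDimensional_C (n : ℕ) : FiniteDimensional K (C n) := by
  induction n using Nat.strong_induction_on with
  | _ n ih =>
    rcases Nat.lt_or_ge n 3 with hn | hn
    · refine finiteDimensional_of_lowWords fun S hS => ?_
      rcases n with _ | m
      · refine top_le_of_forall_braidWord S fun w hw => ?_
        rw [isBraidWord_one (hw.mono zero_le_one)]
        exact hS _ (by simp [lowWords])
      · exact top_le_of_forall_isTarget S fun w hw =>
          hS w (mem_lowWords_of_isTarget (by omega) hw)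
    · have hfg {m : ℕ} (h : m ≤ n) (hm : m < n) : (imC h).FG := by
        rw [imC, LinearMap.range_eq_map]
        exact (Module.finite_def.1 (ih m hm)).map _
      have h1 := hfg (Nat.sub_le n 1) (by omega)
      have h2 := hfg (Nat.sub_le n 2) (by omega)
      refine Module.finite_def.2 ?_
      rw [top_eq_sup n hn]
      exact ((h1.sup ((h1.mul (Submodule.fg_span_singleton _)).mul h1)).sup
        ((h1.mul (Submodule.fg_span_singleton _)).mul h1)).sup
        (h2.mul (Submodule.fg_span_singleton _))

end

end LinksGould

open LinksGould in
theorem theorem2 :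
    -- a uniform effective reduction algorithm
    (∃ red : ℕ × BraidWord → Combination, Computable red ∧
      ∀ n : ℕ, 3 ≤ n → IsReduction n (fun w => red (n, w))) ∧
    -- the resulting equality of `ℚ(t₀, t₁)`-vector spaces
    (∀ n : ℕ, 3 ≤ n →
      (⊤ : Submodule K (C n)) =
        imC (Nat.sub_le n 1) ⊔
        imC (Nat.sub_le n 1) * Submodule.span K {s n (n - 1)} * imC (Nat.sub_le n 1) ⊔
        imC (Nat.sub_le n 1) * Submodule.span K {sbar n (n - 1)} * imC (Nat.sub_le n 1) ⊔
        imC (Nat.sub_le n 2) *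
          Submodule.span K {sbar n (n - 1) * s n (n - 2) * sbar n (n - 1)}) ∧
    -- finite-dimensionality
    (∀ n : ℕ, FiniteDimensional K (C n)) :=
  ⟨exists_computable_reduction, top_eq_sup, finiteDimensional_C⟩
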